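/- Consider the potential hyperbolic heat equation $$u_{tt}+u_t=\frac{u_{xx}}{u_x}$$ for real functions $u(t,x)$. Let $J$ be the space of first-order jets, with coordinates $(t,x,u,u_t,u_x)$, and let $\Omega$ be either of the two regions $\{u_x>0\}$, $\{u_x<0\}$ of $J$. A contact symmetry with open domain $U\subseteq J$ is a smooth diffeomorphism $\Gamma$ of $U$ onto an open subset of $\{u_x\neq 0\}$ that maps the kernel of the contact form $du-u_t\,dt-u_x\,dx$ into itself and whose prolongation to second derivatives, wherever it is defined, maps jets that satisfy the equation to jets that satisfy the equation. A generator on $U$ is a smooth vector field on $U$ whose local flow consists of contact symmetries. Continuous symmetries of $\Omega$ are the elements of the group generated by all smooth one-parameter groups of contact symmetries of $\Omega$ onto itself; two contact symmetries on $U\subseteq\Omega$ are equivalent if they differ by composition on the left with a continuous symmetry of $\Omega$. Then the following hold. (a) For every nonempty connected open set $U\subseteq\Omega$, the generators on $U$ form a five-dimensional real Lie algebra with basis $$X_1=\partial_t,\quad X_2=\partial_x,\quad X_3=\partial_u,\quad X_4=e^{-t}\partial_u-e^{-t}\partial_{u_t},\quad X_5=-x\partial_x+u\partial_u+u_t\partial_{u_t}+2u_x\partial_{u_x}.$$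 (b) Let $$\Gamma_1:(t,x,u,u_t,u_x)\mapsto(t,-x,-u,-u_t,u_x),$$ $$\Gamma_2:(t,x,u,u_t,u_x)\mapsto\left(t+\ln|u_x|,\;u+u_t,\;x+\frac{u_t}{u_x},\;-\frac{u_t}{u_x},\;\frac1{u_x}\right).$$ The contact symmetries of $\Omega$ onto itself form a group, in which the continuous symmetries form a normal subgroup. The group $\langle\Gamma_1,\Gamma_2\rangle$ consists of contact symmetries of $\Omega$ onto itself, is isomorphic to $\mathbb Z_2\times\mathbb Z_2$ with $\Gamma_1,\Gamma_2$ corresponding to the two standard generators, and is a complement of that normal subgroup. So the inequivalent discrete contact symmetries form the group $\mathbb Z_2\times\mathbb Z_2$ generated by $\Gamma_1$ and $\Gamma_2$. (c) For every nonempty connected open set $U\subseteq\Omega$, every contact symmetry $\Gamma$ on $U$ is equivalent on $U$ to exactly one element of $\langle\Gamma_1,\Gamma_2\rangle$. Moreover, $\Gamma$ is not a point transformation (that is, the new $t,x,u$ are not functions of the old $t,x,u$ alone) if and only if it is equivalent to $\Gamma_2$ or to $\Gamma_1\Gamma_2$. -/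

import Mathlib

open Set
open scoped ContDiff

noncomputable section

namespace HyperbolicHeat

/-- The space of first-order jets of real functions `u(t, x)`. The coordinates of `z` are
`z 0 = t`, `z 1 = x`, `z 2 = u`, `z 3 = u_t`, `z 4 = u_x`. -/
abbrev Jet : Type := Fin 5 → ℝ

/-- For `κ = 1` the region `u_x > 0`, for `κ = -1` the region `u_x < 0`. These are the two connected
components of the set `u_x ≠ 0` on which the equation `u_tt + u_t = u_xx / u_x` is defined. -/
def region (κ : ℤˣ) : Set Jet := {z | 0 < ((κ : ℤ) : ℝ) * z 4}

/-- The contact form `du - u_t dt - u_x dx` at `z`, evaluated at the tangent vector `v`. -/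
def contactForm (z v : Jet) : ℝ := v 2 - z 3 * v 0 - z 4 * v 1

/-- The integral element of the contact system over `z` given by the second derivatives
`u_tt = s`, `u_tx = m`, `u_xx = r`: the plane spanned by the truncated total derivatives
`D_t = ∂_t + u_t ∂_u + u_tt ∂_{u_t} + u_tx ∂_{u_x}` and
`D_x = ∂_x + u_x ∂_u + u_tx ∂_{u_t} + u_xx ∂_{u_x}`. It is the tangent plane of the 1-graph of every
function with this second-order jet. -/
def integralElement (z : Jet) (s m r : ℝ) : Submodule ℝ Jet :=
  Submodule.span ℝ {![1, 0, z 3, s, m], ![0, 1, z 4, m, r]}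

/-- The equation `u_tt + u_t = u_xx / u_x`, as a condition on second-order jets. -/
def OnEquation (z : Jet) (s _m r : ℝ) : Prop := s + z 3 = r / z 4

/-- `Γ` is a contact symmetry of the equation with (open) domain `U`: a diffeomorphism from `U` onto
an open subset of `u_x ≠ 0` that preserves the contact structure and whose prolongation to second
derivatives preserves the equation. The prolongation sends `(s, m, r)` over `z` to the
`(s', m', r')` over `Γ z` whose integral element is the image of that of `(s, m, r)` under the
derivative of `Γ`, which is the rule `D û_t = û_tt D t̂ + û_tx D x̂`, `D û_x = û_tx D t̂ + û_xx D x̂`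
for `D = D_t, D_x`. -/
structure IsContactSymmetryOn (U : Set Jet) (Γ : Jet → Jet) : Prop where
  smooth : ContDiffOn ℝ ∞ Γ U
  injOn : InjOn Γ U
  bijective_fderiv : ∀ z ∈ U, Function.Bijective (fderiv ℝ Γ z)
  ux_ne_zero : ∀ z ∈ U, Γ z 4 ≠ 0
  contact : ∀ z ∈ U, ∀ v, contactForm z v = 0 → contactForm (Γ z) (fderiv ℝ Γ z v) = 0
  symmetry : ∀ z ∈ U, ∀ s m r s' m' r' : ℝ, OnEquation z s m r →
    (integralElement z s m r).map (fderiv ℝ Γ z : Jet →ₗ[ℝ] Jet) =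
      integralElement (Γ z) s' m' r' →
    OnEquation (Γ z) s' m' r'

/-- `Γ` is a point transformation on `U`: the new `t, x, u` depend on `t, x, u` only. -/
def IsPointOn (U : Set Jet) (Γ : Jet → Jet) : Prop :=
  ∀ z ∈ U, ∀ w ∈ U, z 0 = w 0 → z 1 = w 1 → z 2 = w 2 →
    Γ z 0 = Γ w 0 ∧ Γ z 1 = Γ w 1 ∧ Γ z 2 = Γ w 2

/-- The vector field `X` on `U` is the infinitesimal generator of a local one-parameter Lie group of
contact symmetries: `X` is smooth on `U`, and near every point of `U` its flow `φ` consists of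
contact symmetries. -/
def IsContactGenerator (U : Set Jet) (X : Jet → Jet) : Prop :=
  ContDiffOn ℝ ∞ X U ∧
  ∀ z ∈ U, ∃ ε : ℝ, 0 < ε ∧ ∃ V : Set Jet, IsOpen V ∧ z ∈ V ∧ V ⊆ U ∧ ∃ φ : ℝ → Jet → Jet,
    ContDiffOn ℝ ∞ (fun a : ℝ × Jet => φ a.1 a.2) (Ioo (-ε) ε ×ˢ V) ∧
    (∀ w ∈ V, φ 0 w = w) ∧
    (∀ s ∈ Ioo (-ε) ε, ∀ w ∈ V,
      φ s w ∈ U ∧ HasDerivAt (fun τ => φ τ w) (X (φ s w)) s) ∧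
    ∀ s ∈ Ioo (-ε) ε, IsContactSymmetryOn V (φ s)

/-- The vector fields `X₁ = ∂_t`, `X₂ = ∂_x`, `X₃ = ∂_u`, `X₄ = e^{-t} ∂_u - e^{-t} ∂_{u_t}`,
`X₅ = -x ∂_x + u ∂_u + u_t ∂_{u_t} + 2 u_x ∂_{u_x}`. -/
def basisField : Fin 5 → Jet → Jet :=
  ![fun _ => ![1, 0, 0, 0, 0],
    fun _ => ![0, 1, 0, 0, 0],
    fun _ => ![0, 0, 1, 0, 0],
    fun z => ![0, 0, Real.exp (-z 0), -Real.exp (-z 0), 0],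
    fun z => ![0, -z 1, z 2, z 3, 2 * z 4]]

open Classical in
/-- A permutation of a region, extended by the identity to a map of the whole jet space. -/
def extend {κ : ℤˣ} (σ : Equiv.Perm (region κ)) (z : Jet) : Jet :=
  if h : z ∈ region κ then (σ ⟨z, h⟩ : Jet) else z

/-- The contact symmetries that map the region `κ` onto itself. -/
def contactSymmetries (κ : ℤˣ) : Set (Equiv.Perm (region κ)) :=
  {σ | IsContactSymmetryOn (region κ) (extend σ)}

/-- The group generated by the contact symmetries of the region `κ`. -/
def symmetryGroup (κ : ℤˣ) : Subgroup (Equiv.Perm (region κ)) :=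
  Subgroup.closure (contactSymmetries κ)

/-- A one-parameter Lie group of contact symmetries of the region `κ`. -/
structure IsOneParameterGroup {κ : ℤˣ}
    (φ : Multiplicative ℝ →* Equiv.Perm (region κ)) : Prop where
  smooth : ContDiffOn ℝ ∞ (fun a : ℝ × Jet => extend (φ (Multiplicative.ofAdd a.1)) a.2)
    (univ ×ˢ region κ)
  mem : ∀ s, φ s ∈ contactSymmetries κ

/-- The group of continuous symmetries: it is generated by all one-parameter Lie groups of contact
symmetries. -/
def continuousGroup (κ : ℤˣ) : Subgroup (Equiv.Perm (region κ)) :=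
  Subgroup.closure {σ | ∃ φ : Multiplicative ℝ →* Equiv.Perm (region κ),
    IsOneParameterGroup φ ∧ ∃ s, φ s = σ}

/-- `Γ` and `d` are equivalent on `U`: they differ by a continuous symmetry. -/
def EquivalentOn {κ : ℤˣ} (U : Set Jet) (Γ : Jet → Jet) (d : Equiv.Perm (region κ)) : Prop :=
  ∃ g ∈ continuousGroup κ, ∀ z : region κ, (z : Jet) ∈ U → Γ z = (g (d z) : Jet)

/-- `(t, x, u, u_t, u_x) ↦ (t, -x, -u, -u_t, u_x)`. -/
def map₁ (z : Jet) : Jet := ![z 0, -z 1, -z 2, -z 3, z 4]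

/-- `(t, x, u, u_t, u_x) ↦ (t + ln |u_x|, u + u_t, x + u_t / u_x, -u_t / u_x, 1 / u_x)`. -/
def map₂ (z : Jet) : Jet :=
  ![z 0 + Real.log |z 4|, z 2 + z 3, z 1 + z 3 / z 4, -(z 3 / z 4), 1 / z 4]

theorem ne_zero_of_mem {κ : ℤˣ} {z : Jet} (hz : z ∈ region κ) : z 4 ≠ 0 := by
  intro h
  simp [region, h] at hz

theorem map₁_mem {κ : ℤˣ} {z : Jet} (hz : z ∈ region κ) : map₁ z ∈ region κ := by
  simpa [region, map₁] using hz

theorem map₂_mem {κ : ℤˣ} {z : Jet} (hz : z ∈ region κ) : map₂ z ∈ region κ := by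
  have h0 := ne_zero_of_mem hz
  have h1 : 0 < ((κ : ℤ) : ℝ) * z 4 := hz
  have h2 : ((κ : ℤ) : ℝ) * (1 / z 4) = (((κ : ℤ) : ℝ) * z 4) / z 4 ^ 2 := by field_simp
  have h3 : 0 < ((κ : ℤ) : ℝ) * (1 / z 4) := by rw [h2]; positivity
  simpa [region, map₂] using h3

theorem map₁_map₁ (z : Jet) : map₁ (map₁ z) = z := by
  ext i
  fin_cases i <;> simp [map₁]

theorem map₂_map₂ {z : Jet} (hz : z 4 ≠ 0) : map₂ (map₂ z) = z := by
  ext i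
  fin_cases i <;> simp [map₂, abs_inv, Real.log_inv] <;> field_simp
  ring

/-- The point reflection `Γ₁`, as a permutation of the region `κ`. -/
def Γ₁ (κ : ℤˣ) : Equiv.Perm (region κ) :=
  Function.Involutive.toPerm (fun z => ⟨map₁ z, map₁_mem z.2⟩)
    (fun z => Subtype.ext (map₁_map₁ z))

/-- The contact transformation `Γ₂`, as a permutation of the region `κ`. -/
def Γ₂ (κ : ℤˣ) : Equiv.Perm (region κ) :=
  Function.Involutive.toPerm (fun z => ⟨map₂ z, map₂_mem z.2⟩)
    (fun z => Subtype.ext (map₂_map₂ (ne_zero_of_mem z.2)))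

/-- The group generated by `Γ₁` and `Γ₂`. -/
def discreteGroup (κ : ℤˣ) : Subgroup (Equiv.Perm (region κ)) :=
  Subgroup.closure {Γ₁ κ, Γ₂ κ}

end HyperbolicHeat

end

open HyperbolicHeat

open Set
open scoped ContDiff

namespace HyperbolicHeat

/-! Write p = u_t and q = u_x. An integral element (s, m, r) lies on the equation exactly when the
two-form `heatForm` vanishes on it. The first step replaces the condition on second-order jets by a
pointwise condition on the derivative of Γ. A contact map scales the contact form θ, hence scales dθ
on the hyperplane θ = 0. If it also respects the equation, then it scales `heatForm` on that
hyperplane. This is `IsContactSymmetryOn.preservesAt`, with converse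
`isContactSymmetryOn_of_preservesAt`. The condition `PreservesAt` is stable under composition and
inversion, and it can be differentiated along a flow.

Generators: differentiating `PreservesAt` along a flow gives linear equations for the vector field,
which reduce to four determining equations for one generating function f. They are solved by pure
differentiation and elimination in a commutative ring with derivations (`HeatFrame`, `JetFrame`).
The key relation is that 2 f_p - 3 f_u + f_x / q is annihilated by all five derivations. Further
elimination kills almost all second derivatives of f, and five constants remain (`exists_field_eq`).
Conversely, each combination of the basis fields integrates to an explicit flow in the
five-parameter family `groupMap`.

Arbitrary contact symmetries are treated by the algebraic method. Pulling back generators along Γ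
gives generators, so Γ induces an automorphism of the five-dimensional Lie algebra
(`IsContactSymmetryOn.exists_automorphism`). The bracket relations force this automorphism either to
keep the lines of ∂_x and ∂_u or to exchange them (`automorphism_derived`). In the first case the
automorphism together with `PreservesAt` determines Γ pointwise (`eq_of_automorphism`): it is a
`groupMap`, possibly after Γ₁. In the second case composition with Γ₂ leads back to the first. This
gives `IsContactSymmetryOn.exists_groupMap`, on every connected open set.

Groups: the discrete group normalizes the five-parameter group and consists of elements of square 1,
so the square of any contact symmetry of the region lies in the five-parameter group. Every member
of a one-parameter group is a square, whence `continuousGroup_eq`. Normality, the complement and the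
uniqueness of the discrete factor then follow by comparing explicit formulas. -/

/-! ### The equation as a two-form on contact hyperplanes. -/

/-- The effective two-form `q dp ∧ dx + dq ∧ dt + p q dt ∧ dx` of the equation. -/
def heatForm (z v w : Jet) : ℝ :=
  z 4 * (v 3 * w 1 - v 1 * w 3) + (v 4 * w 0 - v 0 * w 4) + z 3 * z 4 * (v 0 * w 1 - v 1 * w 0)

/-- The canonical two-form `dt ∧ dp + dx ∧ dq`. -/
def canonicalForm (v w : Jet) : ℝ := v 0 * w 3 - v 3 * w 0 + (v 1 * w 4 - v 4 * w 1)

/-- The linear map `L` from the tangent space at `z` to the one at `z'` scales the contact form, and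
scales the two-form of the equation on the contact hyperplane. -/
def PreservesAt (z z' : Jet) (L : Jet →L[ℝ] Jet) : Prop :=
  ∃ f l : ℝ, f ≠ 0 ∧ l ≠ 0 ∧ (∀ v, contactForm z' (L v) = f * contactForm z v) ∧
    ∀ v w, contactForm z v = 0 → contactForm z w = 0 →
      heatForm z' (L v) (L w) = l * heatForm z v w

theorem PreservesAt.comp {z z' z'' : Jet} {L L' : Jet →L[ℝ] Jet} (h' : PreservesAt z' z'' L')
    (h : PreservesAt z z' L) : PreservesAt z z'' (L'.comp L) := by
  obtain ⟨f, l, hf, hl, h1, h2⟩ := h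
  obtain ⟨f', l', hf', hl', h1', h2'⟩ := h'
  refine ⟨f' * f, l' * l, mul_ne_zero hf' hf, mul_ne_zero hl' hl, fun v => ?_, fun v w hv hw => ?_⟩
  · simp only [ContinuousLinearMap.comp_apply, h1', h1, mul_assoc]
  · simp only [ContinuousLinearMap.comp_apply]
    rw [h2' _ _ (by rw [h1, hv, mul_zero]) (by rw [h1, hw, mul_zero]), h2 _ _ hv hw, mul_assoc]

theorem PreservesAt.symm {z z' : Jet} {L : Jet →L[ℝ] Jet} (h : PreservesAt z z' L)
    {L' : Jet →L[ℝ] Jet} (hL : ∀ v, L (L' v) = v) : PreservesAt z' z L' := by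
  obtain ⟨f, l, hf, hl, h1, h2⟩ := h
  have key : ∀ v, contactForm z (L' v) = f⁻¹ * contactForm z' v := fun v => by
    rw [eq_inv_mul_iff_mul_eq₀ hf, ← h1, hL]
  refine ⟨f⁻¹, l⁻¹, inv_ne_zero hf, inv_ne_zero hl, key, fun v w hv hw => ?_⟩
  rw [eq_inv_mul_iff_mul_eq₀ hl, ← h2 _ _ (by rw [key, hv, mul_zero]) (by rw [key, hw, mul_zero]),
    hL, hL]

/-- For u_x ≠ 0 the two-form is nondegenerate on the contact hyperplane. A kernel vector of L lies
in that hyperplane and is orthogonal to all of it, so it is zero. -/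
theorem PreservesAt.bijective {z z' : Jet} {L : Jet →L[ℝ] Jet} (hz : z 4 ≠ 0)
    (h : PreservesAt z z' L) : Function.Bijective L := by
  obtain ⟨f, l, hf, hl, h1, h2⟩ := h
  have hinj : Function.Injective (L : Jet →ₗ[ℝ] Jet) := by
    rw [← LinearMap.ker_eq_bot, LinearMap.ker_eq_bot']
    intro v hv
    have hv' : L v = 0 := hv
    have hv0 : contactForm z v = 0 := by
      have := h1 v
      rw [hv'] at this
      simpa [contactForm, hf] using this.symm
    have hw : ∀ w, contactForm z w = 0 → heatForm z v w = 0 := fun w hw => by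
      have := h2 v w hv0 hw
      rw [hv'] at this
      simpa [heatForm, hl] using this.symm
    have e0 := hw ![0, 0, 0, 0, 1] (by simp [contactForm])
    have e1 := hw ![0, 0, 0, 1, 0] (by simp [contactForm])
    have e2 := hw ![1, 0, z 3, 0, 0] (by simp [contactForm])
    have e3 := hw ![0, 1, z 4, 0, 0] (by simp [contactForm])
    simp only [contactForm] at hv0
    simp [heatForm, hz] at e0 e1 e2 e3
    simp only [e0, e1] at e2 e3 hv0
    simp [hz] at e2 e3 hv0
    ext i
    fin_cases i <;> simp [*]
  exact ⟨hinj, LinearMap.injective_iff_surjective.mp hinj⟩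

theorem contactForm_span {z : Jet} {s m r : ℝ} :
    contactForm z ![1, 0, z 3, s, m] = 0 ∧ contactForm z ![0, 1, z 4, m, r] = 0 := by
  simp [contactForm]

/-- On the standard basis of an integral element the two-form equals u_x (u_tt + u_t) - u_xx, and a
change of basis multiplies it by a determinant. So its vanishing characterizes the equation. -/
theorem PreservesAt.onEquation {z z' : Jet} {L : Jet →L[ℝ] Jet} (hz : z 4 ≠ 0) (hz' : z' 4 ≠ 0)
    (h : PreservesAt z z' L) {s m r s' m' r' : ℝ} (he : OnEquation z s m r)
    (hE : (integralElement z s m r).map (L : Jet →ₗ[ℝ] Jet) = integralElement z' s' m' r') :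
    OnEquation z' s' m' r' := by
  obtain ⟨f, l, hf, hl, h1, h2⟩ := h
  have ha : (![1, 0, z' 3, s', m'] : Jet) ∈ integralElement z' s' m' r' :=
    Submodule.subset_span (by simp)
  have hb : (![0, 1, z' 4, m', r'] : Jet) ∈ integralElement z' s' m' r' :=
    Submodule.subset_span (by simp)
  rw [← hE] at ha hb
  obtain ⟨v, hv, hva⟩ := ha
  obtain ⟨w, hw, hwb⟩ := hb
  obtain ⟨a, b, rfl⟩ := Submodule.mem_span_pair.mp hv
  obtain ⟨c, d, rfl⟩ := Submodule.mem_span_pair.mp hw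
  have hk := h2 (a • ![1, 0, z 3, s, m] + b • ![0, 1, z 4, m, r])
    (c • ![1, 0, z 3, s, m] + d • ![0, 1, z 4, m, r])
    (by simp [contactForm]; ring) (by simp [contactForm]; ring)
  erw [hva, hwb] at hk
  simp only [OnEquation] at he ⊢
  rw [eq_div_iff hz] at he
  rw [eq_div_iff hz']
  simp [heatForm] at hk
  have : z' 4 * s' + -r' + z' 3 * z' 4 = l * ((a * d - b * c) * ((s + z 3) * z 4 - r)) := by
    rw [hk]; ring
  rw [he] at this
  linarith

/-- A polynomial identity of the form used for the prolongation. -/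
theorem quadratic_mul_eq_zero {a b c a' b' c' : ℝ}
    (h : ∀ s : ℝ, (a + b * s + c * s ^ 2) * (a' + b' * s + c' * s ^ 2) = 0) :
    (a = 0 ∧ b = 0 ∧ c = 0) ∨ (a' = 0 ∧ b' = 0 ∧ c' = 0) := by
  open Polynomial in
  have h0 : (C a + C b * X + C c * X ^ 2) * (C a' + C b' * X + C c' * X ^ 2) = (0 : ℝ[X]) := by
    refine Polynomial.funext fun s => ?_
    simpa using h s
  have hc : ∀ a b c : ℝ, (Polynomial.C a + Polynomial.C b * Polynomial.X +
      Polynomial.C c * Polynomial.X ^ 2 = 0) → a = 0 ∧ b = 0 ∧ c = 0 := fun a b c h => by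
    have h0 := congrArg (Polynomial.eval 0) h
    have h1 := congrArg (Polynomial.eval 1) h
    have h2 := congrArg (Polynomial.eval (-1)) h
    simp at h0 h1 h2
    refine ⟨h0, ?_, ?_⟩ <;> linarith
  rcases mul_eq_zero.mp h0 with h | h
  · exact Or.inl (hc _ _ _ h)
  · exact Or.inr (hc _ _ _ h)

/-- On the equation, a product of two effective forms on integral elements vanishes identically only
if one of the factors does. -/
theorem effective_mul_eq_zero {p q a b c d e a' b' c' d' e' : ℝ} (hq : q ≠ 0)
    (h : ∀ s m : ℝ, (a + b * s + c * m + d * (q * (s + p)) + e * (s * (q * (s + p)) - m ^ 2)) *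
      (a' + b' * s + c' * m + d' * (q * (s + p)) + e' * (s * (q * (s + p)) - m ^ 2)) = 0) :
    (e = 0 ∧ c = 0 ∧ b = -(q * d) ∧ a = -(p * q * d)) ∨
    (e' = 0 ∧ c' = 0 ∧ b' = -(q * d') ∧ a' = -(p * q * d')) := by
  -- For fixed m both factors are quadratic polynomials in s, so one of them has only zero
  -- coefficients.
  have hm : ∀ m : ℝ, (a + c * m + d * q * p - e * m ^ 2 = 0 ∧ b + d * q + e * q * p = 0 ∧ e * q = 0) ∨
      (a' + c' * m + d' * q * p - e' * m ^ 2 = 0 ∧ b' + d' * q + e' * q * p = 0 ∧ e' * q = 0) :=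
    fun m => quadratic_mul_eq_zero fun s => by rw [← h s m]; ring
  have fin : ∀ a b c d e m n : ℝ, m ≠ n →
      (a + c * m + d * q * p - e * m ^ 2 = 0 ∧ b + d * q + e * q * p = 0 ∧ e * q = 0) →
      (a + c * n + d * q * p - e * n ^ 2 = 0 ∧ b + d * q + e * q * p = 0 ∧ e * q = 0) →
      (e = 0 ∧ c = 0 ∧ b = -(q * d) ∧ a = -(p * q * d)) := by
    rintro a b c d e m n hmn ⟨h1, h2, h3⟩ ⟨h4, -, -⟩
    have he : e = 0 := by simpa [hq] using h3
    subst he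
    have hc : c = 0 := by
      have : c * (m - n) = 0 := by linear_combination h1 - h4
      simpa [sub_ne_zero.mpr hmn] using this
    subst hc
    refine ⟨rfl, rfl, by linarith, by linarith⟩
  -- Among three values of m, two must select the same factor; comparing them isolates the
  -- coefficient of m.
  rcases hm 0 with h0 | h0 <;> rcases hm 1 with h1 | h1 <;> rcases hm 2 with h2 | h2
  all_goals first
    | exact Or.inl (fin _ _ _ _ _ _ _ (by norm_num) h0 h1)
    | exact Or.inl (fin _ _ _ _ _ _ _ (by norm_num) h0 h2)
    | exact Or.inl (fin _ _ _ _ _ _ _ (by norm_num) h1 h2)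
    | exact Or.inr (fin _ _ _ _ _ _ _ (by norm_num) h0 h1)
    | exact Or.inr (fin _ _ _ _ _ _ _ (by norm_num) h0 h2)
    | exact Or.inr (fin _ _ _ _ _ _ _ (by norm_num) h1 h2)


/-! ### Conformal symplectic linear algebra in dimension four. -/

/-- The matrix of the canonical symplectic form in dimension four. -/
def sympl : Matrix (Fin 4) (Fin 4) ℝ := !![0, 0, 1, 0; 0, 0, 0, 1; -1, 0, 0, 0; 0, -1, 0, 0]

theorem sympl_mul_sympl : sympl * sympl = -1 := by
  ext i j
  fin_cases i <;> fin_cases j <;> simp [sympl, Matrix.mul_apply, Fin.sum_univ_four]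

/-- Since the square of the symplectic matrix is -1, the hypothesis exhibits a left inverse of M.
For square matrices it is also a right inverse, and this is the transposed relation. -/
theorem mul_sympl_mul_transpose {M : Matrix (Fin 4) (Fin 4) ℝ} {f : ℝ} (hf : f ≠ 0)
    (h : M.transpose * sympl * M = f • sympl) : M * sympl * M.transpose = f • sympl := by
  have h1 : (-(f⁻¹) • (sympl * M.transpose * sympl)) * M = 1 := by
    rw [Matrix.smul_mul, Matrix.mul_assoc, Matrix.mul_assoc, ← Matrix.mul_assoc M.transpose, h,
      Matrix.mul_smul, sympl_mul_sympl]
    simp [hf]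
  have h2 := mul_eq_one_comm.mp h1
  have h3 := congrArg (fun A => f • (A * sympl)) h2
  simp only [Matrix.mul_smul, Matrix.smul_mul, one_mul] at h3
  rw [← h3]
  simp only [Matrix.mul_assoc, sympl_mul_sympl, smul_smul]
  simp [hf]

/-- A frame of four vectors on which the canonical form is that of the standard frame up to a
factor `f`. -/
structure IsConformalFrame (f : ℝ) (v₁ v₂ v₃ v₄ : Jet) : Prop where
  h12 : canonicalForm v₁ v₂ = 0
  h13 : canonicalForm v₁ v₃ = f
  h14 : canonicalForm v₁ v₄ = 0
  h23 : canonicalForm v₂ v₃ = 0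
  h24 : canonicalForm v₂ v₄ = f
  h34 : canonicalForm v₃ v₄ = 0

/-- If the columns of a matrix form a conformal frame, so do its rows. The rows are the values of
dt, dx, dp, dq on the frame, so the conclusion gives the Poisson brackets of the target coordinates.
The third slot, invisible to `canonicalForm`, is filled with 0. -/
theorem IsConformalFrame.dual {f : ℝ} {v₁ v₂ v₃ v₄ : Jet} (h : IsConformalFrame f v₁ v₂ v₃ v₄)
    (hf : f ≠ 0) :
    IsConformalFrame f ![v₁ 0, v₂ 0, 0, v₃ 0, v₄ 0] ![v₁ 1, v₂ 1, 0, v₃ 1, v₄ 1]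
      ![v₁ 3, v₂ 3, 0, v₃ 3, v₄ 3] ![v₁ 4, v₂ 4, 0, v₃ 4, v₄ 4] := by
  obtain ⟨h12, h13, h14, h23, h24, h34⟩ := h
  simp only [canonicalForm] at *
  set M : Matrix (Fin 4) (Fin 4) ℝ := !![v₁ 0, v₂ 0, v₃ 0, v₄ 0; v₁ 1, v₂ 1, v₃ 1, v₄ 1;
    v₁ 3, v₂ 3, v₃ 3, v₄ 3; v₁ 4, v₂ 4, v₃ 4, v₄ 4] with hM
  have h := mul_sympl_mul_transpose (M := M) hf (by
    ext i j
    fin_cases i <;> fin_cases j <;>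
      simp [hM, sympl, Matrix.mul_apply, Fin.sum_univ_four] <;> linarith)
  have e : ∀ i j, (M * sympl * M.transpose) i j = (f • sympl) i j := fun i j => by rw [h]
  have e12 := e 0 1
  have e13 := e 0 2
  have e14 := e 0 3
  have e23 := e 1 2
  have e24 := e 1 3
  have e34 := e 2 3
  simp [hM, sympl, Matrix.mul_apply, Fin.sum_univ_four] at e12 e13 e14 e23 e24 e34
  constructor <;> simp [canonicalForm] <;> linarith

/-- The left side contracts the two-form with the Poisson bivector. The two-form is built from dp ∧
dx, dq ∧ dt and dt ∧ dx, and the corresponding pairs of coordinates all have bracket zero: the form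
is effective. -/
theorem heatForm_trace {f : ℝ} {v₁ v₂ v₃ v₄ : Jet} (h : IsConformalFrame f v₁ v₂ v₃ v₄)
    (hf : f ≠ 0) (z : Jet) : heatForm z v₁ v₃ + heatForm z v₂ v₄ = 0 := by
  obtain ⟨h12, h13, h14, h23, h24, h34⟩ := h.dual hf
  simp [canonicalForm, heatForm] at *
  linear_combination (-z 4) * h23 - h14 + (z 3 * z 4) * h12

/-- The two-form `dt ∧ dx`. -/
def areaForm (v w : Jet) : ℝ := v 0 * w 1 - v 1 * w 0

theorem areaForm_trace {f : ℝ} {v₁ v₂ v₃ v₄ : Jet} (h : IsConformalFrame f v₁ v₂ v₃ v₄)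
    (hf : f ≠ 0) : areaForm v₁ v₃ + areaForm v₂ v₄ = 0 := by
  obtain ⟨h12, -⟩ := h.dual hf
  simp [canonicalForm, areaForm] at *
  linear_combination h12

/-- The hypotheses say that dt ∧ dx pulls back to something vanishing on all integral elements of
the equation. A decomposable form cannot be a nonzero multiple of the nondegenerate form of the
equation, so the pullback would be zero, contradicting the independence of dt and dx. -/
theorem areaForm_ne_zero {f : ℝ} {v₁ v₂ v₃ v₄ : Jet} (h : IsConformalFrame f v₁ v₂ v₃ v₄)
    (hf : f ≠ 0) {p q : ℝ} (hq : q ≠ 0) (h34 : areaForm v₃ v₄ = 0)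
    (h13 : areaForm v₁ v₃ - areaForm v₂ v₄ = 0) (h23 : areaForm v₃ v₂ = -(q * areaForm v₁ v₄))
    (h12 : areaForm v₁ v₂ = -(p * q * areaForm v₁ v₄)) : False := by
  have ht := areaForm_trace h hf
  have a13 : areaForm v₁ v₃ = 0 := by linarith
  have a24 : areaForm v₂ v₄ = 0 := by linarith
  -- The Plücker relation for the decomposable form dt ∧ dx.
  have hp : areaForm v₁ v₂ * areaForm v₃ v₄ - areaForm v₁ v₃ * areaForm v₂ v₄ -
      areaForm v₁ v₄ * areaForm v₃ v₂ = 0 := by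
    simp only [areaForm]; ring
  rw [h34, a13, h23] at hp
  have a14 : areaForm v₁ v₄ = 0 := by
    have : q * (areaForm v₁ v₄ * areaForm v₁ v₄) = 0 := by linear_combination hp
    simpa [hq] using this
  rw [a14] at h23 h12
  obtain ⟨-, e13, e14, e23, e24, -⟩ := h.dual hf
  simp [canonicalForm, areaForm] at *
  -- Cauchy–Binet: {t,p}{x,q} - {t,q}{x,p} = f² is a sum of minors of (dt, dx) times minors of (dp,
  -- dq), and all minors of (dt, dx) vanish.
  have : f * f = 0 := by
    calc f * f = (v₁ 0 * v₃ 3 - v₃ 0 * v₁ 3 + (v₂ 0 * v₄ 3 - v₄ 0 * v₂ 3)) *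
          (v₁ 1 * v₃ 4 - v₃ 1 * v₁ 4 + (v₂ 1 * v₄ 4 - v₄ 1 * v₂ 4)) -
          (v₁ 0 * v₃ 4 - v₃ 0 * v₁ 4 + (v₂ 0 * v₄ 4 - v₄ 0 * v₂ 4)) *
          (v₁ 1 * v₃ 3 - v₃ 1 * v₁ 3 + (v₂ 1 * v₄ 3 - v₄ 1 * v₂ 3)) := by
          rw [e13, e24, e14]; ring
      _ = 0 := by
          linear_combination (v₃ 3 * v₄ 4 - v₄ 3 * v₃ 4) * h12 +
            (v₁ 3 * v₃ 4 - v₃ 3 * v₁ 4) * a13 + (v₂ 3 * v₃ 4 - v₃ 3 * v₂ 4) * a14 -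
            (v₁ 3 * v₄ 4 - v₄ 3 * v₁ 4) * h23 + (v₂ 3 * v₄ 4 - v₄ 3 * v₂ 4) * a24 +
            (v₁ 3 * v₂ 4 - v₂ 3 * v₁ 4) * h34
  exact hf (mul_self_eq_zero.mp this)


/-! ### Preserving the equation forces preserving the two-form. -/

theorem map_integralElement {z : Jet} {s m r : ℝ} (L : Jet →L[ℝ] Jet) :
    (integralElement z s m r).map (L : Jet →ₗ[ℝ] Jet) =
      Submodule.span ℝ {L ![1, 0, z 3, s, m], L ![0, 1, z 4, m, r]} := by
  rw [integralElement, Submodule.map_span, Set.image_pair]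
  rfl

/-- An isotropic plane in the contact hyperplane, transversal to the fibre over `(t, x)`, is an
integral element. -/
theorem exists_integralElement {z v w : Jet} (hv : contactForm z v = 0) (hw : contactForm z w = 0)
    (h : canonicalForm v w = 0) (ha : areaForm v w ≠ 0) :
    ∃ s m r, Submodule.span ℝ {v, w} = integralElement z s m r ∧
      heatForm z v w = areaForm v w * (z 4 * (s + z 3) - r) := by
  set a := areaForm v w with haa
  have ha' : a = v 0 * w 1 - v 1 * w 0 := haa
  refine ⟨(w 1 * v 3 - v 1 * w 3) / a, (w 1 * v 4 - v 1 * w 4) / a, (v 0 * w 4 - w 0 * v 4) / a,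
    ?_, ?_⟩
  · simp only [contactForm, canonicalForm] at hv hw h
    -- Cramer's rule gives two values for u_tx; isotropy of the plane is exactly their equality.
    have hm : (w 1 * v 4 - v 1 * w 4) / a = (v 0 * w 3 - w 0 * v 3) / a := by
      congr 1; linarith
    have e1 : v = v 0 • ![1, 0, z 3, (w 1 * v 3 - v 1 * w 3) / a, (w 1 * v 4 - v 1 * w 4) / a] +
        v 1 • ![0, 1, z 4, (w 1 * v 4 - v 1 * w 4) / a, (v 0 * w 4 - w 0 * v 4) / a] := by
      ext i
      fin_cases i <;> simp
      · linarith
      · rw [hm]; field_simp; rw [ha']; ring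
      · field_simp; rw [ha']; ring
    have e2 : w = w 0 • ![1, 0, z 3, (w 1 * v 3 - v 1 * w 3) / a, (w 1 * v 4 - v 1 * w 4) / a] +
        w 1 • ![0, 1, z 4, (w 1 * v 4 - v 1 * w 4) / a, (v 0 * w 4 - w 0 * v 4) / a] := by
      ext i
      fin_cases i <;> simp
      · linarith
      · rw [hm]; field_simp; rw [ha']; ring
      · field_simp; rw [ha']; ring
    rw [integralElement]
    set A : Jet := ![1, 0, z 3, (w 1 * v 3 - v 1 * w 3) / a, (w 1 * v 4 - v 1 * w 4) / a]
    set B : Jet := ![0, 1, z 4, (w 1 * v 4 - v 1 * w 4) / a, (v 0 * w 4 - w 0 * v 4) / a]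
    have h1 : w 1 / a * v 0 + -(v 1 / a) * w 0 = 1 := by field_simp; rw [ha']; ring
    have h2 : w 1 / a * v 1 + -(v 1 / a) * w 1 = 0 := by field_simp; ring
    have h3 : -(w 0 / a) * v 0 + v 0 / a * w 0 = 0 := by field_simp; ring
    have h4 : -(w 0 / a) * v 1 + v 0 / a * w 1 = 1 := by field_simp; rw [ha']; ring
    apply le_antisymm <;> rw [Submodule.span_le]
    · rintro y (rfl | rfl)
      · exact Submodule.mem_span_pair.mpr ⟨_, _, e1.symm⟩
      · exact Submodule.mem_span_pair.mpr ⟨_, _, e2.symm⟩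
    · rintro y (rfl | rfl)
      · refine Submodule.mem_span_pair.mpr ⟨w 1 / a, -(v 1 / a), ?_⟩
        linear_combination (norm := module) (w 1 / a) • e1 + (-(v 1 / a)) • e2 + h1 • A + h2 • B
      · refine Submodule.mem_span_pair.mpr ⟨-(w 0 / a), v 0 / a, ?_⟩
        linear_combination (norm := module) (-(w 0 / a)) • e1 + (v 0 / a) • e2 + h3 • A + h4 • B
  · simp only [heatForm]
    field_simp
    rw [ha']
    ring

/-- The image of an integral element on the equation is either transversal to the fibre over (t, x),
and then `heatForm` vanishes on it by symmetry, or not, and then `areaForm` vanishes on it. The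
product of the two pullbacks is thus a vanishing polynomial in the free parameters s and m, so one
factor vanishes. `areaForm_ne_zero` excludes the second one, and with the trace relation the first
pullback is a multiple of `heatForm`. -/
theorem preservesAt_of_symmetry {z z' : Jet} (hz : z 4 ≠ 0)
    {L : Jet →L[ℝ] Jet} (hL : Function.Bijective L)
    {f : ℝ} (hf : f ≠ 0) (hc : ∀ v, contactForm z' (L v) = f * contactForm z v)
    (hd : ∀ v w, contactForm z v = 0 → contactForm z w = 0 →
      canonicalForm (L v) (L w) = f * canonicalForm v w) (hz' : z' 4 ≠ 0)
    (hs : ∀ s m r s' m' r' : ℝ, OnEquation z s m r →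
      (integralElement z s m r).map (L : Jet →ₗ[ℝ] Jet) = integralElement z' s' m' r' →
      OnEquation z' s' m' r') : PreservesAt z z' L := by
  set v₁ := L ![1, 0, z 3, 0, 0] with hv₁
  set v₂ := L ![0, 1, z 4, 0, 0] with hv₂
  set v₃ := L ![0, 0, 0, 1, 0] with hv₃
  set v₄ := L ![0, 0, 0, 0, 1] with hv₄
  have hdec : ∀ v, contactForm z v = 0 → L v = v 0 • v₁ + v 1 • v₂ + v 3 • v₃ + v 4 • v₄ := by
    intro v hv
    rw [hv₁, hv₂, hv₃, hv₄, ← map_smul, ← map_smul, ← map_smul, ← map_smul, ← map_add, ← map_add,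
      ← map_add]
    congr 1
    simp only [contactForm] at hv
    ext i
    fin_cases i <;> simp
    linarith
  have hframe : IsConformalFrame f v₁ v₂ v₃ v₄ := by
    constructor <;> rw [hd _ _ (by simp [contactForm]) (by simp [contactForm])] <;>
      simp [canonicalForm]
  have hN := heatForm_trace hframe hf z'
  -- The coefficients multiply 1, s, m, r and s r - m², the minors of the integral element, with r
  -- eliminated by the equation.
  have hprod : ∀ s m : ℝ,
      (heatForm z' v₁ v₂ + heatForm z' v₃ v₂ * s + (heatForm z' v₁ v₃ - heatForm z' v₂ v₄) * m +
        heatForm z' v₁ v₄ * (z 4 * (s + z 3)) +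
        heatForm z' v₃ v₄ * (s * (z 4 * (s + z 3)) - m ^ 2)) *
      (areaForm v₁ v₂ + areaForm v₃ v₂ * s + (areaForm v₁ v₃ - areaForm v₂ v₄) * m +
        areaForm v₁ v₄ * (z 4 * (s + z 3)) +
        areaForm v₃ v₄ * (s * (z 4 * (s + z 3)) - m ^ 2)) = 0 := by
    intro s m
    set r := z 4 * (s + z 3) with hr
    have hon : OnEquation z s m r := by simp only [OnEquation, hr]; field_simp
    have ha := contactForm_span (z := z) (s := s) (m := m) (r := r)
    have e1 := hdec _ ha.1
    have e2 := hdec _ ha.2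
    have c1 := hc ![1, 0, z 3, s, m]
    have c2 := hc ![0, 1, z 4, m, r]
    rw [ha.1, mul_zero] at c1
    rw [ha.2, mul_zero] at c2
    have d := hd _ _ ha.1 ha.2
    have d0 : canonicalForm ![1, 0, z 3, s, m] ![0, 1, z 4, m, r] = 0 := by simp [canonicalForm]
    rw [d0, mul_zero] at d
    have key : heatForm z' (L ![1, 0, z 3, s, m]) (L ![0, 1, z 4, m, r]) *
        areaForm (L ![1, 0, z 3, s, m]) (L ![0, 1, z 4, m, r]) = 0 := by
      by_cases h0 : areaForm (L ![1, 0, z 3, s, m]) (L ![0, 1, z 4, m, r]) = 0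
      · rw [h0, mul_zero]
      · obtain ⟨s', m', r', hE, hh⟩ := exists_integralElement c1 c2 d h0
        have := hs s m r s' m' r' hon (by rw [map_integralElement, hE])
        simp only [OnEquation] at this
        rw [hh, this]
        field_simp
        simp
    rw [← key, e1, e2]
    simp [heatForm, areaForm]
    ring
  rcases effective_mul_eq_zero hz hprod with ⟨h34, h13, h23, h12⟩ | ⟨h34, h13, h23, h12⟩
  · have n13 : heatForm z' v₁ v₃ = 0 := by linarith
    have n24 : heatForm z' v₂ v₄ = 0 := by linarith
    have hheat : ∀ v w, contactForm z v = 0 → contactForm z w = 0 →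
        heatForm z' (L v) (L w) = -heatForm z' v₁ v₄ * heatForm z v w := by
      intro v w hv hw
      have : heatForm z' (L v) (L w) = (v 0 * w 1 - v 1 * w 0) * heatForm z' v₁ v₂ +
          (v 0 * w 3 - v 3 * w 0) * heatForm z' v₁ v₃ + (v 0 * w 4 - v 4 * w 0) * heatForm z' v₁ v₄ +
          (v 3 * w 1 - v 1 * w 3) * heatForm z' v₃ v₂ + (v 1 * w 4 - v 4 * w 1) * heatForm z' v₂ v₄ +
          (v 3 * w 4 - v 4 * w 3) * heatForm z' v₃ v₄ := by
        rw [hdec v hv, hdec w hw]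
        simp [heatForm]
        ring
      rw [this, h12, h23, n13, n24, h34]
      simp only [heatForm]
      ring
    refine ⟨f, -heatForm z' v₁ v₄, hf, ?_, hc, hheat⟩
    intro h0
    -- A zero multiplier is impossible: L maps onto the target contact hyperplane, where the
    -- two-form takes the value 1 on (∂_q, D_t).
    have hsurj : ∀ v, contactForm z' v = 0 → ∃ w, contactForm z w = 0 ∧ L w = v := by
      intro v hv
      obtain ⟨w, rfl⟩ := hL.2 v
      refine ⟨w, ?_, rfl⟩
      simpa [hf] using (hc w).symm.trans hv
    obtain ⟨a, ha, ha'⟩ := hsurj ![0, 0, 0, 0, 1] (by simp [contactForm])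
    obtain ⟨b, hb, hb'⟩ := hsurj ![1, 0, z' 3, 0, 0] (by simp [contactForm])
    have := hheat a b ha hb
    rw [h0, ha', hb'] at this
    simp [heatForm] at this
  · exact (areaForm_ne_zero hframe hf hz h34 h13 h23 h12).elim


/-! ### Contact symmetries as a pointwise condition on the derivative. -/

/-- This is the exterior derivative of Γ*θ = f θ. The term df ∧ θ vanishes on the contact
hyperplane, and symmetry of the second derivative of Γ removes the remaining second-order terms. The
multiplier f is differentiable because it is the value of Γ*θ on ∂_u. -/
theorem canonicalForm_fderiv {U : Set Jet} (hU : IsOpen U) {Γ : Jet → Jet}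
    (hΓ : ContDiffOn ℝ ∞ Γ U) {f : Jet → ℝ}
    (hc : ∀ z ∈ U, ∀ v, contactForm (Γ z) (fderiv ℝ Γ z v) = f z * contactForm z v)
    {z : Jet} (hz : z ∈ U) {v w : Jet} (hv : contactForm z v = 0) (hw : contactForm z w = 0) :
    canonicalForm (fderiv ℝ Γ z v) (fderiv ℝ Γ z w) = f z * canonicalForm v w := by
  have hΓz : ContDiffAt ℝ ∞ Γ z := hΓ.contDiffAt (hU.mem_nhds hz)
  have hd : DifferentiableAt ℝ (fderiv ℝ Γ) z :=
    (hΓz.fderiv_right (m := 1) (by norm_cast)).differentiableAt (by norm_num)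
  have hD : ∀ v i, HasFDerivAt (fun y => fderiv ℝ Γ y v i)
      ((ContinuousLinearMap.proj i).comp ((ContinuousLinearMap.apply ℝ Jet v).comp
        (fderiv ℝ (fderiv ℝ Γ) z))) z := fun v i =>
    (ContinuousLinearMap.proj (R := ℝ) (φ := fun _ : Fin 5 => ℝ) i).hasFDerivAt.comp z
      ((ContinuousLinearMap.apply ℝ Jet v).hasFDerivAt.comp z hd.hasFDerivAt)
  have hG : ∀ i, HasFDerivAt (fun y => Γ y i) ((ContinuousLinearMap.proj i).comp (fderiv ℝ Γ z)) z :=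
    fun i => (ContinuousLinearMap.proj (R := ℝ) (φ := fun _ : Fin 5 => ℝ) i).hasFDerivAt.comp z
      (hΓz.differentiableAt (by simp)).hasFDerivAt
  have hP : ∀ i, HasFDerivAt (fun y : Jet => y i)
      (ContinuousLinearMap.proj (R := ℝ) (φ := fun _ : Fin 5 => ℝ) i) z := fun i =>
    (ContinuousLinearMap.proj (R := ℝ) (φ := fun _ : Fin 5 => ℝ) i).hasFDerivAt
  have hl : ∀ v, HasFDerivAt (fun y => contactForm (Γ y) (fderiv ℝ Γ y v)) _ z := fun v =>
    ((hD v 2).sub ((hG 3).mul (hD v 0))).sub ((hG 4).mul (hD v 1))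
  have hfd : DifferentiableAt ℝ f z := by
    have he : f =ᶠ[nhds z] fun y => contactForm (Γ y) (fderiv ℝ Γ y ![0, 0, 1, 0, 0]) := by
      filter_upwards [hU.mem_nhds hz] with y hy
      rw [hc y hy]
      simp [contactForm]
    exact (hl _).differentiableAt.congr_of_eventuallyEq he
  have hr : ∀ v, HasFDerivAt (fun y => f y * contactForm y v) _ z := fun v =>
    hfd.hasFDerivAt.mul (((hasFDerivAt_const (v 2) z).sub ((hP 3).mul_const (v 0))).sub
      ((hP 4).mul_const (v 1)))
  have heq : ∀ v, (fun y => contactForm (Γ y) (fderiv ℝ Γ y v)) =ᶠ[nhds z]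
      fun y => f y * contactForm y v := fun v => by
    filter_upwards [hU.mem_nhds hz] with y hy
    exact hc y hy v
  have e1 := congrArg (fun T : Jet →L[ℝ] ℝ => T w)
    ((hl v).unique ((hr v).congr_of_eventuallyEq (heq v)))
  have e2 := congrArg (fun T : Jet →L[ℝ] ℝ => T v)
    ((hl w).unique ((hr w).congr_of_eventuallyEq (heq w)))
  have hsym : fderiv ℝ (fderiv ℝ Γ) z v w = fderiv ℝ (fderiv ℝ Γ) z w v :=
    hΓz.isSymmSndFDerivAt (by
      rw [minSmoothness_of_isRCLikeNormedField]; exact WithTop.coe_le_coe.mpr le_top) v w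
  simp [hsym] at e1 e2
  rw [hv] at e1
  rw [hw] at e2
  simp only [canonicalForm]
  linarith

/-- Since θ(∂_u) = 1, splitting off the ∂_u component turns preservation of the kernel of θ into
scaling of θ by the value of Γ*θ on ∂_u. Surjectivity of the derivative makes this factor nonzero.
-/
theorem IsContactSymmetryOn.preservesAt {U : Set Jet} (hU : IsOpen U) (hq : ∀ z ∈ U, z 4 ≠ 0)
    {Γ : Jet → Jet} (h : IsContactSymmetryOn U Γ) {z : Jet} (hz : z ∈ U) :
    PreservesAt z (Γ z) (fderiv ℝ Γ z) := by
  set f : Jet → ℝ := fun z => contactForm (Γ z) (fderiv ℝ Γ z ![0, 0, 1, 0, 0]) with hf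
  have hadd : ∀ z v w, contactForm z (v + w) = contactForm z v + contactForm z w := by
    intro z v w; simp [contactForm]; ring
  have hsmul : ∀ z (a : ℝ) v, contactForm z (a • v) = a * contactForm z v := by
    intro z a v; simp [contactForm]; ring
  have hc : ∀ z ∈ U, ∀ v, contactForm (Γ z) (fderiv ℝ Γ z v) = f z * contactForm z v := by
    intro z hz v
    have hv : v = (v - contactForm z v • ![0, 0, 1, 0, 0]) + contactForm z v • ![0, 0, 1, 0, 0] :=
      (sub_add_cancel _ _).symm
    have h0 := h.contact z hz (v - contactForm z v • ![0, 0, 1, 0, 0]) (by simp [contactForm]; ring)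
    nth_rewrite 1 [hv]
    rw [map_add, hadd, h0, map_smul, hsmul, zero_add, mul_comm]
  refine preservesAt_of_symmetry (hq z hz) (h.bijective_fderiv z hz) (f := f z) ?_ (hc z hz)
    (fun v w => canonicalForm_fderiv hU h.smooth hc hz) (h.ux_ne_zero z hz) (h.symmetry z hz)
  intro h0
  obtain ⟨v, hv⟩ := (h.bijective_fderiv z hz).2 ![0, 0, 1, 0, 0]
  have := hc z hz v
  rw [hv, h0] at this
  simp [contactForm] at this

theorem isContactSymmetryOn_of_preservesAt {U : Set Jet} (hq : ∀ z ∈ U, z 4 ≠ 0) {Γ : Jet → Jet}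
    (hs : ContDiffOn ℝ ∞ Γ U) (hi : InjOn Γ U) (hΓ : ∀ z ∈ U, Γ z 4 ≠ 0)
    (hp : ∀ z ∈ U, PreservesAt z (Γ z) (fderiv ℝ Γ z)) : IsContactSymmetryOn U Γ where
  smooth := hs
  injOn := hi
  bijective_fderiv z hz := (hp z hz).bijective (hq z hz)
  ux_ne_zero := hΓ
  contact z hz v hv := by
    obtain ⟨f, l, -, -, h1, -⟩ := hp z hz
    rw [h1, hv, mul_zero]
  symmetry z hz s m r s' m' r' := (hp z hz).onEquation (hq z hz) (hΓ z hz)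

theorem IsContactSymmetryOn.mono {U V : Set Jet} {Γ : Jet → Jet} (h : IsContactSymmetryOn U Γ)
    (hV : V ⊆ U) : IsContactSymmetryOn V Γ :=
  ⟨h.smooth.mono hV, h.injOn.mono hV, fun z hz => h.bijective_fderiv z (hV hz),
    fun z hz => h.ux_ne_zero z (hV hz), fun z hz => h.contact z (hV hz),
    fun z hz => h.symmetry z (hV hz)⟩

theorem IsContactSymmetryOn.differentiableAt {U : Set Jet} (hU : IsOpen U) {Γ : Jet → Jet}
    (h : IsContactSymmetryOn U Γ) {z : Jet} (hz : z ∈ U) : DifferentiableAt ℝ Γ z :=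
  (h.smooth.contDiffAt (hU.mem_nhds hz)).differentiableAt (by simp)

theorem IsContactSymmetryOn.comp {U V : Set Jet} (hU : IsOpen U) (hV : IsOpen V)
    (hqU : ∀ z ∈ U, z 4 ≠ 0) (hqV : ∀ z ∈ V, z 4 ≠ 0) {Γ Γ' : Jet → Jet}
    (h' : IsContactSymmetryOn V Γ') (h : IsContactSymmetryOn U Γ) (hm : MapsTo Γ U V) :
    IsContactSymmetryOn U (Γ' ∘ Γ) := by
  refine isContactSymmetryOn_of_preservesAt hqU (h'.smooth.comp h.smooth hm)
    (h'.injOn.comp h.injOn hm) (fun z hz => h'.ux_ne_zero _ (hm hz)) fun z hz => ?_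
  rw [fderiv_comp z (h'.differentiableAt hV (hm hz)) (h.differentiableAt hU hz)]
  exact (h'.preservesAt hV hqV (hm hz)).comp (h.preservesAt hU hqU hz)

theorem IsContactSymmetryOn.congr {U : Set Jet} (hU : IsOpen U) {Γ Γ' : Jet → Jet}
    (h : IsContactSymmetryOn U Γ) (he : EqOn Γ' Γ U) : IsContactSymmetryOn U Γ' := by
  have hd : ∀ z ∈ U, fderiv ℝ Γ' z = fderiv ℝ Γ z := fun z hz =>
    Filter.EventuallyEq.fderiv_eq (Filter.eventuallyEq_of_mem (hU.mem_nhds hz) he)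
  refine ⟨h.smooth.congr he, h.injOn.congr he.symm, fun z hz => ?_, fun z hz => ?_,
    fun z hz => ?_, fun z hz => ?_⟩
  · rw [hd z hz]; exact h.bijective_fderiv z hz
  · rw [he hz]; exact h.ux_ne_zero z hz
  · rw [hd z hz, he hz]; exact h.contact z hz
  · rw [hd z hz, he hz]; exact h.symmetry z hz

/-- The inverse function theorem yields openness of the image and smoothness of the inverse; the
symmetry property passes to the inverse through `PreservesAt.symm`. -/
theorem IsContactSymmetryOn.exists_inverse {U : Set Jet} (hU : IsOpen U) (hq : ∀ z ∈ U, z 4 ≠ 0)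
    {Γ : Jet → Jet} (h : IsContactSymmetryOn U Γ) :
    IsOpen (Γ '' U) ∧ ∃ g : Jet → Jet, IsContactSymmetryOn (Γ '' U) g ∧ ∀ z ∈ U, g (Γ z) = z := by
  have hg : ∀ z ∈ U, Function.invFunOn Γ U (Γ z) = z := h.injOn.leftInvOn_invFunOn
  set g := Function.invFunOn Γ U
  have hloc : ∀ z ∈ U, ∃ e : Jet ≃L[ℝ] Jet, HasFDerivAt Γ (e : Jet →L[ℝ] Jet) z := by
    intro z hz
    obtain ⟨hi, hs⟩ := h.bijective_fderiv z hz
    refine ⟨ContinuousLinearEquiv.ofBijective (fderiv ℝ Γ z) (LinearMap.ker_eq_bot.mpr hi)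
      (LinearMap.range_eq_top.mpr hs), ?_⟩
    rw [ContinuousLinearEquiv.coe_ofBijective]
    exact (h.differentiableAt hU hz).hasFDerivAt
  have hsm : ∀ z ∈ U, ContDiffAt ℝ ∞ Γ z := fun z hz => h.smooth.contDiffAt (hU.mem_nhds hz)
  have hopen : IsOpen (Γ '' U) := by
    rw [isOpen_iff_mem_nhds]
    rintro _ ⟨z, hz, rfl⟩
    obtain ⟨e, he⟩ := hloc z hz
    rw [← ((hsm z hz).hasStrictFDerivAt' he (by simp)).map_nhds_eq_of_equiv]
    exact Filter.image_mem_map (hU.mem_nhds hz)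
  have hgs : ∀ z ∈ U, ContDiffAt ℝ ∞ g (Γ z) := by
    intro z hz
    obtain ⟨e, he⟩ := hloc z hz
    have h1 := (hsm z hz).to_localInverse he (by simp)
    refine h1.congr_of_eventuallyEq ?_
    have h2 : ∀ᶠ y in nhds (Γ z), Γ ((hsm z hz).localInverse he (by simp) y) = y :=
      ((hsm z hz).hasStrictFDerivAt' he (by simp)).eventually_right_inverse
    have h3 : ∀ᶠ y in nhds (Γ z), (hsm z hz).localInverse he (by simp) y ∈ U := by
      refine h1.continuousAt.eventually_mem ?_
      rw [ContDiffAt.localInverse_apply_image]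
      exact hU.mem_nhds hz
    filter_upwards [h2, h3] with y hy1 hy2
    nth_rewrite 1 [← hy1]
    exact hg _ hy2
  refine ⟨hopen, g, ?_, hg⟩
  have hgsm : ContDiffOn ℝ ∞ g (Γ '' U) := by
    rintro _ ⟨z, hz, rfl⟩
    exact (hgs z hz).contDiffWithinAt
  refine isContactSymmetryOn_of_preservesAt ?_ hgsm ?_ ?_ ?_
  · rintro _ ⟨z, hz, rfl⟩
    exact h.ux_ne_zero z hz
  · rintro _ ⟨z, hz, rfl⟩ _ ⟨w, hw, rfl⟩ hzw
    rw [hg z hz, hg w hw] at hzw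
    rw [hzw]
  · rintro _ ⟨z, hz, rfl⟩
    rw [hg z hz]
    exact hq z hz
  · rintro _ ⟨z, hz, rfl⟩
    have hp := h.preservesAt hU hq hz
    have hcomp : (fderiv ℝ g (Γ z)).comp (fderiv ℝ Γ z) = ContinuousLinearMap.id ℝ Jet := by
      rw [← fderiv_comp z ((hgs z hz).differentiableAt (by simp)) (h.differentiableAt hU hz),
        ← fderiv_id]
      refine Filter.EventuallyEq.fderiv_eq ?_
      filter_upwards [hU.mem_nhds hz] with y hy
      exact hg y hy
    rw [hg z hz]
    refine hp.symm fun v => ?_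
    obtain ⟨w, rfl⟩ := (h.bijective_fderiv z hz).2 v
    congr 1
    exact DFunLike.congr_fun hcomp w


/-! ### Solving the determining equations in a ring with derivations. -/

theorem eq_zero_of_natCast_mul {A : Type*} [CommRing A] [Algebra ℝ A] (n : ℕ) (hn : n ≠ 0) {a : A}
    (h : (n : A) * a = 0) : a = 0 := by
  have h1 : ((n : ℝ)⁻¹ * n) • a = 0 := by
    rw [mul_smul, Nat.cast_smul_eq_nsmul, nsmul_eq_mul, h, smul_zero]
  rwa [inv_mul_cancel₀ (Nat.cast_ne_zero.mpr hn), one_smul] at h1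

/-- Derivations with the commutation relations of `P = ∂_p`, `Q = ∂_q`, `X = ∂_x`,
`T = ∂_t + p ∂_u - p ∂_p`, `U = ∂_u`, and a regular element with the derivatives of `q`. -/
structure HeatFrame (A : Type*) [CommRing A] [Algebra ℝ A] where
  P : Derivation ℝ A A
  Q : Derivation ℝ A A
  X : Derivation ℝ A A
  -- T is the total t-derivative along u_tt = -u_t, u_tx = 0, a direction compatible with the
  -- equation. It commutes with Q, X, U and kills q, so the determining equations have only q in
  -- their coefficients.
  T : Derivation ℝ A A
  U : Derivation ℝ A A
  q : A
  q_cancel : ∀ f, q * f = 0 → f = 0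
  P_q : P q = 0
  Q_q : Q q = 1
  X_q : X q = 0
  T_q : T q = 0
  U_q : U q = 0
  X_U : ∀ f, X (U f) = U (X f)
  T_U : ∀ f, T (U f) = U (T f)
  T_X : ∀ f, T (X f) = X (T f)
  Q_U : ∀ f, Q (U f) = U (Q f)
  Q_X : ∀ f, Q (X f) = X (Q f)
  Q_T : ∀ f, Q (T f) = T (Q f)
  P_U : ∀ f, P (U f) = U (P f)
  P_X : ∀ f, P (X f) = X (P f)
  P_T : ∀ f, P (T f) = T (P f) + U f - P f
  P_Q : ∀ f, P (Q f) = Q (P f)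

namespace HeatFrame

variable {A : Type*} [CommRing A] [Algebra ℝ A] (F : HeatFrame A)

theorem apply_two (D : Derivation ℝ A A) : D 2 = 0 := D.map_natCast 2

theorem apply_three (D : Derivation ℝ A A) : D 3 = 0 := D.map_natCast 3

/-- The determining equations of the generating function of an infinitesimal contact symmetry. -/
structure Determining (f : A) : Prop where
  eqA : F.P (F.P f) = F.q * F.Q (F.Q f)
  eqB : 2 * (F.q * F.T (F.P f)) =
    2 * (F.q * (F.X (F.Q f) + F.q * F.U (F.Q f))) - F.X f - F.q * F.U f
  eqC : F.q * F.T (F.Q f) = F.X (F.P f) + F.q * F.U (F.P f)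
  eqD : F.q * (F.T (F.T f) + F.T f) =
    F.X (F.X f) + 2 * (F.q * F.U (F.X f)) + F.q * (F.q * F.U (F.U f))

variable {F} {f : A}

/-- The first integral of the determining equations. -/
theorem Determining.first_integral (h : F.Determining f) :
    2 * (F.q * F.P (F.P f)) = 3 * (F.q * F.U (F.P f)) - F.X (F.P f) ∧
    2 * (F.q ^ 2 * F.Q (F.P f)) = 3 * (F.q ^ 2 * F.U (F.Q f)) - F.q * F.X (F.Q f) + F.X f ∧
    2 * (F.q * F.X (F.P f)) = 3 * (F.q * F.U (F.X f)) - F.X (F.X f) ∧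
    2 * (F.q * F.T (F.P f)) = 3 * (F.q * F.U (F.T f)) - F.X (F.T f) ∧
    2 * (F.q * F.U (F.P f)) = 3 * (F.q * F.U (F.U f)) - F.U (F.X f) := by
  obtain ⟨hA, hB, hC, hD⟩ := h
  have PB := congrArg F.P hB
  have QB := congrArg F.Q hB
  have XB := congrArg F.X hB
  have TB := congrArg F.T hB
  have UB := congrArg F.U hB
  have PC := congrArg F.P hC
  have QC := congrArg F.Q hC
  have XC := congrArg F.X hC
  have TC := congrArg F.T hC
  have UC := congrArg F.U hC
  have PD := congrArg F.P hD
  have QD := congrArg F.Q hD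
  have XA := congrArg F.X hA
  have TA := congrArg F.T hA
  have UA := congrArg F.U hA
  simp only [map_add, map_sub, Derivation.leibniz, smul_eq_mul, apply_two, mul_zero, add_zero,
    mul_one, F.P_q, F.Q_q, F.X_q, F.T_q, F.U_q, F.X_U, F.T_U, F.T_X, F.Q_U, F.Q_X, F.Q_T, F.P_U,
    F.P_X, F.P_T, F.P_Q] at PB QB XB TB UB PC QC XC TC UC PD QD XA TA UA
  -- Put I = 2 f_p - 3 f_u + f_x / q. Cleared of denominators, `e1`, `e2` and `e4` say P I = 0, Q I
  -- = 0 and T I = 0, while `e3` says X I + q U I = 0.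
  have e1 : 2 * (F.q * F.P (F.P f)) = 3 * (F.q * F.U (F.P f)) - F.X (F.P f) := by
    linear_combination -PB + 2 * F.q * TA + 2 * F.q * QC - 2 * hC
  have e2 : 2 * (F.q ^ 2 * F.Q (F.P f)) =
      3 * (F.q ^ 2 * F.U (F.Q f)) - F.q * F.X (F.Q f) + F.X f := by
    linear_combination -2 * F.q * PC + F.q * QB - hB - 2 * F.q * XA - 2 * F.q ^ 2 * UA
  have e3 : 2 * (F.q * F.X (F.P f)) + 2 * (F.q ^ 2 * F.U (F.P f)) - 2 * (F.q * F.U (F.X f)) +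
      F.X (F.X f) - 3 * (F.q ^ 2 * F.U (F.U f)) = 0 := by
    linear_combination 2 * F.q * QD - 2 * hD - 2 * F.q * TC - 2 * F.q * hC - XB - F.q * UB
  have e4 : 2 * (F.q * F.T (F.P f)) = 3 * (F.q * F.U (F.T f)) - F.X (F.T f) := by
    linear_combination -2 * PD + TB + 2 * XC + 2 * F.q * UC
  have Qe3 := congrArg F.Q e3
  have Xe2 := congrArg F.X e2
  have Ue2 := congrArg F.U e2
  simp only [map_add, map_sub, map_zero, Derivation.leibniz, smul_eq_mul, apply_two, apply_three,
    mul_zero, add_zero, mul_one, pow_two, F.Q_q, F.X_q, F.U_q, F.X_U, F.Q_U, F.Q_X] at Qe3 Xe2 Ue2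
  -- Because Q I = 0, the q-derivative of X I + q U I = 0 leaves U I = 0.
  have e5 : 2 * (F.q * F.U (F.P f)) = 3 * (F.q * F.U (F.U f)) - F.U (F.X f) := by
    refine sub_eq_zero.mp (F.q_cancel _ ?_)
    linear_combination F.q * Qe3 - Xe2 - F.q * Ue2 - e3
  exact ⟨e1, e2, by linear_combination e3 - F.q * e5, e4, e5⟩

end HeatFrame
namespace HeatFrame

variable {A : Type*} [CommRing A] [Algebra ℝ A] {F : HeatFrame A} {f : A}

/-- The quadratic relation between the derivatives in the directions of `x` and `u`. -/
theorem Determining.quadratic_relation (h : F.Determining f) :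
    F.q * F.X (F.Q f) = F.X f ∧ 2 * F.Q (F.P f) = 3 * F.U (F.Q f) ∧
    F.q ^ 2 * F.U (F.Q f) = F.X (F.X (F.P f)) + F.q * F.U (F.X (F.P f)) ∧
    3 * F.X (F.X f) - 2 * (F.q * F.U (F.X f)) + 3 * (F.q ^ 2 * F.U (F.U f)) = 0 := by
  obtain ⟨I1, I2, I3, I4, I5⟩ := h.first_integral
  obtain ⟨hA, hB, hC, -⟩ := h
  have PA := congrArg F.P hA
  have XA := congrArg F.X hA
  have UA := congrArg F.U hA
  have PB := congrArg F.P hB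
  have XB := congrArg F.X hB
  have UB := congrArg F.U hB
  have PC := congrArg F.P hC
  have UC := congrArg F.U hC
  have PI1 := congrArg F.P I1
  have XI1 := congrArg F.X I1
  have UI1 := congrArg F.U I1
  have QI2 := congrArg F.Q I2
  have PI4 := congrArg F.P I4
  simp only [map_add, map_sub, Derivation.leibniz, smul_eq_mul, apply_two, apply_three, mul_zero,
    add_zero, mul_one, pow_two, F.P_q, F.Q_q, F.X_q, F.U_q, F.X_U, F.Q_U, F.Q_X, F.P_U, F.P_X, F.P_T, F.P_Q] at PA XA UA PB XB UB PC UC PI1 XI1 UI1 QI2 PI4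
  have J : 2 * F.Q (F.P f) = 3 * F.U (F.Q f) := by
    refine sub_eq_zero.mp (eq_zero_of_natCast_mul 2 two_ne_zero
      (F.q_cancel _ (F.q_cancel _ ?_)))
    push_cast
    linear_combination 2 * F.q ^ 2 * PA - F.q * PI1 + F.q * QI2 - 3 * F.q ^ 2 * UA + F.q * XA
  -- What `J` leaves of Q I = 0 is Euler's relation: X f is homogeneous of degree one in q.
  have F1 : F.q * F.X (F.Q f) = F.X f := by
    linear_combination I2 - F.q ^ 2 * J
  have TJ := congrArg F.T J
  have XJ := congrArg F.X J
  have UJ := congrArg F.U J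
  have XF1 := congrArg F.X F1
  have UF1 := congrArg F.U F1
  simp only [Derivation.leibniz, smul_eq_mul, apply_two, apply_three, mul_zero,
    add_zero, F.X_q, F.U_q, F.X_U, F.T_U] at TJ XJ UJ XF1 UF1
  refine ⟨F1, J, ?_, ?_⟩
  · linear_combination -2 * F.q * PC - XI1 - F.q * UI1 + F.q ^ 2 * TJ - F.q ^ 2 * J + 3 * F.q * UC
  · linear_combination 2 * F.q * (PI4 - PB) - 2 * F.q ^ 2 * XJ - 2 * F.q ^ 3 * UJ + 3 * F.q * UB -
      XB - 2 * XF1 - 2 * F.q * UF1 + 2 * I3 - 2 * F.q * I5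

/-- The quadratic relation has q-dependent coefficients, while X f obeys Euler's relation in q.
Differentiating it in q, x and u therefore gives enough independent relations to kill all third
derivatives in x and u. After that U Q f vanishes, and one more q-derivative separates the remaining
second derivatives. -/
theorem Determining.second_order (h : F.Determining f) :
    F.U (F.Q f) = 0 ∧ F.U (F.U f) = 0 ∧ F.U (F.X f) = 0 ∧ F.X (F.X f) = 0 := by
  obtain ⟨F1, J, F2, F3⟩ := h.quadratic_relation
  obtain ⟨-, -, I3, -, -⟩ := h.first_integral
  have XF1 := congrArg F.X F1
  have UF1 := congrArg F.U F1
  have UUF1 := congrArg F.U UF1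
  have XF3 := congrArg F.X F3
  have UF3 := congrArg F.U F3
  have QF3 := congrArg F.Q F3
  have XI3 := congrArg F.X I3
  have UI3 := congrArg F.U I3
  simp only [map_add, map_sub, map_zero, Derivation.leibniz, smul_eq_mul, apply_two, apply_three,
    mul_zero, add_zero, mul_one, pow_two, F.Q_q, F.X_q, F.U_q, F.X_U, F.Q_U, F.Q_X]
    at XF1 UF1 UUF1 XF3 UF3 QF3 XI3 UI3
  have G : -2 * F.U (F.X f) + 3 * (F.q * F.U (F.U f)) + 3 * (F.q ^ 2 * F.U (F.U (F.Q f))) = 0 := by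
    refine F.q_cancel _ ?_
    linear_combination F.q * QF3 - F3 - 3 * XF1 + 2 * F.q * UF1
  have XG := congrArg F.X G
  have UG := congrArg F.U G
  simp only [map_add, map_neg, map_zero, Derivation.leibniz, smul_eq_mul, apply_two, apply_three,
    mul_zero, add_zero, pow_two, F.X_q, F.U_q, F.X_U] at XG UG
  have H : 7 * F.U (F.U (F.X f)) + 3 * (F.q * F.U (F.U (F.U f))) = 0 := by
    refine eq_zero_of_natCast_mul 2 two_ne_zero (F.q_cancel _ ?_)
    push_cast
    linear_combination 2 * UF3 + 3 * XG - 9 * F.q * UUF1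
  have QH := congrArg F.Q H
  have h7 : F.Q 7 = 0 := F.Q.map_natCast 7
  simp only [map_add, map_zero, Derivation.leibniz, smul_eq_mul, apply_three, h7,
    mul_zero, add_zero, mul_one, F.Q_q, F.Q_U, F.Q_X] at QH
  have uux : F.U (F.U (F.X f)) = 0 := by
    refine eq_zero_of_natCast_mul 9 (by norm_num) ?_
    push_cast
    linear_combination F.q * QH - UG - 7 * UUF1
  have uuu : F.U (F.U (F.U f)) = 0 := by
    refine F.q_cancel _ (eq_zero_of_natCast_mul 3 (by norm_num) ?_)
    push_cast
    linear_combination H - 7 * uux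
  have uxx : F.U (F.X (F.X f)) = 0 := by
    refine eq_zero_of_natCast_mul 3 (by norm_num) ?_
    push_cast
    linear_combination UF3 + 2 * F.q * uux - 3 * F.q ^ 2 * uuu
  have xxx : F.X (F.X (F.X f)) = 0 := by
    refine eq_zero_of_natCast_mul 3 (by norm_num) ?_
    push_cast
    linear_combination XF3 + 2 * F.q * uxx - 3 * F.q ^ 2 * uux
  have uq : F.U (F.Q f) = 0 := by
    refine F.q_cancel _ (F.q_cancel _ (F.q_cancel _ (eq_zero_of_natCast_mul 2 two_ne_zero ?_)))
    push_cast
    linear_combination 2 * F.q * F2 + XI3 + F.q * UI3 + 2 * F.q * uxx - xxx + 3 * F.q ^ 2 * uux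
  have uuq := congrArg F.U uq
  have xuq := congrArg F.X uq
  simp only [map_zero, F.X_U] at uuq xuq
  have K : 2 * F.U (F.X f) = 3 * (F.q * F.U (F.U f)) := by
    linear_combination -G + 3 * F.q ^ 2 * uuq
  have QK := congrArg F.Q K
  simp only [Derivation.leibniz, smul_eq_mul, apply_two, apply_three,
    mul_zero, add_zero, mul_one, F.Q_q, F.Q_U, F.Q_X] at QK
  have uu : F.U (F.U f) = 0 := by
    refine eq_zero_of_natCast_mul 3 (by norm_num) ?_
    push_cast
    linear_combination -QK + 2 * xuq - 3 * F.q * uuq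
  have ux : F.U (F.X f) = 0 := by
    refine eq_zero_of_natCast_mul 2 two_ne_zero ?_
    push_cast
    linear_combination K + 3 * F.q * uu
  refine ⟨uq, uu, ux, eq_zero_of_natCast_mul 3 (by norm_num) ?_⟩
  push_cast
  linear_combination F3 + 2 * F.q * ux - 3 * F.q ^ 2 * uu

/-- A solution of the determining equations is determined by five constants. -/
theorem Determining.derivatives (h : F.Determining f) :
    F.X f = F.q * F.U f ∧ F.T (F.T f) + F.T f = 0 ∧
    F.U (F.U f) = 0 ∧ F.U (F.X f) = 0 ∧ F.U (F.T f) = 0 ∧ F.U (F.Q f) = 0 ∧ F.U (F.P f) = 0 ∧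
    F.X (F.P f) = 0 ∧ F.T (F.P f) = 0 ∧ F.Q (F.P f) = 0 ∧ F.P (F.P f) = 0 ∧
    F.X (F.Q f) = F.U f ∧ F.T (F.Q f) = 0 ∧ F.Q (F.Q f) = 0 ∧ F.X (F.T f) = 0 := by
  obtain ⟨uq, uu, ux, xx⟩ := h.second_order
  obtain ⟨F1, J, -, -⟩ := h.quadratic_relation
  obtain ⟨I1, -, I3, I4, I5⟩ := h.first_integral
  obtain ⟨hA, hB, hC, hD⟩ := h
  have h2 : ∀ {a : A}, 2 * a = 0 → a = 0 := fun {a} ha =>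
    eq_zero_of_natCast_mul 2 two_ne_zero (by exact_mod_cast ha)
  have up : F.U (F.P f) = 0 := F.q_cancel _ (h2 (by linear_combination I5 + 3 * F.q * uu - ux))
  have xp : F.X (F.P f) = 0 := F.q_cancel _ (h2 (by linear_combination I3 + 3 * F.q * ux - xx))
  have pp : F.P (F.P f) = 0 := F.q_cancel _ (h2 (by linear_combination I1 + 3 * F.q * up - xp))
  have qq : F.Q (F.Q f) = 0 := F.q_cancel _ (by linear_combination pp - hA)
  have qp : F.Q (F.P f) = 0 := h2 (by linear_combination J + 3 * uq)
  have tq : F.T (F.Q f) = 0 := F.q_cancel _ (by linear_combination hC + xp + F.q * up)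
  have TF1 := congrArg F.T F1
  have xtq := congrArg F.X tq
  simp only [map_zero, Derivation.leibniz, smul_eq_mul, mul_zero, add_zero, F.T_q, F.T_X]
    at TF1 xtq
  have xt : F.X (F.T f) = 0 := by linear_combination F.q * xtq - TF1
  have tt : F.T (F.T f) + F.T f = 0 :=
    F.q_cancel _ (by linear_combination hD + xx + 2 * F.q * ux + F.q ^ 2 * uu)
  have K : 3 * (F.q * F.U (F.T f)) = F.X f - F.q * F.U f := by
    linear_combination hB - I4 + 2 * F1 + 2 * F.q ^ 2 * uq + xt
  have TK := congrArg F.T K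
  have Utt := congrArg F.U tt
  simp only [map_add, map_sub, map_zero, Derivation.leibniz, smul_eq_mul, apply_three, mul_zero,
    add_zero, F.T_q, F.T_U, F.T_X] at TK Utt
  have ut : F.U (F.T f) = 0 := F.q_cancel _ (h2 (by linear_combination -TK + 3 * F.q * Utt - xt))
  have x : F.X f = F.q * F.U f := by linear_combination 3 * F.q * ut - K
  have tp : F.T (F.P f) = 0 := F.q_cancel _ (h2 (by linear_combination I4 + 3 * F.q * ut - xt))
  have xq : F.X (F.Q f) = F.U f :=
    sub_eq_zero.mp (F.q_cancel _ (by linear_combination F1 + x))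
  exact ⟨x, tt, uu, ux, ut, uq, up, xp, tp, qp, pp, xq, tq, qq, xt⟩

end HeatFrame

/-- A `HeatFrame` together with elements that have the derivatives of `p`, `x`, `u`, `e ^ t` and
`e ^ (-t)`. -/
structure JetFrame (A : Type*) [CommRing A] [Algebra ℝ A] extends HeatFrame A where
  p : A
  x : A
  u : A
  e : A
  e' : A
  e_mul_e' : e * e' = 1
  P_p : P p = 1
  Q_p : Q p = 0
  X_p : X p = 0
  T_p : T p = -p
  U_p : U p = 0
  P_x : P x = 0
  Q_x : Q x = 0
  X_x : X x = 1
  T_x : T x = 0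
  U_x : U x = 0
  P_u : P u = 0
  Q_u : Q u = 0
  X_u : X u = 0
  T_u : T u = p
  U_u : U u = 1
  P_e : P e = 0
  Q_e : Q e = 0
  X_e : X e = 0
  T_e : T e = e
  U_e : U e = 0
  P_e' : P e' = 0
  Q_e' : Q e' = 0
  X_e' : X e' = 0
  T_e' : T e' = -e'
  U_e' : U e' = 0

namespace JetFrame

variable {A : Type*} [CommRing A] [Algebra ℝ A] (F : JetFrame A)

/-- The linearized conditions for the components of an infinitesimal contact symmetry. -/
structure Infinitesimal (X₀ X₁ X₂ X₃ X₄ : A) : Prop where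
  h3 : F.P X₂ = F.p * F.P X₀ + F.q * F.P X₁
  h4 : F.Q X₂ = F.p * F.Q X₀ + F.q * F.Q X₁
  ht : F.T X₂ + F.p * F.P X₂ - F.p * (F.T X₀ + F.p * F.P X₀) - F.q * (F.T X₁ + F.p * F.P X₁) = X₃
  hx : F.X X₂ + F.q * F.U X₂ - F.p * (F.X X₀ + F.q * F.U X₀) - F.q * (F.X X₁ + F.q * F.U X₁) = X₄
  -- The digits number the frame D_t, D_x, ∂_p, ∂_q. Each condition is one component of the
  -- statement that the Lie derivative of the two-form is a multiple of it, with the multiplier read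
  -- off from the pair (∂_q, D_t).
  w34 : F.P X₀ = F.q * F.Q X₁
  w13 : F.q * F.T X₁ + F.P X₄ = 0
  w32 : F.q * F.P X₃ + F.p * F.q * F.P X₀ + F.q * (F.X X₁ + F.q * F.U X₁) + X₄ =
    F.q * (F.Q X₄ - F.p * F.q * F.Q X₁ + F.T X₀ + F.p * F.P X₀)
  w12 : F.q * (F.T X₃ + F.p * F.P X₃) + F.p * F.q * (F.T X₀ + F.p * F.P X₀) -
      (F.X X₄ + F.q * F.U X₄) + F.p * F.q * (F.X X₁ + F.q * F.U X₁) + F.q * X₃ + F.p * X₄ =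
    F.p * F.q * (F.Q X₄ - F.p * F.q * F.Q X₁ + F.T X₀ + F.p * F.P X₀)

variable {F}

/-- The components of an infinitesimal contact symmetry in terms of its generating function. -/
theorem Infinitesimal.exists_generating {X₀ X₁ X₂ X₃ X₄ : A}
    (h : F.Infinitesimal X₀ X₁ X₂ X₃ X₄) : ∃ f : A, F.Determining f ∧ X₀ = -F.P f ∧ X₁ = -F.Q f ∧
      X₂ = f - F.p * F.P f - F.q * F.Q f ∧ X₃ = F.T f + F.p * F.P f ∧ X₄ = F.X f + F.q * F.U f := by
  obtain ⟨h3, h4, ht, hx, w34, w13, w32, w12⟩ := h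
  set f := X₂ - F.p * X₀ - F.q * X₁ with hf
  have e0 : X₀ = -F.P f := by
    simp only [hf, map_sub, Derivation.leibniz, smul_eq_mul, F.P_p, F.P_q]
    linear_combination h3
  have e1 : X₁ = -F.Q f := by
    simp only [hf, map_sub, Derivation.leibniz, smul_eq_mul, F.Q_p, F.Q_q]
    linear_combination h4
  have e2 : X₂ = f - F.p * F.P f - F.q * F.Q f := by
    linear_combination -hf + F.p * e0 + F.q * e1
  have e3 : X₃ = F.T f + F.p * F.P f := by
    have hT : F.T f = F.T X₂ - (F.p * F.T X₀ - F.p * X₀) - F.q * F.T X₁ := by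
      simp only [hf, map_sub, Derivation.leibniz, smul_eq_mul, F.T_p, F.T_q]
      ring
    linear_combination -ht - hT - F.p * e0 + F.p * h3
  have e4 : X₄ = F.X f + F.q * F.U f := by
    simp only [hf, map_sub, Derivation.leibniz, smul_eq_mul, F.X_p, F.X_q, F.U_p, F.U_q]
    linear_combination -hx
  clear_value f
  subst e0 e1 e2 e3 e4
  simp only [map_add, map_neg, Derivation.leibniz, smul_eq_mul, F.P_p, F.T_p, F.P_q, F.Q_q, F.X_q,
    F.U_q, F.X_U, F.Q_U, F.Q_X, F.P_U, F.P_X, F.P_T] at w34 w13 w32 w12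
  refine ⟨f, ⟨?_, ?_, ?_, ?_⟩, rfl, rfl, rfl, rfl, rfl⟩
  · linear_combination -w34
  · linear_combination w32 + F.q * F.p * w34
  · linear_combination -w13
  · linear_combination w12 - F.p * w32

/-- An infinitesimal contact symmetry is a combination of the five basis fields, with coefficients
that are annihilated by all derivations of the frame. -/
theorem Infinitesimal.exists_constants {X₀ X₁ X₂ X₃ X₄ : A}
    (h : F.Infinitesimal X₀ X₁ X₂ X₃ X₄) : ∃ c : Fin 5 → A,
      (∀ i, F.P (c i) = 0 ∧ F.Q (c i) = 0 ∧ F.X (c i) = 0 ∧ F.T (c i) = 0 ∧ F.U (c i) = 0) ∧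
      X₀ = c 0 ∧ X₁ = c 1 - c 4 * F.x ∧ X₂ = c 2 + c 3 * F.e' + c 4 * F.u ∧
      X₃ = -(c 3 * F.e') + c 4 * F.p ∧ X₄ = 2 * (c 4 * F.q) := by
  obtain ⟨f, hf, rfl, rfl, rfl, rfl, rfl⟩ := h.exists_generating
  obtain ⟨x, tt, uu, ux, ut, uq, up, xp, tp, qp, pp, xq, tq, qq, xt⟩ := hf.derivatives
  -- Y is ∂_t f. The constants are read off from f = -c₀ p - c₁ q + c₂ + c₃ e^(-t) + c₄ (u + x q).
  set Y := F.T f - F.p * F.U f + F.p * F.P f with hY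
  have k0 : ∀ c, c = -F.P f →
      F.P c = 0 ∧ F.Q c = 0 ∧ F.X c = 0 ∧ F.T c = 0 ∧ F.U c = 0 := by
    rintro _ rfl
    simp only [map_neg, pp, qp, xp, tp, up, neg_zero, and_self]
  have k4 : ∀ c, c = F.U f → F.P c = 0 ∧ F.Q c = 0 ∧ F.X c = 0 ∧ F.T c = 0 ∧ F.U c = 0 := by
    rintro _ rfl
    simp only [F.P_U, F.Q_U, F.X_U, F.T_U, up, uq, ux, ut, uu, and_self]
  have k1 : ∀ c, c = -F.Q f + F.U f * F.x →
      F.P c = 0 ∧ F.Q c = 0 ∧ F.X c = 0 ∧ F.T c = 0 ∧ F.U c = 0 := by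
    rintro _ rfl
    simp [F.P_U, F.Q_U, F.X_U, F.T_U, up, uq, ux, ut, uu, F.P_Q, qp, qq, xq, tq, F.P_x, F.Q_x,
      F.X_x, F.T_x, F.U_x]
  have k3 : ∀ c, c = -(F.e * Y) →
      F.P c = 0 ∧ F.Q c = 0 ∧ F.X c = 0 ∧ F.T c = 0 ∧ F.U c = 0 := by
    rintro _ rfl
    simp [hY, F.P_U, F.Q_U, F.X_U, F.T_U, up, uq, ux, ut, uu, F.P_T, F.Q_T, tp, qp, pp, tq, xp, xt,
      F.P_e, F.Q_e, F.X_e, F.T_e, F.U_e, F.P_p, F.Q_p, F.X_p, F.T_p, F.U_p]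
    linear_combination -F.e * tt
  obtain ⟨p0, q0, x0, t0, u0⟩ := k0 _ rfl
  obtain ⟨p1, q1, x1, t1, u1⟩ := k1 _ rfl
  obtain ⟨p3, q3, x3, t3, u3⟩ := k3 _ rfl
  obtain ⟨p4, q4, x4, t4, u4⟩ := k4 _ rfl
  have k2 : ∀ c, c = f + -F.P f * F.p + (-F.Q f + F.U f * F.x) * F.q - -(F.e * Y) * F.e' -
      F.U f * (F.u + F.x * F.q) →
      F.P c = 0 ∧ F.Q c = 0 ∧ F.X c = 0 ∧ F.T c = 0 ∧ F.U c = 0 := by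
    rintro _ rfl
    refine ⟨?_, ?_, ?_, ?_, ?_⟩
    · rw [map_sub, map_sub, map_add, map_add, Derivation.leibniz, Derivation.leibniz,
        Derivation.leibniz _ (-(F.e * Y)), Derivation.leibniz _ (F.U f), p0, p1, p3, p4]
      simp [F.P_p, F.P_q, F.P_e', F.P_u, F.P_x]
    · rw [map_sub, map_sub, map_add, map_add, Derivation.leibniz, Derivation.leibniz,
        Derivation.leibniz _ (-(F.e * Y)), Derivation.leibniz _ (F.U f), q0, q1, q3, q4]
      simp [F.Q_p, F.Q_q, F.Q_e', F.Q_u, F.Q_x]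
    · rw [map_sub, map_sub, map_add, map_add, Derivation.leibniz, Derivation.leibniz,
        Derivation.leibniz _ (-(F.e * Y)), Derivation.leibniz _ (F.U f), x0, x1, x3, x4]
      simp [F.X_p, F.X_q, F.X_e', F.X_u, F.X_x]
      linear_combination x
    · rw [map_sub, map_sub, map_add, map_add, Derivation.leibniz, Derivation.leibniz,
        Derivation.leibniz _ (-(F.e * Y)), Derivation.leibniz _ (F.U f), t0, t1, t3, t4]
      simp [F.T_p, F.T_q, F.T_e', F.T_u, F.T_x]
      linear_combination -Y * F.e_mul_e' - hY
    · rw [map_sub, map_sub, map_add, map_add, Derivation.leibniz, Derivation.leibniz,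
        Derivation.leibniz _ (-(F.e * Y)), Derivation.leibniz _ (F.U f), u0, u1, u3, u4]
      simp [F.U_p, F.U_q, F.U_e', F.U_u, F.U_x]
  refine ⟨![-F.P f, -F.Q f + F.U f * F.x, f + -F.P f * F.p + (-F.Q f + F.U f * F.x) * F.q -
    -(F.e * Y) * F.e' - F.U f * (F.u + F.x * F.q), -(F.e * Y), F.U f], fun i => ?_, rfl,
    ?_, ?_, ?_, ?_⟩
  · fin_cases i
    exacts [k0 _ rfl, k1 _ rfl, k2 _ rfl, k3 _ rfl, k4 _ rfl]
  · simp
  · simp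
    ring
  · simp
    linear_combination -hY - Y * F.e_mul_e'
  · simp
    linear_combination x

end JetFrame

/-! ### Smooth functions on an open set as such a ring. -/

/-- The algebra of real functions on `U` that have a smooth extension to the jet space near `U`. -/
def smoothAlgebra (U : Set Jet) : Subalgebra ℝ (U → ℝ) where
  carrier := {f | ∃ g : Jet → ℝ, ContDiffOn ℝ ∞ g U ∧ ∀ z : U, f z = g z}
  mul_mem' := by
    rintro f f' ⟨g, hg, h⟩ ⟨g', hg', h'⟩
    exact ⟨fun z => g z * g' z, hg.mul hg', fun z => by rw [Pi.mul_apply, h, h']⟩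
  add_mem' := by
    rintro f f' ⟨g, hg, h⟩ ⟨g', hg', h'⟩
    exact ⟨fun z => g z + g' z, hg.add hg', fun z => by rw [Pi.add_apply, h, h']⟩
  algebraMap_mem' r := ⟨fun _ => r, contDiffOn_const, fun _ => rfl⟩

/-- The element of the smooth algebra given by a function that is smooth on `U`. -/
def toSmooth {U : Set Jet} (g : Jet → ℝ) (hg : ContDiffOn ℝ ∞ g U) : smoothAlgebra U :=
  ⟨fun z => g z, g, hg, fun _ => rfl⟩

theorem exists_eq_toSmooth {U : Set Jet} (f : smoothAlgebra U) :
    ∃ g, ∃ hg : ContDiffOn ℝ ∞ g U, f = toSmooth g hg := by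
  obtain ⟨f, g, hg, h⟩ := f
  exact ⟨g, hg, Subtype.ext (funext h)⟩

theorem smoothAlgebra_ext {U : Set Jet} {f g : smoothAlgebra U}
    (h : ∀ z : U, (f : U → ℝ) z = (g : U → ℝ) z) : f = g := Subtype.ext (funext h)

/-- The derivative in the direction of `v`, as a function. -/
noncomputable def directional {U : Set Jet} (v : Jet) (f : smoothAlgebra U) (z : Jet) : ℝ :=
  fderiv ℝ (Classical.choose f.2) z v

/-- On an open set the derivative does not depend on the chosen extension. -/
theorem directional_toSmooth {U : Set Jet} (hU : IsOpen U) (v : Jet) {g : Jet → ℝ}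
    (hg : ContDiffOn ℝ ∞ g U) {z : Jet} (hz : z ∈ U) :
    directional v (toSmooth g hg) z = fderiv ℝ g z v := by
  have h := Classical.choose_spec (toSmooth g hg).2
  rw [directional, Filter.EventuallyEq.fderiv_eq]
  filter_upwards [hU.mem_nhds hz] with y hy
  exact (h.2 ⟨y, hy⟩).symm

theorem contDiffOn_fderiv_apply {U : Set Jet} (hU : IsOpen U) {g : Jet → ℝ}
    (hg : ContDiffOn ℝ ∞ g U) (v : Jet) : ContDiffOn ℝ ∞ (fun z => fderiv ℝ g z v) U :=
  (hg.fderiv_of_isOpen hU (by simp)).clm_apply contDiffOn_const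

/-- The derivative in the direction of `v`, as a derivation of the smooth algebra. -/
noncomputable def partialDeriv {U : Set Jet} (hU : IsOpen U) (v : Jet) :
    Derivation ℝ (smoothAlgebra U) (smoothAlgebra U) :=
  Derivation.mk'
    { toFun := fun f => ⟨fun z => directional v f z, by
        obtain ⟨g, hg, rfl⟩ := exists_eq_toSmooth f
        exact ⟨fun z => fderiv ℝ g z v, contDiffOn_fderiv_apply hU hg v,
          fun z => directional_toSmooth hU v hg z.2⟩⟩
      map_add' := by
        intro f f'
        obtain ⟨g, hg, rfl⟩ := exists_eq_toSmooth f
        obtain ⟨g', hg', rfl⟩ := exists_eq_toSmooth f'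
        refine smoothAlgebra_ext fun z => ?_
        have hd := ((hg z z.2).contDiffAt (hU.mem_nhds z.2)).differentiableAt (by simp)
        have hd' := ((hg' z z.2).contDiffAt (hU.mem_nhds z.2)).differentiableAt (by simp)
        have e : toSmooth g hg + toSmooth g' hg' = toSmooth (fun z => g z + g' z) (hg.add hg') := rfl
        change directional v _ z = directional v _ z + directional v _ z
        rw [e, directional_toSmooth hU v _ z.2, directional_toSmooth hU v _ z.2,
          directional_toSmooth hU v _ z.2, fderiv_fun_add hd hd']
        rfl
      map_smul' := by
        intro c f
        obtain ⟨g, hg, rfl⟩ := exists_eq_toSmooth f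
        refine smoothAlgebra_ext fun z => ?_
        have hd := ((hg z z.2).contDiffAt (hU.mem_nhds z.2)).differentiableAt (by simp)
        have e : c • toSmooth g hg = toSmooth (fun z => c • g z) (hg.const_smul c) := rfl
        change directional v _ z = c • directional v _ z
        rw [e, directional_toSmooth hU v _ z.2, directional_toSmooth hU v _ z.2,
          fderiv_fun_const_smul hd]
        rfl } (by
    intro f f'
    obtain ⟨g, hg, rfl⟩ := exists_eq_toSmooth f
    obtain ⟨g', hg', rfl⟩ := exists_eq_toSmooth f'
    refine smoothAlgebra_ext fun z => ?_
    have hd := ((hg z z.2).contDiffAt (hU.mem_nhds z.2)).differentiableAt (by simp)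
    have hd' := ((hg' z z.2).contDiffAt (hU.mem_nhds z.2)).differentiableAt (by simp)
    have e : toSmooth g hg * toSmooth g' hg' = toSmooth (fun z => g z * g' z) (hg.mul hg') := rfl
    change directional v _ z = g z * directional v _ z + g' z * directional v _ z
    rw [e, directional_toSmooth hU v _ z.2, directional_toSmooth hU v _ z.2,
      directional_toSmooth hU v _ z.2, fderiv_fun_mul hd hd']
    simp)

theorem partialDeriv_apply {U : Set Jet} (hU : IsOpen U) (v : Jet) {g : Jet → ℝ}
    (hg : ContDiffOn ℝ ∞ g U) (z : U) :
    (partialDeriv hU v (toSmooth g hg) : U → ℝ) z = fderiv ℝ g z v :=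
  directional_toSmooth hU v hg z.2

theorem partialDeriv_toSmooth {U : Set Jet} (hU : IsOpen U) (v : Jet) {g : Jet → ℝ}
    (hg : ContDiffOn ℝ ∞ g U) : partialDeriv hU v (toSmooth g hg) =
      toSmooth (fun z => fderiv ℝ g z v) (contDiffOn_fderiv_apply hU hg v) :=
  smoothAlgebra_ext fun z => partialDeriv_apply hU v hg z

theorem partialDeriv_comm {U : Set Jet} (hU : IsOpen U) (v w : Jet) (f : smoothAlgebra U) :
    partialDeriv hU v (partialDeriv hU w f) = partialDeriv hU w (partialDeriv hU v f) := by
  obtain ⟨g, hg, rfl⟩ := exists_eq_toSmooth f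
  refine smoothAlgebra_ext fun z => ?_
  have hgz : ContDiffAt ℝ ∞ g z := hg.contDiffAt (hU.mem_nhds z.2)
  have hd : DifferentiableAt ℝ (fderiv ℝ g) z :=
    (hgz.fderiv_right (m := 1) (by norm_cast)).differentiableAt (by norm_num)
  rw [partialDeriv_toSmooth hU w hg, partialDeriv_toSmooth hU v hg, partialDeriv_apply,
    partialDeriv_apply,
    fderiv_clm_apply hd (by fun_prop), fderiv_clm_apply hd (by fun_prop)]
  simpa using hgz.isSymmSndFDerivAt (by
    rw [minSmoothness_of_isRCLikeNormedField]; exact WithTop.coe_le_coe.mpr le_top) v w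

theorem partialDeriv_of_hasFDerivAt {U : Set Jet} (hU : IsOpen U) (v : Jet) {g : Jet → ℝ}
    (hg : ContDiffOn ℝ ∞ g U) {g' : Jet → Jet →L[ℝ] ℝ} (h : ∀ z, HasFDerivAt g (g' z) z)
    {a : Jet → ℝ} (ha : ContDiffOn ℝ ∞ a U) (hga : ∀ z, g' z v = a z) :
    partialDeriv hU v (toSmooth g hg) = toSmooth a ha :=
  smoothAlgebra_ext fun z => by
    rw [partialDeriv_apply, (h z).fderiv, hga]
    rfl

theorem contDiff_coord (i : Fin 5) : ContDiff ℝ ∞ fun z : Jet => z i := contDiff_apply ℝ ℝ i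

/-- The `i`-th coordinate function. -/
noncomputable def coordFn (U : Set Jet) (i : Fin 5) : smoothAlgebra U :=
  toSmooth (fun z => z i) (contDiff_coord i).contDiffOn

theorem partialDeriv_coordFn {U : Set Jet} (hU : IsOpen U) (v : Jet) (i : Fin 5) :
    partialDeriv hU v (coordFn U i) = algebraMap ℝ _ (v i) :=
  partialDeriv_of_hasFDerivAt hU v _
    (fun _ => (ContinuousLinearMap.proj (R := ℝ) (φ := fun _ : Fin 5 => ℝ) i).hasFDerivAt)
    contDiffOn_const fun _ => rfl

/-- The function `e ^ (s t)`. -/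
noncomputable def expFn (U : Set Jet) (s : ℝ) : smoothAlgebra U :=
  toSmooth (fun z => Real.exp (s * z 0))
    (Real.contDiff_exp.comp (contDiff_const.mul (contDiff_coord 0))).contDiffOn

theorem partialDeriv_expFn {U : Set Jet} (hU : IsOpen U) (v : Jet) (s : ℝ) :
    partialDeriv hU v (expFn U s) = algebraMap ℝ _ (s * v 0) * expFn U s := by
  refine partialDeriv_of_hasFDerivAt hU v _
    (fun z => ((ContinuousLinearMap.proj (R := ℝ) (φ := fun _ : Fin 5 => ℝ) 0).hasFDerivAt.const_mul
      s).exp)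
    (contDiffOn_const.mul
      (Real.contDiff_exp.comp (contDiff_const.mul (contDiff_coord 0))).contDiffOn) fun z => ?_
  simp only [smul_apply, ContinuousLinearMap.proj_apply, smul_eq_mul]
  change _ = s * v 0 * Real.exp (s * z 0)
  ring

/-- The frame of derivations on the smooth functions on `U`. -/
noncomputable def jetFrame {U : Set Jet} (hU : IsOpen U) (hq : ∀ z ∈ U, z 4 ≠ 0) :
    JetFrame (smoothAlgebra U) where
  P := partialDeriv hU (Pi.single 3 1)
  Q := partialDeriv hU (Pi.single 4 1)
  X := partialDeriv hU (Pi.single 1 1)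
  U := partialDeriv hU (Pi.single 2 1)
  T := partialDeriv hU (Pi.single 0 1) +
    coordFn U 3 • (partialDeriv hU (Pi.single 2 1) - partialDeriv hU (Pi.single 3 1))
  q := coordFn U 4
  p := coordFn U 3
  x := coordFn U 1
  u := coordFn U 2
  e := expFn U 1
  e' := expFn U (-1)
  q_cancel f hf := smoothAlgebra_ext fun z => by
    have h : (z : Jet) 4 * (f : U → ℝ) z = 0 := congrFun (congrArg Subtype.val hf) z
    exact (mul_eq_zero.mp h).resolve_left (hq z z.2)
  X_U := partialDeriv_comm hU _ _
  Q_U := partialDeriv_comm hU _ _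
  Q_X := partialDeriv_comm hU _ _
  P_U := partialDeriv_comm hU _ _
  P_X := partialDeriv_comm hU _ _
  P_Q := partialDeriv_comm hU _ _
  T_U f := by
    simp [Derivation.leibniz, partialDeriv_coordFn, partialDeriv_comm hU _ (Pi.single 2 1)]
  T_X f := by
    simp [Derivation.leibniz, partialDeriv_coordFn, partialDeriv_comm hU _ (Pi.single 1 1)]
  Q_T f := by
    simp [Derivation.leibniz, partialDeriv_coordFn, partialDeriv_comm hU _ (Pi.single 4 1)]
  P_T f := by
    simp [Derivation.leibniz, partialDeriv_coordFn, partialDeriv_comm hU _ (Pi.single 3 1)]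
    ring
  e_mul_e' := smoothAlgebra_ext fun z => by
    change Real.exp (1 * (z : Jet) 0) * Real.exp (-1 * (z : Jet) 0) = 1
    rw [← Real.exp_add]
    simp
  P_q := by simp [partialDeriv_coordFn]
  Q_q := by simp [partialDeriv_coordFn]
  X_q := by simp [partialDeriv_coordFn]
  U_q := by simp [partialDeriv_coordFn]
  T_q := by simp [partialDeriv_coordFn]
  P_p := by simp [partialDeriv_coordFn]
  Q_p := by simp [partialDeriv_coordFn]
  X_p := by simp [partialDeriv_coordFn]
  U_p := by simp [partialDeriv_coordFn]
  T_p := by simp [partialDeriv_coordFn]; ring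
  P_x := by simp [partialDeriv_coordFn]
  Q_x := by simp [partialDeriv_coordFn]
  X_x := by simp [partialDeriv_coordFn]
  U_x := by simp [partialDeriv_coordFn]
  T_x := by simp [partialDeriv_coordFn]
  P_u := by simp [partialDeriv_coordFn]
  Q_u := by simp [partialDeriv_coordFn]
  X_u := by simp [partialDeriv_coordFn]
  U_u := by simp [partialDeriv_coordFn]
  T_u := by simp [partialDeriv_coordFn]
  P_e := by simp [partialDeriv_expFn]
  Q_e := by simp [partialDeriv_expFn]
  X_e := by simp [partialDeriv_expFn]
  U_e := by simp [partialDeriv_expFn]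
  T_e := by simp [partialDeriv_expFn]
  P_e' := by simp [partialDeriv_expFn]
  Q_e' := by simp [partialDeriv_expFn]
  X_e' := by simp [partialDeriv_expFn]
  U_e' := by simp [partialDeriv_expFn]
  T_e' := by simp [partialDeriv_expFn]; ring


/-! ### Generators are combinations of the five basis fields. -/

/-- The combination of the basis fields with coefficients `c`. -/
noncomputable def field (c : Fin 5 → ℝ) (z : Jet) : Jet :=
  ![c 0, c 1 - c 4 * z 1, c 2 + c 3 * Real.exp (-z 0) + c 4 * z 2,
    -(c 3 * Real.exp (-z 0)) + c 4 * z 3, 2 * (c 4 * z 4)]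

/-- The Lie derivative of the two-form of the equation along a vector field with value `X` and
derivative `B` at `z`. -/
def lieHeatForm (z X : Jet) (B : Jet →L[ℝ] Jet) (v w : Jet) : ℝ :=
  heatForm z (B v) w + heatForm z v (B w) + X 4 * (v 3 * w 1 - v 1 * w 3) +
    (X 3 * z 4 + z 3 * X 4) * (v 0 * w 1 - v 1 * w 0)

/-- The vector field `X` preserves infinitesimally, at `z`, the contact form up to a factor, and the
two-form of the equation up to a factor on the contact hyperplane. -/
structure InfinitesimalAt (X : Jet → Jet) (z : Jet) : Prop where
  contact : ∀ v, contactForm z v = 0 →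
    contactForm z (fderiv ℝ X z v) - X z 3 * v 0 - X z 4 * v 1 = 0
  heat : ∃ m, ∀ v w, contactForm z v = 0 → contactForm z w = 0 →
    lieHeatForm z (X z) (fderiv ℝ X z) v w = m * heatForm z v w

theorem infinitesimal_of_infinitesimalAt {U : Set Jet} (hU : IsOpen U) (hq : ∀ z ∈ U, z 4 ≠ 0)
    {X : Jet → Jet} (hX : ∀ i, ContDiffOn ℝ ∞ (fun z => X z i) U)
    (h : ∀ z ∈ U, InfinitesimalAt X z) :
    (jetFrame hU hq).Infinitesimal (toSmooth _ (hX 0)) (toSmooth _ (hX 1)) (toSmooth _ (hX 2))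
      (toSmooth _ (hX 3)) (toSmooth _ (hX 4)) := by
  set F := jetFrame hU hq with hF
  have key : ∀ i (z : U) v, ((partialDeriv hU v) (toSmooth _ (hX i)) : U → ℝ) z =
      fderiv ℝ X z v i := by
    intro i z v
    have hd : ∀ i, DifferentiableAt ℝ (fun y => X y i) z := fun i =>
      ((hX i z z.2).contDiffAt (hU.mem_nhds z.2)).differentiableAt (by simp)
    rw [partialDeriv_apply, fderiv_pi hd]
    rfl
  have hP : ∀ i (z : U), (F.P (toSmooth _ (hX i)) : U → ℝ) z =
      fderiv ℝ X z (Pi.single 3 1) i := fun i z => key i z _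
  have hQ : ∀ i (z : U), (F.Q (toSmooth _ (hX i)) : U → ℝ) z =
      fderiv ℝ X z (Pi.single 4 1) i := fun i z => key i z _
  have hx : ∀ i (z : U), (F.X (toSmooth _ (hX i)) : U → ℝ) z =
      fderiv ℝ X z (Pi.single 1 1) i := fun i z => key i z _
  have hu : ∀ i (z : U), (F.U (toSmooth _ (hX i)) : U → ℝ) z =
      fderiv ℝ X z (Pi.single 2 1) i := fun i z => key i z _
  have hT : ∀ i (z : U), (F.T (toSmooth _ (hX i)) : U → ℝ) z =
      fderiv ℝ X z (Pi.single 0 1) i +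
        (z : Jet) 3 * (fderiv ℝ X z (Pi.single 2 1) i - fderiv ℝ X z (Pi.single 3 1) i) := by
    intro i z
    rw [← key, ← key, ← key]
    rfl
  have hp : ∀ z : U, (F.p : U → ℝ) z = (z : Jet) 3 := fun z => rfl
  have hq' : ∀ z : U, (F.q : U → ℝ) z = (z : Jet) 4 := fun z => rfl
  have hval : ∀ i (z : U), ((toSmooth _ (hX i) : smoothAlgebra U) : U → ℝ) z = X z i :=
    fun i z => rfl
  have dt : ∀ z : Jet, (![1, 0, z 3, 0, 0] : Jet) = Pi.single 0 1 + z 3 • Pi.single 2 1 := by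
    intro z; ext i; fin_cases i <;> simp
  have dx : ∀ z : Jet, (![0, 1, z 4, 0, 0] : Jet) = Pi.single 1 1 + z 4 • Pi.single 2 1 := by
    intro z; ext i; fin_cases i <;> simp
  have ct : ∀ z : Jet, contactForm z (Pi.single 0 1 + z 3 • Pi.single 2 1) = 0 := by
    intro z; simp [contactForm]
  have cx : ∀ z : Jet, contactForm z (Pi.single 1 1 + z 4 • Pi.single 2 1) = 0 := by
    intro z; simp [contactForm]
  have c3 : ∀ z : Jet, contactForm z (Pi.single 3 1) = 0 := by intro z; simp [contactForm]
  have c4 : ∀ z : Jet, contactForm z (Pi.single 4 1) = 0 := by intro z; simp [contactForm]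
  constructor <;> refine smoothAlgebra_ext fun z => ?_ <;>
    simp only [Subalgebra.coe_add, Subalgebra.coe_sub, Subalgebra.coe_mul, Subalgebra.coe_zero,
      Pi.add_apply, Pi.sub_apply, Pi.mul_apply, Pi.zero_apply, hP, hQ, hx, hu, hT, hp, hq', hval]
  · have e := (h z z.2).contact _ (c3 z)
    simp [contactForm] at e
    linarith
  · have e := (h z z.2).contact _ (c4 z)
    simp [contactForm] at e
    linarith
  · have e := (h z z.2).contact _ (ct z)
    simp [contactForm] at e
    linarith
  · have e := (h z z.2).contact _ (cx z)
    simp [contactForm] at e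
    linarith
  all_goals obtain ⟨m, hm⟩ := (h z z.2).heat
  · have e := hm _ _ (c3 z) (c4 z)
    simp [lieHeatForm, heatForm] at e
    linarith
  · have e := hm _ _ (ct z) (c3 z)
    simp [lieHeatForm, heatForm] at e
    linarith
  · have e := hm _ _ (c3 z) (cx z)
    -- The two-form equals 1 on this pair, so `e'` expresses the multiplier m.
    have e' := hm _ _ (c4 z) (ct z)
    simp [lieHeatForm, heatForm] at e e'
    rw [← e'] at e
    linarith
  · have e := hm _ _ (ct z) (cx z)
    have e' := hm _ _ (c4 z) (ct z)
    simp [lieHeatForm, heatForm] at e e'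
    rw [← e'] at e
    linarith

theorem exists_field_eq {U : Set Jet} (hU : IsOpen U) (hc : IsConnected U) (hq : ∀ z ∈ U, z 4 ≠ 0)
    {X : Jet → Jet} (hX : ContDiffOn ℝ ∞ X U) (h : ∀ z ∈ U, InfinitesimalAt X z) :
    ∃ c, ∀ z ∈ U, X z = field c z := by
  have hX' : ∀ i, ContDiffOn ℝ ∞ (fun z => X z i) U := fun i => (contDiff_coord i).comp_contDiffOn hX
  obtain ⟨c, hc0, e0, e1, e2, e3, e4⟩ :=
    (infinitesimal_of_infinitesimalAt hU hq hX' h).exists_constants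
  have hconst : ∀ i, ∃ a : ℝ, ∀ z : U, (c i : U → ℝ) z = a := by
    intro i
    obtain ⟨hP, hQ, hx, hT, hu⟩ := hc0 i
    obtain ⟨g, hg, hgc⟩ := exists_eq_toSmooth (c i)
    have hgd : DifferentiableOn ℝ g U := hg.differentiableOn (by simp)
    have hz : ∀ v, partialDeriv hU v (c i) = 0 → ∀ z ∈ U, fderiv ℝ g z v = 0 := by
      intro v hv z hz
      rw [hgc] at hv
      rw [← partialDeriv_apply hU v hg ⟨z, hz⟩, hv]
      rfl
    have hT' : partialDeriv hU (Pi.single 0 1) (c i) = 0 := by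
      have : partialDeriv hU (Pi.single 0 1) (c i) + coordFn U 3 *
          (partialDeriv hU (Pi.single 2 1) (c i) - partialDeriv hU (Pi.single 3 1) (c i)) = 0 := hT
      have h2 : partialDeriv hU (Pi.single 2 1) (c i) = 0 := hu
      have h3 : partialDeriv hU (Pi.single 3 1) (c i) = 0 := hP
      rw [h2, h3] at this
      linear_combination this
    obtain ⟨a, ha⟩ := hU.exists_is_const_of_fderiv_eq_zero hc.isPreconnected hgd (fun z hz' => by
      ext v
      have hv : v = ∑ j, v j • (Pi.single j 1 : Jet) := by
        ext k; simp [Finset.sum_apply, Pi.single_apply]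
      rw [hv, map_sum]
      simp only [map_smul]
      refine Finset.sum_eq_zero fun j _ => ?_
      rw [show fderiv ℝ g z (Pi.single j 1) = 0 from ?_, smul_zero]
      fin_cases j
      exacts [hz _ hT' z hz', hz _ hx z hz', hz _ hu z hz', hz _ hP z hz', hz _ hQ z hz'])
    refine ⟨a, fun z => ?_⟩
    rw [hgc]
    exact ha z z.2
  choose a ha using hconst
  refine ⟨a, fun z hz => ?_⟩
  have f0 := congrFun (congrArg Subtype.val e0) ⟨z, hz⟩
  have f1 := congrFun (congrArg Subtype.val e1) ⟨z, hz⟩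
  have f2 := congrFun (congrArg Subtype.val e2) ⟨z, hz⟩
  have f3 := congrFun (congrArg Subtype.val e3) ⟨z, hz⟩
  have f4 := congrFun (congrArg Subtype.val e4) ⟨z, hz⟩
  simp only [Subalgebra.coe_add, Subalgebra.coe_sub, Subalgebra.coe_mul, Subalgebra.coe_neg,
      Pi.add_apply, Pi.sub_apply, Pi.mul_apply, Pi.neg_apply, ha] at f0 f1 f2 f3 f4
  have he : ((jetFrame hU hq).e' : U → ℝ) ⟨z, hz⟩ = Real.exp (-z 0) := by
    change Real.exp (-1 * z 0) = _
    rw [neg_one_mul]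
  rw [he] at f2 f3
  ext i
  fin_cases i
  exacts [f0, f1, f2, f3, f4]

/-- Both conditions are time derivatives at 0 of the `PreservesAt` relations for the flow. -/
theorem IsContactGenerator.infinitesimalAt {U : Set Jet} (hq : ∀ z ∈ U, z 4 ≠ 0)
    {X : Jet → Jet} (h : IsContactGenerator U X) {z : Jet} (hz : z ∈ U) : InfinitesimalAt X z := by
  obtain ⟨-, h⟩ := h
  obtain ⟨ε, hε, V, hV, hzV, hVU, φ, hφ, h0, hflow, hsym⟩ := h z hz
  have hmem : ∀ w ∈ V, ((0 : ℝ), w) ∈ Ioo (-ε) ε ×ˢ V := fun w hw => ⟨⟨by linarith, hε⟩, hw⟩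
  have hopen : IsOpen (Ioo (-ε) ε ×ˢ V) := isOpen_Ioo.prod hV
  set Φ : ℝ × Jet → Jet := fun a => φ a.1 a.2 with hΦ
  have hΦz : ∀ a ∈ Ioo (-ε) ε ×ˢ V, ContDiffAt ℝ ∞ Φ a := fun a ha =>
    hφ.contDiffAt (hopen.mem_nhds ha)
  have hΦd : ∀ a ∈ Ioo (-ε) ε ×ˢ V, DifferentiableAt ℝ Φ a := fun a ha =>
    (hΦz a ha).differentiableAt (by simp)
  have hdd : DifferentiableAt ℝ (fderiv ℝ Φ) (0, z) :=
    ((hΦz _ (hmem z hzV)).fderiv_right (m := 1) (by norm_cast)).differentiableAt (by norm_num)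
  have hspace : ∀ s ∈ Ioo (-ε) ε, ∀ w ∈ V, ∀ v, fderiv ℝ (φ s) w v = fderiv ℝ Φ (s, w) (0, v) := by
    intro s hs w hw v
    have h1 : HasFDerivAt (fun y : Jet => (s, y)) (ContinuousLinearMap.inr ℝ ℝ Jet) w :=
      hasFDerivAt_prodMk_right s w
    have h2 := (hΦd (s, w) ⟨hs, hw⟩).hasFDerivAt.comp w h1
    have h3 : HasFDerivAt (φ s) _ w := h2
    rw [h3.fderiv]
    simp
  have htime : ∀ w ∈ V, fderiv ℝ Φ (0, w) (1, 0) = X w := by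
    intro w hw
    have h1 : HasDerivAt (fun s : ℝ => (s, w)) ((1 : ℝ), (0 : Jet)) 0 :=
      (hasDerivAt_id 0).prodMk (hasDerivAt_const 0 w)
    have h2 := (hΦd (0, w) (hmem w hw)).hasFDerivAt.comp_hasDerivAt 0 h1
    have h3 := (hflow 0 ⟨by linarith, hε⟩ w hw).2
    rw [h0 w hw] at h3
    exact h2.unique h3
  -- The time derivative of the spatial derivative of the flow is the spatial derivative of X, by
  -- symmetry of second derivatives.
  have hmixed : ∀ v, fderiv ℝ (fderiv ℝ Φ) (0, z) (1, 0) (0, v) = fderiv ℝ X z v := by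
    intro v
    rw [(hΦz _ (hmem z hzV)).isSymmSndFDerivAt (by
      rw [minSmoothness_of_isRCLikeNormedField]; exact WithTop.coe_le_coe.mpr le_top) (1, 0) (0, v)]
    have h1 : HasFDerivAt (fun y : Jet => ((0 : ℝ), y)) (ContinuousLinearMap.inr ℝ ℝ Jet) z :=
      hasFDerivAt_prodMk_right 0 z
    have h2 := (ContinuousLinearMap.apply ℝ Jet ((1 : ℝ), (0 : Jet))).hasFDerivAt.comp z
      (HasFDerivAt.comp z hdd.hasFDerivAt h1)
    have h3 : X =ᶠ[nhds z] fun y => fderiv ℝ Φ (0, y) (1, 0) := by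
      filter_upwards [hV.mem_nhds hzV] with y hy
      exact (htime y hy).symm
    rw [(HasFDerivAt.congr_of_eventuallyEq h2 h3).fderiv]
    simp
  have hb : ∀ v i, HasDerivAt (fun s => fderiv ℝ Φ (s, z) (0, v) i) (fderiv ℝ X z v i) 0 := by
    intro v i
    have h1 : HasDerivAt (fun s : ℝ => (s, z)) ((1 : ℝ), (0 : Jet)) 0 :=
      (hasDerivAt_id 0).prodMk (hasDerivAt_const 0 z)
    have h2 := ((ContinuousLinearMap.proj (R := ℝ) (φ := fun _ : Fin 5 => ℝ) i).comp
      (ContinuousLinearMap.apply ℝ Jet ((0 : ℝ), v))).hasFDerivAt.comp_hasDerivAt 0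
      (HasFDerivAt.comp_hasDerivAt 0 hdd.hasFDerivAt h1)
    rw [← hmixed]
    exact h2
  have ha : ∀ i, HasDerivAt (fun s => φ s z i) (X z i) 0 := by
    intro i
    have h3 := (hflow 0 ⟨by linarith, hε⟩ z hzV).2
    rw [h0 z hzV] at h3
    exact hasDerivAt_pi.mp h3 i
  have hb0 : ∀ v, fderiv ℝ Φ (0, z) (0, v) = v := by
    intro v
    rw [← hspace 0 ⟨by linarith, hε⟩ z hzV]
    have : φ 0 =ᶠ[nhds z] id := by
      filter_upwards [hV.mem_nhds hzV] with y hy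
      exact h0 y hy
    rw [this.fderiv_eq, fderiv_id]
    rfl
  have hnhds : ∀ᶠ s in nhds (0 : ℝ), s ∈ Ioo (-ε) ε := Ioo_mem_nhds (by linarith) hε
  have hzero : ∀ {g : ℝ → ℝ} {g' : ℝ}, HasDerivAt g g' 0 → (∀ s ∈ Ioo (-ε) ε, g s = 0) → g' = 0 := by
    intro g g' hg hg0
    refine hg.unique ((hasDerivAt_const (0 : ℝ) (0 : ℝ)).congr_of_eventuallyEq ?_)
    filter_upwards [hnhds] with s hs
    exact hg0 s hs
  have hheat : ∀ v w, HasDerivAt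
      (fun s => heatForm (φ s z) (fderiv ℝ Φ (s, z) (0, v)) (fderiv ℝ Φ (s, z) (0, w)))
      (lieHeatForm z (X z) (fderiv ℝ X z) v w) 0 := by
    intro v w
    have := (((ha 4).mul (((hb v 3).mul (hb w 1)).sub ((hb v 1).mul (hb w 3)))).add
      (((hb v 4).mul (hb w 0)).sub ((hb v 0).mul (hb w 4)))).add
      (((ha 3).mul (ha 4)).mul (((hb v 0).mul (hb w 1)).sub ((hb v 1).mul (hb w 0))))
    simp only [Pi.mul_apply, Pi.sub_apply, hb0, h0 z hzV] at this
    refine this.congr_deriv ?_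
    simp only [lieHeatForm, heatForm]
    ring
  refine ⟨fun v hv => ?_, lieHeatForm z (X z) (fderiv ℝ X z) (Pi.single 4 1) ![1, 0, z 3, 0, 0],
    fun v w hv hw => ?_⟩
  · have hd := ((hb v 2).sub ((ha 3).mul (hb v 0))).sub ((ha 4).mul (hb v 1))
    have := hzero hd fun s hs => by
      have := (hsym s hs).contact z hzV v hv
      rw [hspace s hs z hzV] at this
      simpa [contactForm] using this
    rw [hb0, h0 z hzV] at this
    simp only [contactForm]
    linarith
  · have c4 : contactForm z (Pi.single 4 1) = 0 := by simp [contactForm]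
    have ct : contactForm z ![1, 0, z 3, 0, 0] = 0 := by simp [contactForm]
    have e4t : heatForm z (Pi.single 4 1) ![1, 0, z 3, 0, 0] = 1 := by simp [heatForm]
    have hd := (hheat v w).sub ((hheat (Pi.single 4 1) ![1, 0, z 3, 0, 0]).mul_const
      (heatForm z v w))
    have := hzero hd fun s hs => by
      obtain ⟨f, l, -, -, -, h2⟩ := (hsym s hs).preservesAt hV (fun z hz => hq z (hVU hz)) hzV
      have k1 := h2 v w hv hw
      have k2 := h2 _ _ c4 ct
      simp only [hspace s hs z hzV] at k1 k2
      simp only [Pi.sub_apply]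
      rw [k1, k2, e4t]
      ring
    linarith


/-! ### The explicit contact symmetries. -/

/-- The general element of the five-parameter group of point symmetries. -/
noncomputable def groupMap (a b c d k : ℝ) (z : Jet) : Jet :=
  ![z 0 + a, Real.exp (-k) * z 1 + b, Real.exp k * z 2 + c + d * Real.exp (-z 0),
    Real.exp k * z 3 - d * Real.exp (-z 0), Real.exp (2 * k) * z 4]

theorem hasFDerivAt_coord (i : Fin 5) (z : Jet) : HasFDerivAt (fun y : Jet => y i)
    (ContinuousLinearMap.proj (R := ℝ) (φ := fun _ : Fin 5 => ℝ) i) z :=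
  (ContinuousLinearMap.proj (R := ℝ) (φ := fun _ : Fin 5 => ℝ) i).hasFDerivAt

theorem hasFDerivAt_vec {f₀ f₁ f₂ f₃ f₄ : Jet → ℝ} {f₀' f₁' f₂' f₃' f₄' : Jet →L[ℝ] ℝ} {z : Jet}
    (h₀ : HasFDerivAt f₀ f₀' z) (h₁ : HasFDerivAt f₁ f₁' z) (h₂ : HasFDerivAt f₂ f₂' z)
    (h₃ : HasFDerivAt f₃ f₃' z) (h₄ : HasFDerivAt f₄ f₄' z) :
    HasFDerivAt (fun y => ![f₀ y, f₁ y, f₂ y, f₃ y, f₄ y])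
      (ContinuousLinearMap.pi ![f₀', f₁', f₂', f₃', f₄']) z := by
  rw [hasFDerivAt_pi]
  intro i
  fin_cases i
  exacts [h₀, h₁, h₂, h₃, h₄]

theorem contDiffOn_vec {f₀ f₁ f₂ f₃ f₄ : Jet → ℝ} {U : Set Jet} (h₀ : ContDiffOn ℝ ∞ f₀ U)
    (h₁ : ContDiffOn ℝ ∞ f₁ U) (h₂ : ContDiffOn ℝ ∞ f₂ U) (h₃ : ContDiffOn ℝ ∞ f₃ U)
    (h₄ : ContDiffOn ℝ ∞ f₄ U) :
    ContDiffOn ℝ ∞ (fun y => ![f₀ y, f₁ y, f₂ y, f₃ y, f₄ y]) U := by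
  rw [contDiffOn_pi]
  intro i
  fin_cases i
  exacts [h₀, h₁, h₂, h₃, h₄]

theorem fderiv_groupMap (a b c d k : ℝ) (z v : Jet) :
    fderiv ℝ (groupMap a b c d k) z v =
      ![v 0, Real.exp (-k) * v 1, Real.exp k * v 2 - d * (Real.exp (-z 0) * v 0),
        Real.exp k * v 3 + d * (Real.exp (-z 0) * v 0), Real.exp (2 * k) * v 4] := by
  have he := (hasFDerivAt_coord 0 z).fun_neg.exp
  have h := hasFDerivAt_vec ((hasFDerivAt_coord 0 z).add_const a)
    (((hasFDerivAt_coord 1 z).const_mul (Real.exp (-k))).add_const b)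
    ((((hasFDerivAt_coord 2 z).const_mul (Real.exp k)).add_const c).add
      (he.const_mul d))
    (((hasFDerivAt_coord 3 z).const_mul (Real.exp k)).sub (he.const_mul d))
    ((hasFDerivAt_coord 4 z).const_mul (Real.exp (2 * k)))
  have h' : HasFDerivAt (groupMap a b c d k) _ z := h
  rw [h'.fderiv]
  ext i
  fin_cases i <;> simp [sub_eq_add_neg]

theorem contDiff_groupMap (a b c d k : ℝ) : ContDiff ℝ ∞ (groupMap a b c d k) := by
  have hc := contDiff_coord
  have he : ContDiff ℝ ∞ fun z : Jet => Real.exp (-z 0) := Real.contDiff_exp.comp (hc 0).neg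
  rw [← contDiffOn_univ]
  exact contDiffOn_vec ((hc 0).add contDiff_const).contDiffOn
    ((contDiff_const.mul (hc 1)).add contDiff_const).contDiffOn
    (((contDiff_const.mul (hc 2)).add contDiff_const).add (contDiff_const.mul he)).contDiffOn
    ((contDiff_const.mul (hc 3)).sub (contDiff_const.mul he)).contDiffOn
    (contDiff_const.mul (hc 4)).contDiffOn

theorem preservesAt_groupMap (a b c d k : ℝ) (z : Jet) :
    PreservesAt z (groupMap a b c d k z) (fderiv ℝ (groupMap a b c d k) z) := by
  have e1 : Real.exp (2 * k) = Real.exp k * Real.exp k := by rw [← Real.exp_add]; ring_nf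
  have e2 : Real.exp k * Real.exp (-k) = 1 := by rw [← Real.exp_add]; simp
  refine ⟨Real.exp k, Real.exp (2 * k), (Real.exp_pos _).ne', (Real.exp_pos _).ne', fun v => ?_,
    fun v w _ _ => ?_⟩
  · rw [fderiv_groupMap]
    simp [contactForm, groupMap, e1]
    linear_combination (-(Real.exp k) * z 4 * v 1) * e2
  · rw [fderiv_groupMap, fderiv_groupMap]
    simp [heatForm, groupMap, e1]
    linear_combination (Real.exp k * Real.exp k * z 4 * (v 3 * w 1 - v 1 * w 3) +
      Real.exp k * Real.exp k * z 4 * z 3 * (v 0 * w 1 - v 1 * w 0)) * e2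

theorem groupMap_groupMap (a b c d k a' b' c' d' k' : ℝ) (z : Jet) :
    groupMap a b c d k (groupMap a' b' c' d' k' z) =
      groupMap (a + a') (b + Real.exp (-k) * b') (c + Real.exp k * c')
        (Real.exp k * d' + d * Real.exp (-a')) (k + k') z := by
  have e1 : Real.exp (-k' + -k) = Real.exp (-k) * Real.exp (-k') := by
    rw [← Real.exp_add]; ring_nf
  have e2 : Real.exp (2 * (k + k')) = Real.exp (2 * k) * Real.exp (2 * k') := by
    rw [← Real.exp_add]; ring_nf
  have e3 : Real.exp (-a' + -z 0) = Real.exp (-z 0) * Real.exp (-a') := by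
    rw [← Real.exp_add]; ring_nf
  ext i
  fin_cases i <;> simp [groupMap, e1, e2, e3, Real.exp_add] <;> ring

theorem groupMap_zero (z : Jet) : groupMap 0 0 0 0 0 z = z := by
  ext i
  fin_cases i <;> simp [groupMap]

theorem groupMap_inverse (a b c d k : ℝ) (z : Jet) :
    groupMap (-a) (-(Real.exp k * b)) (-(Real.exp (-k) * c)) (-(Real.exp (-k) * (d * Real.exp a)))
      (-k) (groupMap a b c d k z) = z := by
  rw [groupMap_groupMap]
  have e : Real.exp a * Real.exp (-a) = 1 := by rw [← Real.exp_add]; simp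
  have : Real.exp (-k) * d + -(Real.exp (-k) * (d * Real.exp a)) * Real.exp (-a) = 0 := by
    linear_combination (-Real.exp (-k) * d) * e
  rw [this]
  simp [groupMap_zero]

theorem groupMap_mem {κ : ℤˣ} (a b c d k : ℝ) {z : Jet} (hz : z ∈ region κ) :
    groupMap a b c d k z ∈ region κ := by
  have h : 0 < ((κ : ℤ) : ℝ) * z 4 := hz
  have e : ((κ : ℤ) : ℝ) * groupMap a b c d k z 4 = Real.exp (2 * k) * (((κ : ℤ) : ℝ) * z 4) := by
    simp [groupMap]
    ring
  change 0 < ((κ : ℤ) : ℝ) * groupMap a b c d k z 4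
  rw [e]
  positivity

theorem isContactSymmetryOn_groupMap {U : Set Jet} (hq : ∀ z ∈ U, z 4 ≠ 0) (a b c d k : ℝ) :
    IsContactSymmetryOn U (groupMap a b c d k) := by
  refine isContactSymmetryOn_of_preservesAt hq (contDiff_groupMap a b c d k).contDiffOn ?_ ?_
    fun z _ => preservesAt_groupMap a b c d k z
  · intro z _ w _ h
    rw [← groupMap_inverse a b c d k z, h, groupMap_inverse]
  · intro z hz
    simp [groupMap, hq z hz]

theorem isContactSymmetryOn_map₁ {U : Set Jet} (hq : ∀ z ∈ U, z 4 ≠ 0) :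
    IsContactSymmetryOn U map₁ := by
  have hd : ∀ z v, fderiv ℝ map₁ z v = map₁ v := by
    intro z v
    have h : HasFDerivAt map₁ _ z := hasFDerivAt_vec (hasFDerivAt_coord 0 z)
      (hasFDerivAt_coord 1 z).fun_neg (hasFDerivAt_coord 2 z).fun_neg
      (hasFDerivAt_coord 3 z).fun_neg (hasFDerivAt_coord 4 z)
    rw [h.fderiv]
    ext i
    fin_cases i <;> simp [map₁]
  have hc := contDiff_coord
  refine isContactSymmetryOn_of_preservesAt hq (contDiffOn_vec (hc 0).contDiffOn
    (hc 1).neg.contDiffOn (hc 2).neg.contDiffOn (hc 3).neg.contDiffOn (hc 4).contDiffOn) ?_ ?_ ?_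
  · intro z _ w _ h
    rw [← map₁_map₁ z, h, map₁_map₁]
  · intro z hz
    simpa [map₁] using hq z hz
  · intro z hz
    refine ⟨-1, 1, by norm_num, one_ne_zero, fun v => ?_, fun v w _ _ => ?_⟩
    · rw [hd]
      simp [contactForm, map₁]
      ring
    · rw [hd, hd]
      simp [heatForm, map₁]
      ring

theorem fderiv_map₂ {z : Jet} (h4 : z 4 ≠ 0) (v : Jet) :
    fderiv ℝ map₂ z v = ![v 0 + v 4 / z 4, v 2 + v 3,
      v 1 + (v 3 / z 4 - z 3 * v 4 / z 4 ^ 2), -(v 3 / z 4 - z 3 * v 4 / z 4 ^ 2),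
      -(v 4 / z 4 ^ 2)] := by
  have hinv : HasFDerivAt (fun y : Jet => (y 4)⁻¹) _ z :=
    (hasDerivAt_inv h4).comp_hasFDerivAt z (hasFDerivAt_coord 4 z)
  have h : HasFDerivAt (fun y : Jet => ![y 0 + Real.log (y 4), y 2 + y 3, y 1 + y 3 * (y 4)⁻¹,
      -(y 3 * (y 4)⁻¹), (y 4)⁻¹]) _ z := hasFDerivAt_vec
    ((hasFDerivAt_coord 0 z).add ((hasFDerivAt_coord 4 z).log h4))
    ((hasFDerivAt_coord 2 z).add (hasFDerivAt_coord 3 z))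
    ((hasFDerivAt_coord 1 z).add ((hasFDerivAt_coord 3 z).mul hinv))
    (((hasFDerivAt_coord 3 z).mul hinv).fun_neg) hinv
  have e : map₂ = fun y : Jet => ![y 0 + Real.log (y 4), y 2 + y 3, y 1 + y 3 * (y 4)⁻¹,
      -(y 3 * (y 4)⁻¹), (y 4)⁻¹] := by
    ext y i
    fin_cases i <;> simp [map₂, Real.log_abs, div_eq_mul_inv]
  rw [e, h.fderiv]
  ext i
  fin_cases i <;> simp <;> field_simp <;> ring

theorem isContactSymmetryOn_map₂ {U : Set Jet} (hq : ∀ z ∈ U, z 4 ≠ 0) :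
    IsContactSymmetryOn U map₂ := by
  have hd := fun z hz => fderiv_map₂ (hq z hz)
  have hc := contDiff_coord
  have hinv : ContDiffOn ℝ ∞ (fun z : Jet => (z 4)⁻¹) U := (hc 4).contDiffOn.inv hq
  refine isContactSymmetryOn_of_preservesAt hq ?_ ?_ ?_ ?_
  · have e : map₂ = fun y : Jet => ![y 0 + Real.log (y 4), y 2 + y 3, y 1 + y 3 * (y 4)⁻¹,
        -(y 3 * (y 4)⁻¹), (y 4)⁻¹] := by
      ext y i
      fin_cases i <;> simp [map₂, Real.log_abs, div_eq_mul_inv]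
    rw [e]
    exact contDiffOn_vec ((hc 0).contDiffOn.add ((hc 4).contDiffOn.log hq))
      ((hc 2).add (hc 3)).contDiffOn ((hc 1).contDiffOn.add ((hc 3).contDiffOn.mul hinv))
      ((hc 3).contDiffOn.mul hinv).neg hinv
  · intro z hz w hw h
    rw [← map₂_map₂ (hq z hz), h, map₂_map₂ (hq w hw)]
  · intro z hz
    simpa [map₂] using hq z hz
  · intro z hz
    have h4 := hq z hz
    refine ⟨-(z 4)⁻¹, -(z 4 ^ 2)⁻¹, neg_ne_zero.mpr (inv_ne_zero h4),
      neg_ne_zero.mpr (inv_ne_zero (pow_ne_zero 2 h4)), fun v => ?_, fun v w hv hw => ?_⟩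
    · rw [hd z hz]
      simp [contactForm, map₂]
      field_simp
      ring
    · rw [hd z hz, hd z hz]
      simp only [contactForm] at hv hw
      have hv2 : v 2 = z 3 * v 0 + z 4 * v 1 := by linarith
      have hw2 : w 2 = z 3 * w 0 + z 4 * w 1 := by linarith
      simp [heatForm, map₂, hv2, hw2]
      field_simp
      ring


/-! ### Flows and brackets of the basis fields. -/

/-- The integral of `exp (a * τ)` over `0 ≤ τ ≤ s`. -/
noncomputable def expIntegral (a s : ℝ) : ℝ := if a = 0 then s else (Real.exp (a * s) - 1) / a

theorem mul_expIntegral (a s : ℝ) : a * expIntegral a s = Real.exp (a * s) - 1 := by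
  by_cases h : a = 0
  · simp [expIntegral, h]
  · rw [expIntegral, if_neg h, mul_div_cancel₀ _ h]

theorem expIntegral_zero (a : ℝ) : expIntegral a 0 = 0 := by
  simp [expIntegral]

theorem hasDerivAt_expIntegral (a s : ℝ) : HasDerivAt (expIntegral a) (Real.exp (a * s)) s := by
  by_cases h : a = 0
  · have : expIntegral a = fun s => s := by funext s; simp [expIntegral, h]
    rw [this, h, zero_mul, Real.exp_zero]
    exact hasDerivAt_id s
  · have : expIntegral a = fun s => (Real.exp (a * s) - 1) / a := by
      funext s; rw [expIntegral, if_neg h]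
    rw [this]
    refine (((((hasDerivAt_id s).const_mul a).exp).sub_const 1).div_const a).congr_deriv ?_
    simp
    field_simp

theorem contDiff_expIntegral (a : ℝ) : ContDiff ℝ ∞ (expIntegral a) := by
  by_cases h : a = 0
  · have : expIntegral a = fun s => s := by funext s; simp [expIntegral, h]
    rw [this]
    exact contDiff_id
  · have : expIntegral a = fun s => (Real.exp (a * s) - 1) / a := by
      funext s; rw [expIntegral, if_neg h]
    rw [this]
    exact ((Real.contDiff_exp.comp (contDiff_const.mul contDiff_id)).sub contDiff_const).div_const a

/-- The flow of the combination of the basis fields with coefficients `c`. -/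
noncomputable def fieldFlow (c : Fin 5 → ℝ) (s : ℝ) : Jet → Jet :=
  groupMap (c 0 * s) (c 1 * expIntegral (-c 4) s) (c 2 * expIntegral (c 4) s)
    -- Variation of constants: the coefficient of e^(-t) solves d' = c₄ d + c₃ e^(-c₀ s), d(0) = 0.
    (c 3 * (Real.exp (c 4 * s) * expIntegral (-c 0 - c 4) s)) (c 4 * s)

theorem fieldFlow_zero (c : Fin 5 → ℝ) (z : Jet) : fieldFlow c 0 z = z := by
  simp [fieldFlow, expIntegral_zero, groupMap_zero]

theorem contDiff_fieldFlow (c : Fin 5 → ℝ) :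
    ContDiff ℝ ∞ (fun a : ℝ × Jet => fieldFlow c a.1 a.2) := by
  have hs : ContDiff ℝ ∞ fun a : ℝ × Jet => a.1 := contDiff_fst
  have hz : ∀ i, ContDiff ℝ ∞ fun a : ℝ × Jet => a.2 i := fun i =>
    (contDiff_coord i).comp contDiff_snd
  have hE : ∀ r, ContDiff ℝ ∞ fun a : ℝ × Jet => expIntegral r a.1 := fun r =>
    (contDiff_expIntegral r).comp hs
  have hexp : ∀ {g : ℝ × Jet → ℝ}, ContDiff ℝ ∞ g → ContDiff ℝ ∞ fun a => Real.exp (g a) :=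
    fun hg => Real.contDiff_exp.comp hg
  have hk : ContDiff ℝ ∞ fun a : ℝ × Jet => c 4 * a.1 := contDiff_const.mul hs
  have hd : ContDiff ℝ ∞ fun a : ℝ × Jet =>
      c 3 * (Real.exp (c 4 * a.1) * expIntegral (-c 0 - c 4) a.1) * Real.exp (-a.2 0) :=
    (contDiff_const.mul ((hexp hk).mul (hE _))).mul (hexp (hz 0).neg)
  rw [contDiff_pi]
  intro i
  fin_cases i
  · exact (hz 0).add (contDiff_const.mul hs)
  · exact ((hexp hk.neg).mul (hz 1)).add (contDiff_const.mul (hE _))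
  · exact (((hexp hk).mul (hz 2)).add (contDiff_const.mul (hE _))).add hd
  · exact ((hexp hk).mul (hz 3)).sub hd
  · exact (hexp (contDiff_const.mul hk)).mul (hz 4)

theorem hasDerivAt_fieldFlow (c : Fin 5 → ℝ) (z : Jet) (s : ℝ) :
    HasDerivAt (fun τ => fieldFlow c τ z) (field c (fieldFlow c s z)) s := by
  have hk : ∀ r, HasDerivAt (fun τ : ℝ => r * τ) r s := fun r => by
    simpa using (hasDerivAt_id s).const_mul r
  have he : ∀ r, HasDerivAt (fun τ : ℝ => Real.exp (r * τ)) (Real.exp (r * s) * r) s :=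
    fun r => (hk r).exp
  have hd := ((((he (c 4)).mul (hasDerivAt_expIntegral (-c 0 - c 4) s)).const_mul
    (c 3)).mul_const (Real.exp (-z 0)))
  have hen := (hk (c 4)).fun_neg.exp
  have h2 := ((hk (c 4)).const_mul 2).exp
  have e1 := mul_expIntegral (-c 4) s
  have e2 := mul_expIntegral (c 4) s
  have e3 := mul_expIntegral (-c 0 - c 4) s
  have e4 : Real.exp (c 4 * s) * Real.exp ((-c 0 - c 4) * s) = Real.exp (-(c 0 * s)) := by
    rw [← Real.exp_add]; ring_nf
  have e5 : Real.exp (-(c 0 * s) + -z 0) = Real.exp (-z 0) * Real.exp (-(c 0 * s)) := by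
    rw [← Real.exp_add]; ring_nf
  have e6 : Real.exp (-c 4 * s) = Real.exp (-(c 4 * s)) := by ring_nf
  rw [hasDerivAt_pi]
  intro i
  fin_cases i
  · refine ((hk (c 0)).const_add (z 0)).congr_deriv ?_
    simp [field]
  · refine ((hen.mul_const (z 1)).add
      ((hasDerivAt_expIntegral (-c 4) s).const_mul (c 1))).congr_deriv ?_
    simp [field, fieldFlow, groupMap]
    rw [e6] at e1
    linear_combination (-c 1) * e1
  · refine ((((he (c 4)).mul_const (z 2)).add
      ((hasDerivAt_expIntegral (c 4) s).const_mul (c 2))).add hd).congr_deriv ?_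
    simp only [field, fieldFlow, groupMap]
    simp
    rw [e5]
    linear_combination (-c 2) * e2 + c 3 * Real.exp (-z 0) * e4
  · refine (((he (c 4)).mul_const (z 3)).sub hd).congr_deriv ?_
    simp only [field, fieldFlow, groupMap]
    simp
    rw [e5]
    linear_combination -c 3 * Real.exp (-z 0) * e4
  · refine (h2.mul_const (z 4)).congr_deriv ?_
    simp [field, fieldFlow, groupMap]
    ring

theorem contDiff_field (c : Fin 5 → ℝ) : ContDiff ℝ ∞ (field c) := by
  have hz := contDiff_coord
  have he : ContDiff ℝ ∞ fun z : Jet => c 3 * Real.exp (-z 0) :=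
    contDiff_const.mul (Real.contDiff_exp.comp (hz 0).neg)
  rw [contDiff_pi]
  intro i
  fin_cases i
  · exact contDiff_const
  · exact contDiff_const.sub (contDiff_const.mul (hz 1))
  · exact (contDiff_const.add he).add (contDiff_const.mul (hz 2))
  · exact he.neg.add (contDiff_const.mul (hz 3))
  · exact contDiff_const.mul (contDiff_const.mul (hz 4))

theorem exists_Ioo_prod_subset {O : Set (ℝ × Jet)} {z : Jet} (hO : O ∈ nhds ((0 : ℝ), z)) :
    ∃ ε : ℝ, 0 < ε ∧ ∃ V : Set Jet, IsOpen V ∧ z ∈ V ∧ Ioo (-ε) ε ×ˢ V ⊆ O := by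
  obtain ⟨S, hS, V', hV', hSV⟩ := mem_nhds_prod_iff.mp hO
  obtain ⟨ε, hε, hεS⟩ := Metric.mem_nhds_iff.mp hS
  obtain ⟨V, hVV', hV, hzV⟩ := mem_nhds_iff.mp hV'
  refine ⟨ε, hε, V, hV, hzV, (prod_mono ?_ hVV').trans hSV⟩
  rwa [Real.ball_eq_Ioo, zero_sub, zero_add] at hεS

theorem isContactGenerator_field {U : Set Jet} (hU : IsOpen U) (hq : ∀ z ∈ U, z 4 ≠ 0)
    {X : Jet → Jet} {c : Fin 5 → ℝ} (hX : ∀ z ∈ U, X z = field c z) : IsContactGenerator U X := by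
  refine ⟨(contDiff_field c).contDiffOn.congr hX, fun z hz => ?_⟩
  have h0 : (fun a : ℝ × Jet => fieldFlow c a.1 a.2) ⁻¹' U ∈ nhds ((0 : ℝ), z) :=
    (contDiff_fieldFlow c).continuous.continuousAt.preimage_mem_nhds (by
      simpa [fieldFlow_zero] using hU.mem_nhds hz)
  have h1 : (univ : Set ℝ) ×ˢ U ∈ nhds ((0 : ℝ), z) :=
    (isOpen_univ.prod hU).mem_nhds ⟨mem_univ _, hz⟩
  obtain ⟨ε, hε, V, hV, hzV, hsub⟩ := exists_Ioo_prod_subset (Filter.inter_mem h0 h1)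
  have hVU : V ⊆ U := fun w hw => (hsub (mk_mem_prod (⟨by linarith, hε⟩ : (0 : ℝ) ∈ Ioo (-ε) ε) hw)).2.2
  refine ⟨ε, hε, V, hV, hzV, hVU, fieldFlow c, (contDiff_fieldFlow c).contDiffOn,
    fun w _ => fieldFlow_zero c w, fun s hs w hw => ?_, fun s hs => ?_⟩
  · have hmem : fieldFlow c s w ∈ U := (hsub (mk_mem_prod hs hw)).1
    rw [hX _ hmem]
    exact ⟨hmem, hasDerivAt_fieldFlow c w s⟩
  · exact isContactSymmetryOn_groupMap (fun w hw => hq w (hVU hw)) _ _ _ _ _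

theorem isContactGenerator_iff {U : Set Jet} (hU : IsOpen U) (hc : IsConnected U)
    (hq : ∀ z ∈ U, z 4 ≠ 0) {X : Jet → Jet} :
    IsContactGenerator U X ↔ ∃ c, ∀ z ∈ U, X z = field c z :=
  ⟨fun h => exists_field_eq hU hc hq h.1 fun _ hz => h.infinitesimalAt hq hz,
    fun ⟨_, hc⟩ => isContactGenerator_field hU hq hc⟩

theorem field_eq_sum (c : Fin 5 → ℝ) (z : Jet) : field c z = ∑ i, c i • basisField i z := by
  ext i
  fin_cases i <;> simp [field, basisField, Fin.sum_univ_five] <;> ring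

theorem field_injective {z : Jet} (hz : z 4 ≠ 0) {c c' : Fin 5 → ℝ}
    (h : field c z = field c' z) : c = c' := by
  have h0 := congrFun h 0
  have h1 := congrFun h 1
  have h2 := congrFun h 2
  have h3 := congrFun h 3
  have h4 := congrFun h 4
  simp [field, hz] at h0 h1 h2 h3 h4
  rw [h4] at h1 h2 h3
  simp at h1 h3
  rw [h3] at h2
  ext i
  fin_cases i <;> simp [*]
  simpa using h2

/-- The structure constants of the Lie algebra of generators. -/
def bracket (a b : Fin 5 → ℝ) : Fin 5 → ℝ :=
  ![0, -(a 1 * b 4 - a 4 * b 1), a 2 * b 4 - a 4 * b 2,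
    -(a 0 * b 3 - a 3 * b 0) + (a 3 * b 4 - a 4 * b 3), 0]

theorem fderiv_field (c : Fin 5 → ℝ) (z v : Jet) : fderiv ℝ (field c) z v =
    ![0, -(c 4 * v 1), -(c 3 * (Real.exp (-z 0) * v 0)) + c 4 * v 2,
      c 3 * (Real.exp (-z 0) * v 0) + c 4 * v 3, 2 * (c 4 * v 4)] := by
  have he := ((hasFDerivAt_coord 0 z).fun_neg.exp).const_mul (c 3)
  have h : HasFDerivAt (field c) _ z := hasFDerivAt_vec (hasFDerivAt_const (c 0) z)
    (((hasFDerivAt_coord 1 z).const_mul (c 4)).const_sub (c 1))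
    ((he.const_add (c 2)).add ((hasFDerivAt_coord 2 z).const_mul (c 4)))
    (he.fun_neg.add ((hasFDerivAt_coord 3 z).const_mul (c 4)))
    (((hasFDerivAt_coord 4 z).const_mul (c 4)).const_mul 2)
  rw [h.fderiv]
  ext i
  fin_cases i <;> simp

theorem lieBracket_field (a b : Fin 5 → ℝ) (z : Jet) :
    VectorField.lieBracket ℝ (field a) (field b) z = field (bracket a b) z := by
  rw [VectorField.lieBracket, fderiv_field, fderiv_field]
  ext i
  fin_cases i <;> simp [field, bracket] <;> ring


/-! ### The Lie algebra automorphism induced by a contact symmetry. -/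

/-- The flow of the pulled-back field is the flow of the field conjugated by Γ, hence composed of
contact symmetries. -/
theorem isContactGenerator_pullback {U : Set Jet} (hU : IsOpen U) (hq : ∀ z ∈ U, z 4 ≠ 0)
    {Γ : Jet → Jet} (h : IsContactSymmetryOn U Γ) (c : Fin 5 → ℝ) :
    IsContactGenerator U (VectorField.pullback ℝ Γ (field c)) := by
  obtain ⟨hW, g, hg, hgΓ⟩ := h.exists_inverse hU hq
  have hqW : ∀ z ∈ Γ '' U, z 4 ≠ 0 := by
    rintro _ ⟨z, hz, rfl⟩
    exact h.ux_ne_zero z hz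
  have hpull : ∀ z ∈ U, VectorField.pullback ℝ Γ (field c) z = fderiv ℝ g (Γ z) (field c (Γ z)) := by
    intro z hz
    have hcomp : (fderiv ℝ g (Γ z)).comp (fderiv ℝ Γ z) = ContinuousLinearMap.id ℝ Jet := by
      rw [← fderiv_comp z (hg.differentiableAt hW (mem_image_of_mem Γ hz))
        (h.differentiableAt hU hz), ← fderiv_id]
      refine Filter.EventuallyEq.fderiv_eq ?_
      filter_upwards [hU.mem_nhds hz] with y hy
      exact hgΓ y hy
    have hcomp' : (fderiv ℝ Γ z).comp (fderiv ℝ g (Γ z)) = ContinuousLinearMap.id ℝ Jet := by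
      ext1 v
      obtain ⟨w, rfl⟩ := (h.bijective_fderiv z hz).2 v
      change fderiv ℝ Γ z (((fderiv ℝ g (Γ z)).comp (fderiv ℝ Γ z)) w) = _
      rw [hcomp]
      rfl
    rw [VectorField.pullback, ContinuousLinearMap.inverse_eq hcomp' hcomp]
  refine ⟨?_, fun z hz => ?_⟩
  · have h1 : ContDiffOn ℝ ∞ (fun y => fderiv ℝ g y (field c y)) (Γ '' U) :=
      (hg.smooth.fderiv_of_isOpen hW (by simp)).clm_apply (contDiff_field c).contDiffOn
    exact (h1.comp h.smooth (mapsTo_image Γ U)).congr hpull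
  · set F : ℝ × Jet → Jet := fun a => fieldFlow c a.1 (Γ a.2) with hF
    have hFs : ContDiffOn ℝ ∞ F (univ ×ˢ U) :=
      (contDiff_fieldFlow c).comp_contDiffOn (contDiff_fst.contDiffOn.prodMk
        (h.smooth.comp contDiff_snd.contDiffOn fun a ha => ha.2))
    have h1 : (univ : Set ℝ) ×ˢ U ∈ nhds ((0 : ℝ), z) :=
      (isOpen_univ.prod hU).mem_nhds ⟨mem_univ _, hz⟩
    have h0 : F ⁻¹' (Γ '' U) ∈ nhds ((0 : ℝ), z) :=
      (hFs.continuousOn.continuousAt h1).preimage_mem_nhds (by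
        simpa [hF, fieldFlow_zero] using hW.mem_nhds (mem_image_of_mem Γ hz))
    obtain ⟨ε, hε, V, hV, hzV, hsub⟩ := exists_Ioo_prod_subset (Filter.inter_mem h0 h1)
    have hVU : V ⊆ U := fun w hw =>
      (hsub (mk_mem_prod (⟨by linarith, hε⟩ : (0 : ℝ) ∈ Ioo (-ε) ε) hw)).2.2
    have hmaps : ∀ s ∈ Ioo (-ε) ε, ∀ w ∈ V, fieldFlow c s (Γ w) ∈ Γ '' U := fun s hs w hw =>
      (hsub (mk_mem_prod hs hw)).1
    refine ⟨ε, hε, V, hV, hzV, hVU, fun s w => g (fieldFlow c s (Γ w)), ?_, ?_, ?_, ?_⟩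
    · exact hg.smooth.comp (hFs.mono (prod_mono (subset_univ _) hVU)) fun a ha =>
        hmaps a.1 ha.1 a.2 ha.2
    · intro w hw
      simp only [fieldFlow_zero]
      exact hgΓ w (hVU hw)
    · intro s hs w hw
      obtain ⟨y, hy, hyw⟩ := hmaps s hs w hw
      have hgy : g (fieldFlow c s (Γ w)) = y := by rw [← hyw, hgΓ y hy]
      change g (fieldFlow c s (Γ w)) ∈ U ∧ HasDerivAt (fun τ => g (fieldFlow c τ (Γ w)))
        (VectorField.pullback ℝ Γ (field c) (g (fieldFlow c s (Γ w)))) s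
      rw [hgy, hpull y hy, hyw]
      refine ⟨hy, ?_⟩
      exact (hg.differentiableAt hW (hmaps s hs w hw)).hasFDerivAt.comp_hasDerivAt s
        (hasDerivAt_fieldFlow c (Γ w) s)
    · intro s hs
      have hV' := h.mono hVU
      have hflow : IsContactSymmetryOn (Γ '' U) (fieldFlow c s) :=
        isContactSymmetryOn_groupMap hqW _ _ _ _ _
      have h2 := hflow.comp hV hW (fun z hz => hq z (hVU hz)) hqW hV'
        fun w hw => mem_image_of_mem Γ (hVU hw)
      exact hg.comp hV hW (fun z hz => hq z (hVU hz)) hqW h2 (hmaps s hs)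

/-- A contact symmetry transforms the basis of the generators by a constant invertible matrix, which
is an automorphism of the Lie algebra. -/
theorem IsContactSymmetryOn.exists_automorphism {U : Set Jet} (hU : IsOpen U) (hc : IsConnected U)
    (hq : ∀ z ∈ U, z 4 ≠ 0) {Γ : Jet → Jet} (h : IsContactSymmetryOn U Γ) :
    ∃ C : (Fin 5 → ℝ) → Fin 5 → ℝ, (∀ z ∈ U, ∀ a, fderiv ℝ Γ z (field (C a) z) = field a (Γ z)) ∧
      ∀ a b, C (bracket a b) = bracket (C a) (C b) := by
  have hex := fun a => (isContactGenerator_iff hU hc hq).mp (isContactGenerator_pullback hU hq h a)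
  choose C hC using hex
  refine ⟨C, fun z hz a => ?_, fun a b => ?_⟩
  · rw [← hC a z hz]
    have hbij := h.bijective_fderiv z hz
    set e := ContinuousLinearEquiv.ofBijective (fderiv ℝ Γ z) (LinearMap.ker_eq_bot.mpr hbij.1)
      (LinearMap.range_eq_top.mpr hbij.2) with he
    have hE : fderiv ℝ Γ z = (e : Jet →L[ℝ] Jet) := by
      rw [he, ContinuousLinearEquiv.coe_ofBijective]
    rw [VectorField.pullback, hE, ContinuousLinearMap.inverse_equiv]
    exact e.apply_symm_apply _
  · obtain ⟨z, hz⟩ := hc.nonempty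
    have hΓz : ContDiffAt ℝ ∞ Γ z := h.smooth.contDiffAt (hU.mem_nhds hz)
    have hd : ∀ a y, DifferentiableAt ℝ (field a) y := fun a y =>
      (contDiff_field a).contDiffAt.differentiableAt (by simp)
    have key := VectorField.pullback_lieBracket (𝕜 := ℝ) (n := ∞) (by
      rw [minSmoothness_of_isRCLikeNormedField]; exact WithTop.coe_le_coe.mpr le_top) hΓz
      (hd a (Γ z)) (hd b (Γ z))
    have hbr : VectorField.lieBracket ℝ (field a) (field b) = field (bracket a b) :=
      funext (lieBracket_field a b)
    have hev : ∀ a, VectorField.pullback ℝ Γ (field a) =ᶠ[nhds z] field (C a) := fun a => by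
      filter_upwards [hU.mem_nhds hz] with y hy
      exact hC a y hy
    rw [hbr, (hev a).lieBracket_vectorField_eq (hev b), lieBracket_field, hC _ z hz] at key
    exact field_injective (hq z hz) key


theorem field_add (a b : Fin 5 → ℝ) (z : Jet) : field (a + b) z = field a z + field b z := by
  simp only [field_eq_sum, Pi.add_apply, add_smul, Finset.sum_add_distrib]

theorem field_smul (r : ℝ) (a : Fin 5 → ℝ) (z : Jet) : field (r • a) z = r • field a z := by
  simp only [field_eq_sum, Pi.smul_apply, smul_eq_mul, mul_smul, Finset.smul_sum]

/-- The coefficients are determined uniquely, by injectivity of L and of the parametrization by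
`field`, so C inherits linearity from L. -/
theorem exists_linearMap {z : Jet} (hz : z 4 ≠ 0) {z' : Jet} {L : Jet →L[ℝ] Jet}
    (hL : Function.Injective L) {C : (Fin 5 → ℝ) → Fin 5 → ℝ}
    (h : ∀ a, L (field (C a) z) = field a z') :
    ∃ C' : (Fin 5 → ℝ) →ₗ[ℝ] Fin 5 → ℝ, ⇑C' = C := by
  refine ⟨⟨⟨C, fun a b => field_injective hz (hL ?_)⟩, fun r a => field_injective hz (hL ?_)⟩, rfl⟩
  · rw [h, field_add, field_add, map_add, h, h]
  · simp only [RingHom.id_apply]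
    rw [h, field_smul, field_smul, map_smul, h]

section
variable {C : (Fin 5 → ℝ) →ₗ[ℝ] Fin 5 → ℝ}

/-- An automorphism of the Lie algebra maps the derived algebra to itself, and has there one of two
shapes. -/
theorem automorphism_derived (hC : ∀ a, C a = 0 → a = 0)
    (hbr : ∀ a b, C (bracket a b) = bracket (C a) (C b)) :
    C ![1, 0, 0, 0, 0] 0 = 1 ∧ C ![1, 0, 0, 0, 0] 4 = 0 ∧
    (∃ γ, γ ≠ 0 ∧ C ![0, 0, 0, 1, 0] = ![0, 0, 0, γ, 0]) ∧
    C ![0, 0, 0, 0, 1] 0 + C ![0, 0, 0, 0, 1] 4 = 1 ∧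
    ((C ![0, 0, 0, 0, 1] 4 = 1 ∧ ∃ α β, α ≠ 0 ∧ β ≠ 0 ∧ C ![0, 1, 0, 0, 0] = ![0, α, 0, 0, 0] ∧
        C ![0, 0, 1, 0, 0] = ![0, 0, β, 0, 0]) ∨
      ∃ α β, α ≠ 0 ∧ β ≠ 0 ∧ C ![0, 1, 0, 0, 0] = ![0, 0, α, 0, 0] ∧
        C ![0, 0, 1, 0, 0] = ![0, β, 0, 0, 0]) := by
  have b14 := hbr ![0, 0, 0, 0, 1] ![0, 1, 0, 0, 0]
  have b24 := hbr ![0, 0, 1, 0, 0] ![0, 0, 0, 0, 1]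
  have b34 := hbr ![0, 0, 0, 1, 0] ![0, 0, 0, 0, 1]
  have b03 := hbr ![0, 0, 0, 1, 0] ![1, 0, 0, 0, 0]
  have b01 := hbr ![1, 0, 0, 0, 0] ![0, 1, 0, 0, 0]
  have b02 := hbr ![1, 0, 0, 0, 0] ![0, 0, 1, 0, 0]
  have hz : (![0, 0, 0, 0, 0] : Fin 5 → ℝ) = 0 := by ext i; fin_cases i <;> rfl
  have hne : ∀ a : Fin 5 → ℝ, a ≠ 0 → C a ≠ 0 := fun a ha h => ha (hC a h)
  have n1 := hne ![0, 1, 0, 0, 0] fun h => by simpa using congrFun h 1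
  have n2 := hne ![0, 0, 1, 0, 0] fun h => by simpa using congrFun h 2
  have n3 := hne ![0, 0, 0, 1, 0] fun h => by simpa using congrFun h 3
  have n12 : ∀ x y : ℝ, x • C ![0, 1, 0, 0, 0] + y • C ![0, 0, 1, 0, 0] = 0 → x = 0 ∧ y = 0 := by
    intro x y h
    have h' := hC (x • ![0, 1, 0, 0, 0] + y • ![0, 0, 1, 0, 0]) (by
      rw [map_add, map_smul, map_smul, h])
    exact ⟨by simpa using congrFun h' 1, by simpa using congrFun h' 2⟩
  generalize C ![1, 0, 0, 0, 0] = r0 at *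
  generalize e1 : C ![0, 1, 0, 0, 0] = r1 at *
  generalize e2 : C ![0, 0, 1, 0, 0] = r2 at *
  generalize e3 : C ![0, 0, 0, 1, 0] = r3 at *
  generalize C ![0, 0, 0, 0, 1] = r4 at *
  simp [bracket, hz, e1, e2, e3] at b14 b24 b34 b03 b01 b02
  have ext5 : ∀ {a b : Fin 5 → ℝ}, a 0 = b 0 → a 1 = b 1 → a 2 = b 2 → a 3 = b 3 → a 4 = b 4 →
      a = b := by
    intro a b h0 h1 h2 h3 h4
    ext i
    fin_cases i <;> assumption
  have z10 : r1 0 = 0 := congrFun b14 0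
  have z14 : r1 4 = 0 := congrFun b14 4
  have z20 : r2 0 = 0 := congrFun b24 0
  have z24 : r2 4 = 0 := congrFun b24 4
  have z30 : r3 0 = 0 := congrFun b34 0
  have z34 : r3 4 = 0 := congrFun b34 4
  have x11 := congrFun b14 1
  have x12 := congrFun b14 2
  have x21 := congrFun b24 1
  have x22 := congrFun b24 2
  have x33 := congrFun b34 3
  have y1 := congrFun b03 1
  have y2 := congrFun b03 2
  have y3 := congrFun b03 3
  have w11 := congrFun b01 1
  have w12 := congrFun b01 2
  have w13 := congrFun b01 3
  have w21 := congrFun b02 1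
  have w22 := congrFun b02 2
  have w23 := congrFun b02 3
  simp [z10, z14, z20, z24, z30, z34] at x11 x12 x21 x22 x33 y1 y2 y3 w11 w12 w13 w21 w22 w23
  -- The images of X₂ and X₃ commute with that of X₁. If the latter had an X₅ component, both would
  -- lie on the line of X₄ and be dependent.
  have h04 : r0 4 = 0 := by
    by_contra hne
    have v11 : r1 1 = 0 := by simpa [hne] using w11
    have v12 : r1 2 = 0 := by simpa [hne] using w12
    have v21 : r2 1 = 0 := by simpa [hne] using w21
    have v22 : r2 2 = 0 := by simpa [hne] using w22
    have := n12 (r2 3) (-r1 3) (ext5 (by simp [z10, z20]) (by simp [v11, v21])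
      (by simp [v12, v22]) (by simp; ring) (by simp [z14, z24]))
    exact n2 (ext5 z20 v21 v22 this.1 z24)
  simp only [h04] at y1 y2 y3 w13 w23
  have v31 : r3 1 = 0 := by linarith
  have v32 : r3 2 = 0 := by linarith
  have v33 : r3 3 ≠ 0 := fun h => n3 (ext5 z30 v31 v32 h z34)
  have h00 : r0 0 = 1 := mul_left_cancel₀ v33 (by linarith)
  have v13 : r1 3 = 0 := by rw [h00] at w13; linarith
  have v23 : r2 3 = 0 := by rw [h00] at w23; linarith
  have h44 : r4 0 + r4 4 = 1 := mul_left_cancel₀ v33 (by linarith)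
  refine ⟨h00, h04, ⟨r3 3, v33, ext5 z30 v31 v32 rfl z34⟩, h44, ?_⟩
  -- X₂ and X₃ have opposite weights 1 and -1 under X₅. So the X₅ coefficient of the image of X₅ is
  -- 1 or -1, and the two lines are kept or exchanged accordingly.
  by_cases v11 : r1 1 = 0
  · have v12 : r1 2 ≠ 0 := fun h => n1 (ext5 z10 v11 h v13 z14)
    have k : r4 4 = -1 := mul_left_cancel₀ v12 (by linarith)
    have v22 : r2 2 = 0 := by rw [k] at x22; linarith
    have v21 : r2 1 ≠ 0 := fun h => n2 (ext5 z20 h v22 v23 z24)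
    exact Or.inr ⟨r1 2, r2 1, v12, v21, ext5 z10 v11 rfl v13 z14, ext5 z20 rfl v22 v23 z24⟩
  · have k : r4 4 = 1 := mul_left_cancel₀ v11 (by linarith)
    have v12 : r1 2 = 0 := by rw [k] at x12; linarith
    have v21 : r2 1 = 0 := by rw [k] at x21; linarith
    have v22 : r2 2 ≠ 0 := fun h => n2 (ext5 z20 v21 h v23 z24)
    exact Or.inl ⟨k, r1 1, r2 2, v11, v22, ext5 z10 rfl v12 v13 z14, ext5 z20 v21 rfl v23 z24⟩

/-- Once the lines of X₂ and X₃ are kept, commutation of the images of X₁ and X₅ removes the X₂ and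
X₃ components of the former and equates the two X₄ coefficients. -/
theorem automorphism_point (hC : ∀ a, C a = 0 → a = 0)
    (hbr : ∀ a b, C (bracket a b) = bracket (C a) (C b)) (h1 : C ![0, 1, 0, 0, 0] 1 ≠ 0) :
    ∃ a₃ α β γ b₁ b₂ : ℝ, α ≠ 0 ∧ β ≠ 0 ∧ γ ≠ 0 ∧ C ![1, 0, 0, 0, 0] = ![1, 0, 0, a₃, 0] ∧
      C ![0, 1, 0, 0, 0] = ![0, α, 0, 0, 0] ∧ C ![0, 0, 1, 0, 0] = ![0, 0, β, 0, 0] ∧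
      C ![0, 0, 0, 1, 0] = ![0, 0, 0, γ, 0] ∧ C ![0, 0, 0, 0, 1] = ![0, b₁, b₂, a₃, 1] := by
  obtain ⟨h00, h04, ⟨γ, hγ, e3⟩, h44, ⟨k, α, β, hα, hβ, e1, e2⟩ | ⟨α, β, hα, hβ, e1, e2⟩⟩ :=
    automorphism_derived hC hbr
  · have b04 := hbr ![1, 0, 0, 0, 0] ![0, 0, 0, 0, 1]
    have hz : (![0, 0, 0, 0, 0] : Fin 5 → ℝ) = 0 := by ext i; fin_cases i <;> rfl
    have h40 : C ![0, 0, 0, 0, 1] 0 = 0 := by linarith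
    simp [bracket, hz, h00, h04, h40, k] at b04
    have c1 := congrFun b04 1
    have c2 := congrFun b04 2
    have c3 := congrFun b04 3
    simp at c1 c2 c3
    refine ⟨C ![1, 0, 0, 0, 0] 3, α, β, γ, C ![0, 0, 0, 0, 1] 1, C ![0, 0, 0, 0, 1] 2,
      hα, hβ, hγ, ?_, e1, e2, e3, ?_⟩
    · ext i
      fin_cases i <;> simp <;> linarith
    · ext i
      fin_cases i <;> simp <;> linarith
  · simp [e1] at h1

end


/-! ### Reconstructing the symmetry from the automorphism. -/

/-- A contact symmetry for which the automorphism preserves `∂_x` up to a factor is, at every point,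
given by the action of the automorphism. -/
theorem eq_of_automorphism {z z' : Jet} (hz : z 4 ≠ 0) {L : Jet →L[ℝ] Jet}
    (hp : PreservesAt z z' L) {a₃ α β γ b₁ b₂ : ℝ} (hα : α ≠ 0) (hγ : γ ≠ 0)
    (h0 : L (field ![1, 0, 0, a₃, 0] z) = field ![1, 0, 0, 0, 0] z')
    (h1 : L (field ![0, α, 0, 0, 0] z) = field ![0, 1, 0, 0, 0] z')
    (h2 : L (field ![0, 0, β, 0, 0] z) = field ![0, 0, 1, 0, 0] z')
    (h3 : L (field ![0, 0, 0, γ, 0] z) = field ![0, 0, 0, 1, 0] z')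
    (h4 : L (field ![0, b₁, b₂, a₃, 1] z) = field ![0, 0, 0, 0, 1] z') :
    0 < γ * α ∧ z' = ![z 0 - Real.log (γ * α), α⁻¹ * (z 1 - b₁),
      α * (z 2 + b₂ + a₃ * Real.exp (-z 0)), α * (z 3 - a₃ * Real.exp (-z 0)), α ^ 2 * z 4] := by
  obtain ⟨f, l, hf, hl, hc, hh⟩ := hp
  have c0 := hc (field ![1, 0, 0, a₃, 0] z)
  have c1 := hc (field ![0, α, 0, 0, 0] z)
  have c2 := hc (field ![0, 0, β, 0, 0] z)
  have c3 := hc (field ![0, 0, 0, γ, 0] z)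
  have c4 := hc (field ![0, b₁, b₂, a₃, 1] z)
  rw [h0] at c0
  rw [h1] at c1
  rw [h2] at c2
  rw [h3] at c3
  rw [h4] at c4
  simp [contactForm, field] at c0 c1 c2 c3 c4
  set E := Real.exp (-z 0) with hE
  have hE0 : E ≠ 0 := (Real.exp_pos _).ne'
  have lu : L ![0, 0, 1, 0, 0] = f • ![0, 0, 1, 0, 0] := by
    have e : field ![0, 0, β, 0, 0] z = β • ![0, 0, 1, 0, 0] := by
      ext i; fin_cases i <;> simp [field]
    have e' : field ![0, 0, 1, 0, 0] z' = ![0, 0, 1, 0, 0] := by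
      ext i; fin_cases i <;> simp [field]
    rw [e, e', map_smul] at h2
    have := congrArg (fun v => f • v) h2
    simp only [smul_smul, ← c2, one_smul] at this
    exact this
  have lx : L ![0, 1, 0, 0, 0] = α⁻¹ • ![0, 1, 0, 0, 0] := by
    have e : field ![0, α, 0, 0, 0] z = α • ![0, 1, 0, 0, 0] := by
      ext i; fin_cases i <;> simp [field]
    have e' : field ![0, 1, 0, 0, 0] z' = ![0, 1, 0, 0, 0] := by
      ext i; fin_cases i <;> simp [field]
    rw [e, e', map_smul] at h1
    exact (inv_smul_eq_iff₀ hα).mpr h1.symm |>.symm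
  have lp : L ![0, 0, 0, 1, 0] = f • ![0, 0, 0, 1, 0] := by
    have e : field ![0, 0, 0, γ, 0] z = (γ * E) • (![0, 0, 1, 0, 0] - ![0, 0, 0, 1, 0]) := by
      ext i; fin_cases i <;> simp [field, hE]
    have e' : field ![0, 0, 0, 1, 0] z' =
        (γ * E) • (f • ![0, 0, 1, 0, 0] - f • ![0, 0, 0, 1, 0]) := by
      ext i; fin_cases i <;> simp [field, c3] <;> ring
    rw [e, e', map_smul, map_sub, lu] at h3
    exact sub_right_injective (smul_right_injective Jet (mul_ne_zero hγ hE0) h3)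
  have lt : L ![1, 0, 0, 0, 0] = ![1, 0, -(a₃ * E * f), a₃ * E * f, 0] := by
    have e : field ![1, 0, 0, a₃, 0] z = ![1, 0, 0, 0, 0] +
        (a₃ * E) • (![0, 0, 1, 0, 0] - ![0, 0, 0, 1, 0]) := by
      ext i; fin_cases i <;> simp [field, hE]
    rw [e, map_add, map_smul, map_sub, lu, lp] at h0
    rw [eq_sub_of_add_eq h0]
    ext i; fin_cases i <;> simp [field]
  -- The two-form vanishes on (∂_p, ∂_q), so L ∂_q has no ∂_x component.
  have k1 := hh ![0, 0, 0, 1, 0] ![0, 0, 0, 0, 1] (by simp [contactForm]) (by simp [contactForm])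
  have ez4 : z' 4 = α * f * z 4 := by linarith
  have hz4 : z' 4 ≠ 0 := by rw [ez4]; positivity
  rw [lp] at k1
  simp [heatForm, hz4, hf] at k1
  have e4 : field ![0, b₁, b₂, a₃, 1] z = (b₁ - z 1) • ![0, 1, 0, 0, 0] +
      (b₂ + a₃ * E + z 2) • ![0, 0, 1, 0, 0] + (z 3 - a₃ * E) • ![0, 0, 0, 1, 0] +
      (2 * z 4) • ![0, 0, 0, 0, 1] := by
    ext i; fin_cases i <;> simp [field, hE]
    ring
  rw [e4, map_add, map_add, map_add, map_smul, map_smul, map_smul, map_smul, lx, lu, lp] at h4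
  have ex := congrFun h4 1
  have eq := congrFun h4 4
  simp [field, k1] at ex eq
  have k2 := hh ![0, 0, 0, 0, 1] (![1, 0, 0, 0, 0] + z 3 • ![0, 0, 1, 0, 0])
    (by simp [contactForm]) (by simp [contactForm])
  rw [map_add, map_smul, lt, lu] at k2
  simp [heatForm, k1] at k2
  have k3 := hh ![0, 0, 0, 1, 0] (![0, 1, 0, 0, 0] + z 4 • ![0, 0, 1, 0, 0])
    (by simp [contactForm]) (by simp [contactForm])
  rw [map_add, map_smul, lx, lp, lu] at k3
  simp [heatForm] at k3
  -- The pairs (∂_q, D_t) and (∂_p, D_x) give two expressions for the multiplier of the two-form.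
  -- With the u_x component of the relation for X₅ they agree only if the contact factor is α.
  have hfα : f = α := by
    rw [ez4, ← k2] at k3
    rw [ez4] at eq
    field_simp at k3 eq
    rw [eq] at k3
    exact mul_left_cancel₀ hf (by linarith)
  subst hfα
  have hpos : 0 < γ * f := by
    have : γ * f = Real.exp (-z' 0) / E := by rw [c3]; field_simp
    rw [this]
    positivity
  refine ⟨hpos, ?_⟩
  have e0 : z' 0 = z 0 - Real.log (γ * f) := by
    have : Real.exp (-z' 0) = Real.exp (Real.log (γ * f) + -z 0) := by
      rw [c3, Real.exp_add, Real.exp_log hpos]; ring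
    have := Real.exp_injective this
    linarith
  have e1 : z' 1 = f⁻¹ * (z 1 - b₁) := by linarith
  have e2 : z' 2 = f * (z 2 + b₂ + a₃ * E) := by
    rw [e1, ez4] at c4
    field_simp at c4
    linarith
  ext i
  fin_cases i
  · exact e0
  · exact e1
  · exact e2
  · simp; linarith
  · simp; rw [ez4]; ring

theorem map₁_map₂ (z : Jet) : map₁ (map₂ z) = map₂ (map₁ z) := by
  ext i
  fin_cases i <;> simp [map₁, map₂] <;> ring

theorem map₁_groupMap (a b c d k : ℝ) (z : Jet) :
    map₁ (groupMap a b c d k z) = groupMap a (-b) (-c) (-d) k (map₁ z) := by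
  ext i
  fin_cases i <;> simp [map₁, groupMap] <;> ring

/-- Conjugation by Γ₂ exchanges the translations of x and u and inverts the scaling. The sign κ
enters through exp(-ln |u_x|) = κ / u_x. -/
theorem map₂_groupMap {κ : ℤˣ} (a b c d k : ℝ) {z : Jet} (hz : z ∈ region κ) :
    map₂ (groupMap a b c d k z) = groupMap (a + 2 * k) c b
      (-(((κ : ℤ) : ℝ) * d * Real.exp (-(2 * k)))) (-k) (map₂ z) := by
  have h4 := ne_zero_of_mem hz
  have hinv : |z 4|⁻¹ = ((κ : ℤ) : ℝ) * (z 4)⁻¹ := by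
    have h : 0 < ((κ : ℤ) : ℝ) * z 4 := hz
    rcases Int.units_eq_one_or κ with rfl | rfl
    · simp at h
      simp [abs_of_pos h]
    · simp at h
      simp [abs_of_neg h]
  have hκ : ((κ : ℤ) : ℝ) * ((κ : ℤ) : ℝ) = 1 := by
    rcases Int.units_eq_one_or κ with rfl | rfl <;> simp
  have e1 : Real.exp (2 * k) = Real.exp k * Real.exp k := by rw [← Real.exp_add]; ring_nf
  have e2 : Real.exp (-(2 * k)) = (Real.exp k)⁻¹ * (Real.exp k)⁻¹ := by
    rw [Real.exp_neg, e1, mul_inv]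
  have hk : Real.exp k ≠ 0 := (Real.exp_pos _).ne'
  have e3 : Real.exp (-(z 0 + Real.log (z 4))) = ((κ : ℤ) : ℝ) * (z 4)⁻¹ * Real.exp (-z 0) := by
    rw [neg_add, Real.exp_add, ← Real.log_abs, ← Real.log_inv, Real.exp_log (by positivity), hinv]
    ring
  have e4 : Real.log |Real.exp (2 * k) * z 4| = 2 * k + Real.log |z 4| := by
    rw [abs_mul, Real.log_mul (by positivity) (by positivity), Real.abs_exp, Real.log_exp]
  generalize ((κ : ℤ) : ℝ) = s at *
  ext i
  fin_cases i
  · change z 0 + a + Real.log |Real.exp (2 * k) * z 4| = z 0 + Real.log |z 4| + (a + 2 * k)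
    rw [e4]
    ring
  · simp [map₂, groupMap]
    ring
  · simp [map₂, groupMap, -neg_add_rev, e3, e1, e2, Real.exp_neg k]
    field_simp
    linear_combination (d * Real.exp (-z 0)) * hκ
  · simp [map₂, groupMap, -neg_add_rev, e3, e1, e2, Real.exp_neg k]
    field_simp
    linear_combination (-(d * Real.exp (-z 0))) * hκ
  · simp [map₂, groupMap, e1, Real.exp_neg]
    field_simp


/-- The reconstructed formula scales by α, whereas `groupMap` scales by exp k > 0. With k = ln |α|
the sign of α decides whether Γ₁ is needed. -/
theorem IsContactSymmetryOn.exists_groupMap_of_automorphism {U : Set Jet} (hU : IsOpen U)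
    (hc : IsConnected U) (hq : ∀ z ∈ U, z 4 ≠ 0) {Γ : Jet → Jet} (h : IsContactSymmetryOn U Γ)
    {C : (Fin 5 → ℝ) → Fin 5 → ℝ}
    (hC : ∀ z ∈ U, ∀ a, fderiv ℝ Γ z (field (C a) z) = field a (Γ z))
    (hbr : ∀ a b, C (bracket a b) = bracket (C a) (C b)) (h1 : C ![0, 1, 0, 0, 0] 1 ≠ 0) :
    ∃ a b c d k : ℝ, (∀ z ∈ U, Γ z = groupMap a b c d k z) ∨
      ∀ z ∈ U, Γ z = groupMap a b c d k (map₁ z) := by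
  obtain ⟨w, hw⟩ := hc.nonempty
  obtain ⟨C, rfl⟩ := exists_linearMap (hq w hw) (h.bijective_fderiv w hw).1 (hC w hw)
  have hinj : ∀ a, C a = 0 → a = 0 := fun a ha => by
    have e := hC w hw a
    have h0 : ∀ z, field 0 z = 0 := fun z => by simp [field_eq_sum]
    rw [ha, h0, map_zero, ← h0 (Γ w)] at e
    exact (field_injective (h.ux_ne_zero w hw) e).symm
  obtain ⟨a₃, α, β, γ, b₁, b₂, hα, -, hγ, e0, e1, e2, e3, e4⟩ := automorphism_point hinj hbr h1
  have key : ∀ z ∈ U, _ := fun z hz => eq_of_automorphism (hq z hz) (h.preservesAt hU hq hz) hα hγ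
    (e0 ▸ hC z hz _) (e1 ▸ hC z hz _) (e2 ▸ hC z hz _) (e3 ▸ hC z hz _) (e4 ▸ hC z hz _)
  have hexp : Real.exp (Real.log α) = |α| := Real.exp_log_eq_abs hα
  have hexp' : Real.exp (-Real.log α) = |α|⁻¹ := by rw [Real.exp_neg, hexp]
  have hexp2 : Real.exp (2 * Real.log α) = α ^ 2 := by
    rw [two_mul, Real.exp_add, hexp, abs_mul_abs_self, sq]
  refine ⟨-Real.log (γ * α), -(α⁻¹ * b₁), α * b₂, α * a₃, Real.log α, ?_⟩
  rcases lt_or_gt_of_ne hα with hneg | hpos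
  · refine Or.inr fun z hz => ?_
    rw [(key z hz).2]
    ext i
    fin_cases i <;>
      simp [groupMap, map₁, hexp, hexp', hexp2, abs_of_neg hneg, inv_neg] <;> ring
  · refine Or.inl fun z hz => ?_
    rw [(key z hz).2]
    ext i
    fin_cases i <;> simp [groupMap, hexp, hexp', hexp2, abs_of_pos hpos] <;> ring

/-- On a connected open set, every contact symmetry is one of four standard ones followed by an
element of the five-parameter group. -/
theorem IsContactSymmetryOn.exists_groupMap {κ : ℤˣ} {U : Set Jet} (hU : IsOpen U)
    (hc : IsConnected U) (hκ : U ⊆ region κ) {Γ : Jet → Jet} (h : IsContactSymmetryOn U Γ) :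
    ∃ a b c d k : ℝ, (∀ z ∈ U, Γ z = groupMap a b c d k z) ∨
      (∀ z ∈ U, Γ z = groupMap a b c d k (map₁ z)) ∨
      (∀ z ∈ U, Γ z = groupMap a b c d k (map₂ z)) ∨
      ∀ z ∈ U, Γ z = groupMap a b c d k (map₁ (map₂ z)) := by
  have hq : ∀ z ∈ U, z 4 ≠ 0 := fun z hz => ne_zero_of_mem (hκ hz)
  obtain ⟨C, hC, hbr⟩ := h.exists_automorphism hU hc hq
  by_cases h1 : C ![0, 1, 0, 0, 0] 1 = 0
  · obtain ⟨w, hw⟩ := hc.nonempty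
    have hΓ : ∀ y ∈ Γ '' U, y 4 ≠ 0 := by
      rintro _ ⟨z, hz, rfl⟩
      exact h.ux_ne_zero z hz
    -- The derivative of `map₂` sends ∂_u to ∂_x, so composing with it turns the exchanging shape
    -- into the preserving one.
    have h' : IsContactSymmetryOn U (map₂ ∘ Γ) :=
      (isContactSymmetryOn_map₂ hΓ).comp hU (h.exists_inverse hU hq).1 hq hΓ h
        fun z hz => mem_image_of_mem Γ hz
    obtain ⟨C', hC', hbr'⟩ := h'.exists_automorphism hU hc hq
    have hne : C' ![0, 1, 0, 0, 0] 1 ≠ 0 := by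
      have hd : fderiv ℝ (map₂ ∘ Γ) w (field (C ![0, 0, 1, 0, 0]) w) =
          field ![0, 1, 0, 0, 0] ((map₂ ∘ Γ) w) := by
        have hm : DifferentiableAt ℝ map₂ (Γ w) :=
          (isContactSymmetryOn_map₂ hΓ).differentiableAt (h.exists_inverse hU hq).1
            (mem_image_of_mem Γ hw)
        rw [fderiv_comp w hm (h.differentiableAt hU hw), ContinuousLinearMap.comp_apply,
          hC w hw, fderiv_map₂ (h.ux_ne_zero w hw)]
        ext i
        fin_cases i <;> simp [field]
      rw [← hC' w hw] at hd
      have e := field_injective (hq w hw) ((h'.bijective_fderiv w hw).1 hd)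
      rw [← e]
      obtain ⟨C, rfl⟩ := exists_linearMap (hq w hw) (h.bijective_fderiv w hw).1 (hC w hw)
      have hinj : ∀ a, C a = 0 → a = 0 := fun a ha => by
        have e := hC w hw a
        have h0 : ∀ z, field 0 z = 0 := fun z => by simp [field_eq_sum]
        rw [ha, h0, map_zero, ← h0 (Γ w)] at e
        exact (field_injective (h.ux_ne_zero w hw) e).symm
      obtain ⟨-, -, -, -, ⟨-, α, β, hα, hβ, e1, e2⟩ | ⟨α, β, hα, hβ, e1, e2⟩⟩ :=
        automorphism_derived hinj hbr
      · simp [e1, hα] at h1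
      · simpa [e2] using hβ
    obtain ⟨a, b, c, d, k, hG⟩ := h'.exists_groupMap_of_automorphism hU hc hq hC' hbr' hne
    have hΓ₂ : ∀ z ∈ U, Γ z = map₂ ((map₂ ∘ Γ) z) := fun z hz =>
      (map₂_map₂ (h.ux_ne_zero z hz)).symm
    refine ⟨a + 2 * k, c, b, -(((κ : ℤ) : ℝ) * d * Real.exp (-(2 * k))), -k, Or.inr (Or.inr (hG.imp (fun hG z hz => ?_) fun hG z hz => ?_))⟩
    · rw [hΓ₂ z hz, hG z hz, map₂_groupMap a b c d k (hκ hz)]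
    · rw [hΓ₂ z hz, hG z hz, map₂_groupMap a b c d k (map₁_mem (hκ hz)), map₁_map₂]
  · obtain ⟨a, b, c, d, k, hG⟩ := h.exists_groupMap_of_automorphism hU hc hq hC hbr h1
    exact ⟨a, b, c, d, k, hG.imp_right Or.inl⟩


/-! ### The group of contact symmetries of a region. -/

section
variable {κ : ℤˣ}

theorem extend_coe (σ : Equiv.Perm (region κ)) (z : region κ) : extend σ z = σ z := by
  simp [extend]

theorem extend_of_mem (σ : Equiv.Perm (region κ)) {z : Jet} (hz : z ∈ region κ) :
    extend σ z = σ ⟨z, hz⟩ := extend_coe σ ⟨z, hz⟩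

theorem isOpen_region : IsOpen (region κ) :=
  isOpen_lt continuous_const (continuous_const.mul (continuous_apply 4))

theorem isConnected_region : IsConnected (region κ) := by
  refine ⟨⟨![0, 0, 0, 0, ((κ : ℤ) : ℝ)], ?_⟩, Convex.isPreconnected ?_⟩
  · rcases Int.units_eq_one_or κ with rfl | rfl <;> simp [region]
  · intro z hz w hw a b ha hb hab
    simp only [region, mem_ofPred_eq] at hz hw ⊢
    simp only [Pi.add_apply, Pi.smul_apply, smul_eq_mul]
    have e : ((κ : ℤ) : ℝ) * (a * z 4 + b * w 4) =
        a * (((κ : ℤ) : ℝ) * z 4) + b * (((κ : ℤ) : ℝ) * w 4) := by ring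
    rw [e]
    rcases ha.eq_or_lt with rfl | ha
    · rw [zero_add] at hab
      simpa [hab] using hw
    · positivity

theorem ux_ne_zero_of_mem_region : ∀ z ∈ region κ, z 4 ≠ 0 := fun _ => ne_zero_of_mem

theorem mul_mem_contactSymmetries {σ τ : Equiv.Perm (region κ)} (hσ : σ ∈ contactSymmetries κ)
    (hτ : τ ∈ contactSymmetries κ) : σ * τ ∈ contactSymmetries κ := by
  have hm : ∀ z ∈ region κ, extend τ z ∈ region κ := fun z hz => by
    rw [extend_of_mem τ hz]
    exact (τ _).2
  refine (IsContactSymmetryOn.comp isOpen_region isOpen_region ux_ne_zero_of_mem_region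
    ux_ne_zero_of_mem_region hσ hτ hm).congr isOpen_region fun z hz => ?_
  rw [Function.comp_apply, extend_of_mem _ hz, extend_of_mem τ hz, extend_coe]
  rfl

theorem inv_mem_contactSymmetries {σ : Equiv.Perm (region κ)} (hσ : σ ∈ contactSymmetries κ) :
    σ⁻¹ ∈ contactSymmetries κ := by
  obtain ⟨-, g, hg, hgσ⟩ := IsContactSymmetryOn.exists_inverse isOpen_region
    ux_ne_zero_of_mem_region hσ
  have hsub : region κ ⊆ extend σ '' region κ := fun z hz =>
    ⟨_, (σ⁻¹ ⟨z, hz⟩).2, by rw [extend_coe, Equiv.Perm.inv_def, Equiv.apply_symm_apply]⟩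
  refine (hg.mono hsub).congr isOpen_region fun z hz => ?_
  have := hgσ _ (σ⁻¹ ⟨z, hz⟩).2
  rw [extend_coe, Equiv.Perm.inv_def, Equiv.apply_symm_apply] at this
  rw [extend_of_mem _ hz]
  exact this.symm

theorem mem_contactSymmetries_of_eqOn {σ : Equiv.Perm (region κ)} {Γ : Jet → Jet}
    (h : IsContactSymmetryOn (region κ) Γ) (hσ : ∀ z : region κ, (σ z : Jet) = Γ z) :
    σ ∈ contactSymmetries κ :=
  h.congr isOpen_region fun z hz => by rw [extend_of_mem _ hz, hσ]

/-- The elements of the five-parameter group, as permutations of a region. -/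
noncomputable def groupPerm (κ : ℤˣ) (a b c d k : ℝ) : Equiv.Perm (region κ) where
  toFun z := ⟨groupMap a b c d k z, groupMap_mem a b c d k z.2⟩
  invFun z := ⟨groupMap (-a) (-(Real.exp k * b)) (-(Real.exp (-k) * c))
    (-(Real.exp (-k) * (d * Real.exp a))) (-k) z, groupMap_mem _ _ _ _ _ z.2⟩
  left_inv z := Subtype.ext (groupMap_inverse a b c d k z)
  right_inv z := Subtype.ext (by
    have e1 : Real.exp k * Real.exp (-k) = 1 := by rw [← Real.exp_add]; simp
    change groupMap a b c d k (groupMap _ _ _ _ _ z) = z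
    rw [groupMap_groupMap]
    have h1 : b + Real.exp (-k) * -(Real.exp k * b) = 0 := by linear_combination (-b) * e1
    have h2 : c + Real.exp k * -(Real.exp (-k) * c) = 0 := by linear_combination (-c) * e1
    have h3 : Real.exp k * -(Real.exp (-k) * (d * Real.exp a)) + d * Real.exp (- -a) = 0 := by
      rw [neg_neg]
      linear_combination (-d * Real.exp a) * e1
    rw [h1, h2, h3, add_neg_cancel, add_neg_cancel, groupMap_zero])

theorem groupPerm_apply (a b c d k : ℝ) (z : region κ) :
    (groupPerm κ a b c d k z : Jet) = groupMap a b c d k z := rfl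

theorem groupPerm_mul (a b c d k a' b' c' d' k' : ℝ) :
    groupPerm κ a b c d k * groupPerm κ a' b' c' d' k' =
      groupPerm κ (a + a') (b + Real.exp (-k) * b') (c + Real.exp k * c')
        (Real.exp k * d' + d * Real.exp (-a')) (k + k') :=
  Equiv.ext fun z => Subtype.ext (groupMap_groupMap a b c d k a' b' c' d' k' z)

theorem groupPerm_zero : groupPerm κ 0 0 0 0 0 = 1 :=
  Equiv.ext fun z => Subtype.ext (groupMap_zero z)

theorem groupPerm_inv (a b c d k : ℝ) : (groupPerm κ a b c d k)⁻¹ =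
    groupPerm κ (-a) (-(Real.exp k * b)) (-(Real.exp (-k) * c))
      (-(Real.exp (-k) * (d * Real.exp a))) (-k) :=
  Equiv.ext fun _ => rfl

theorem groupPerm_mem_contactSymmetries (a b c d k : ℝ) :
    groupPerm κ a b c d k ∈ contactSymmetries κ :=
  mem_contactSymmetries_of_eqOn
    (isContactSymmetryOn_groupMap ux_ne_zero_of_mem_region a b c d k) (groupPerm_apply a b c d k)

theorem Γ₁_apply (z : region κ) : (Γ₁ κ z : Jet) = map₁ z := rfl

theorem Γ₂_apply (z : region κ) : (Γ₂ κ z : Jet) = map₂ z := rfl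

theorem Γ₁_mem_contactSymmetries : Γ₁ κ ∈ contactSymmetries κ :=
  mem_contactSymmetries_of_eqOn (isContactSymmetryOn_map₁ ux_ne_zero_of_mem_region) Γ₁_apply

theorem Γ₂_mem_contactSymmetries : Γ₂ κ ∈ contactSymmetries κ :=
  mem_contactSymmetries_of_eqOn (isContactSymmetryOn_map₂ ux_ne_zero_of_mem_region) Γ₂_apply

theorem Γ₁_mul_self : Γ₁ κ * Γ₁ κ = 1 :=
  Equiv.ext fun z => Subtype.ext (map₁_map₁ z)

theorem Γ₂_mul_self : Γ₂ κ * Γ₂ κ = 1 :=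
  Equiv.ext fun z => Subtype.ext (map₂_map₂ (ne_zero_of_mem z.2))

theorem Γ₁_mul_Γ₂ : Γ₁ κ * Γ₂ κ = Γ₂ κ * Γ₁ κ :=
  Equiv.ext fun z => Subtype.ext (map₁_map₂ z)

theorem Γ₁_mul_groupPerm (a b c d k : ℝ) :
    Γ₁ κ * groupPerm κ a b c d k = groupPerm κ a (-b) (-c) (-d) k * Γ₁ κ :=
  Equiv.ext fun z => Subtype.ext (map₁_groupMap a b c d k z)

theorem Γ₂_mul_groupPerm (a b c d k : ℝ) :
    Γ₂ κ * groupPerm κ a b c d k = groupPerm κ (a + 2 * k) c b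
      (-(((κ : ℤ) : ℝ) * d * Real.exp (-(2 * k)))) (-k) * Γ₂ κ :=
  Equiv.ext fun z => Subtype.ext (map₂_groupMap a b c d k z.2)

/-- The five-parameter group, as a group of permutations of a region. -/
noncomputable def pointGroup (κ : ℤˣ) : Subgroup (Equiv.Perm (region κ)) where
  carrier := {σ | ∃ a b c d k, groupPerm κ a b c d k = σ}
  mul_mem' := by
    rintro _ _ ⟨a, b, c, d, k, rfl⟩ ⟨a', b', c', d', k', rfl⟩
    exact ⟨_, _, _, _, _, (groupPerm_mul a b c d k a' b' c' d' k').symm⟩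
  one_mem' := ⟨0, 0, 0, 0, 0, groupPerm_zero⟩
  inv_mem' := by
    rintro _ ⟨a, b, c, d, k, rfl⟩
    exact ⟨_, _, _, _, _, (groupPerm_inv a b c d k).symm⟩

theorem groupPerm_mem (a b c d k : ℝ) : groupPerm κ a b c d k ∈ pointGroup κ :=
  ⟨a, b, c, d, k, rfl⟩

theorem coe_symmetryGroup :
    (symmetryGroup κ : Set (Equiv.Perm (region κ))) = contactSymmetries κ := by
  refine Subset.antisymm (fun σ hσ => ?_) Subgroup.subset_closure
  induction hσ using Subgroup.closure_induction with
  | mem σ h => exact h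
  | one =>
    rw [← groupPerm_zero]
    exact groupPerm_mem_contactSymmetries 0 0 0 0 0
  | mul σ τ _ _ hσ hτ => exact mul_mem_contactSymmetries hσ hτ
  | inv σ _ hσ => exact inv_mem_contactSymmetries hσ

/-- The two generators of the discrete group, as a homomorphism. -/
noncomputable def discreteHom (κ : ℤˣ) :
    Multiplicative (ZMod 2) × Multiplicative (ZMod 2) →* Equiv.Perm (region κ) where
  toFun x := Γ₁ κ ^ (Multiplicative.toAdd x.1).val * Γ₂ κ ^ (Multiplicative.toAdd x.2).val
  map_one' := by simp
  map_mul' := by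
    have h1 : ∀ x y : ZMod 2, Γ₁ κ ^ (x + y).val = Γ₁ κ ^ x.val * Γ₁ κ ^ y.val := fun x y => by
      rw [ZMod.val_add, ← pow_add, ← pow_mod_orderOf, Nat.mod_mod_of_dvd,  pow_mod_orderOf]
      exact orderOf_dvd_of_pow_eq_one (by rw [sq, Γ₁_mul_self])
    have h2 : ∀ x y : ZMod 2, Γ₂ κ ^ (x + y).val = Γ₂ κ ^ x.val * Γ₂ κ ^ y.val := fun x y => by
      rw [ZMod.val_add, ← pow_add, ← pow_mod_orderOf, Nat.mod_mod_of_dvd,  pow_mod_orderOf]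
      exact orderOf_dvd_of_pow_eq_one (by rw [sq, Γ₂_mul_self])
    have hc : Commute (Γ₁ κ) (Γ₂ κ) := Γ₁_mul_Γ₂
    intro x y
    simp only [Prod.fst_mul, Prod.snd_mul, toAdd_mul, h1, h2]
    exact ((hc.pow_pow _ _).symm.mul_mul_mul_comm _ _).symm

theorem range_discreteHom : (discreteHom κ).range = discreteGroup κ := by
  refine le_antisymm ?_ ((Subgroup.closure_le _).mpr ?_)
  · rintro _ ⟨x, rfl⟩
    exact mul_mem (pow_mem (Subgroup.subset_closure (by simp)) _)
      (pow_mem (Subgroup.subset_closure (by simp)) _)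
  · rintro σ (rfl | rfl)
    · exact ⟨(Multiplicative.ofAdd 1, 1), by simp [discreteHom, ZMod.val_one]⟩
    · exact ⟨(1, Multiplicative.ofAdd 1), by simp [discreteHom, ZMod.val_one]⟩

theorem mem_discreteGroup {δ : Equiv.Perm (region κ)} :
    δ ∈ discreteGroup κ ↔ δ = 1 ∨ δ = Γ₁ κ ∨ δ = Γ₂ κ ∨ δ = Γ₁ κ * Γ₂ κ := by
  constructor
  · rw [← range_discreteHom]
    rintro ⟨⟨x, y⟩, rfl⟩
    have h : ∀ x : ZMod 2, x.val = 0 ∨ x.val = 1 := by decide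
    rcases h (Multiplicative.toAdd x) with hx | hx <;>
      rcases h (Multiplicative.toAdd y) with hy | hy <;> simp [discreteHom, hx, hy]
  · have h1 : Γ₁ κ ∈ discreteGroup κ := Subgroup.subset_closure (by simp)
    have h2 : Γ₂ κ ∈ discreteGroup κ := Subgroup.subset_closure (by simp)
    rintro (rfl | rfl | rfl | rfl)
    exacts [one_mem _, h1, h2, mul_mem h1 h2]

theorem discreteGroup_le : discreteGroup κ ≤ symmetryGroup κ := by
  refine (Subgroup.closure_le _).mpr ?_
  rintro σ (rfl | rfl)
  · exact Subgroup.subset_closure Γ₁_mem_contactSymmetries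
  · exact Subgroup.subset_closure Γ₂_mem_contactSymmetries

theorem pointGroup_le : pointGroup κ ≤ symmetryGroup κ := by
  rintro _ ⟨a, b, c, d, k, rfl⟩
  exact Subgroup.subset_closure (groupPerm_mem_contactSymmetries a b c d k)

theorem exists_mul_discrete {U : Set Jet} (hU : IsOpen U) (hc : IsConnected U)
    (hκ : U ⊆ region κ) {Γ : Jet → Jet} (h : IsContactSymmetryOn U Γ) :
    ∃ g ∈ pointGroup κ, ∃ δ ∈ discreteGroup κ,
      ∀ z : region κ, (z : Jet) ∈ U → Γ z = (g (δ z) : Jet) := by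
  obtain ⟨a, b, c, d, k, hG⟩ := h.exists_groupMap hU hc hκ
  refine ⟨_, groupPerm_mem a b c d k, ?_⟩
  rcases hG with hG | hG | hG | hG
  · exact ⟨1, mem_discreteGroup.mpr (by simp), fun z hz => hG z hz⟩
  · exact ⟨Γ₁ κ, mem_discreteGroup.mpr (by simp), fun z hz => hG z hz⟩
  · exact ⟨Γ₂ κ, mem_discreteGroup.mpr (by simp), fun z hz => hG z hz⟩
  · exact ⟨Γ₁ κ * Γ₂ κ, mem_discreteGroup.mpr (by simp), fun z hz => hG z hz⟩

theorem exists_mul_eq {σ : Equiv.Perm (region κ)} (h : σ ∈ contactSymmetries κ) :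
    ∃ g ∈ pointGroup κ, ∃ δ ∈ discreteGroup κ, g * δ = σ := by
  obtain ⟨g, hg, δ, hδ, e⟩ := exists_mul_discrete isOpen_region isConnected_region Subset.rfl h
  refine ⟨g, hg, δ, hδ, Equiv.ext fun z => Subtype.ext ?_⟩
  rw [← extend_coe σ, e z z.2]
  rfl

theorem discrete_conj_mem {δ g : Equiv.Perm (region κ)} (hδ : δ ∈ discreteGroup κ)
    (hg : g ∈ pointGroup κ) : δ * g * δ⁻¹ ∈ pointGroup κ := by
  have h1 : ∀ g ∈ pointGroup κ, Γ₁ κ * g * (Γ₁ κ)⁻¹ ∈ pointGroup κ := by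
    rintro _ ⟨a, b, c, d, k, rfl⟩
    rw [Γ₁_mul_groupPerm, mul_inv_cancel_right]
    exact groupPerm_mem _ _ _ _ _
  have h2 : ∀ g ∈ pointGroup κ, Γ₂ κ * g * (Γ₂ κ)⁻¹ ∈ pointGroup κ := by
    rintro _ ⟨a, b, c, d, k, rfl⟩
    rw [Γ₂_mul_groupPerm, mul_inv_cancel_right]
    exact groupPerm_mem _ _ _ _ _
  rcases mem_discreteGroup.mp hδ with rfl | rfl | rfl | rfl
  · simpa using hg
  · exact h1 g hg
  · exact h2 g hg
  · have e : Γ₁ κ * Γ₂ κ * g * (Γ₁ κ * Γ₂ κ)⁻¹ = Γ₁ κ * (Γ₂ κ * g * (Γ₂ κ)⁻¹) * (Γ₁ κ)⁻¹ := by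
      group
    rw [e]
    exact h1 _ (h2 g hg)

theorem discrete_mul_self {δ : Equiv.Perm (region κ)} (hδ : δ ∈ discreteGroup κ) : δ * δ = 1 := by
  rcases mem_discreteGroup.mp hδ with rfl | rfl | rfl | rfl
  · exact one_mul 1
  · exact Γ₁_mul_self
  · exact Γ₂_mul_self
  · nth_rewrite 2 [Γ₁_mul_Γ₂]
    rw [mul_assoc, ← mul_assoc (Γ₂ κ), Γ₂_mul_self, one_mul, Γ₁_mul_self]

/-- The discrete factor normalizes the five-parameter group and squares to 1, so it disappears from
the square. -/
theorem contactSymmetries_mul_self {σ : Equiv.Perm (region κ)} (h : σ ∈ contactSymmetries κ) :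
    σ * σ ∈ pointGroup κ := by
  obtain ⟨g, hg, δ, hδ, rfl⟩ := exists_mul_eq h
  have e : g * δ * (g * δ) = g * (δ * g * δ⁻¹) * (δ * δ) := by group
  rw [e, discrete_mul_self hδ, mul_one]
  exact mul_mem hg (discrete_conj_mem hδ hg)

theorem groupPerm_mem_continuousGroup {a b c d k : ℝ}
    (h : ∀ s s', groupPerm κ (s * a) (s * b) (s * c) (s * d) (s * k) *
      groupPerm κ (s' * a) (s' * b) (s' * c) (s' * d) (s' * k) =
      groupPerm κ ((s + s') * a) ((s + s') * b) ((s + s') * c) ((s + s') * d) ((s + s') * k)) :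
    groupPerm κ a b c d k ∈ continuousGroup κ := by
  let φ : Multiplicative ℝ →* Equiv.Perm (region κ) :=
    { toFun := fun s => groupPerm κ (s.toAdd * a) (s.toAdd * b) (s.toAdd * c) (s.toAdd * d)
        (s.toAdd * k)
      map_one' := by simpa using groupPerm_zero
      map_mul' := fun s s' => (h s.toAdd s'.toAdd).symm }
  refine Subgroup.subset_closure ⟨φ, ⟨?_, fun s => groupPerm_mem_contactSymmetries _ _ _ _ _⟩,
    Multiplicative.ofAdd 1, ?_⟩
  · have hs : ContDiff ℝ ∞ fun y : ℝ × Jet => y.1 := contDiff_fst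
    have hz : ∀ i, ContDiff ℝ ∞ fun y : ℝ × Jet => y.2 i := fun i =>
      (contDiff_coord i).comp contDiff_snd
    have hsm : ContDiff ℝ ∞ fun y : ℝ × Jet =>
        groupMap (y.1 * a) (y.1 * b) (y.1 * c) (y.1 * d) (y.1 * k) y.2 := by
      rw [contDiff_pi]
      intro i
      fin_cases i <;> simp only [groupMap, Fin.zero_eta, Fin.mk_one, Fin.reduceFinMk,
        Matrix.cons_val] <;> fun_prop
    refine hsm.contDiffOn.congr fun y hy => ?_
    rw [extend_of_mem _ hy.2]
    rfl
  · change groupPerm κ (1 * a) (1 * b) (1 * c) (1 * d) (1 * k) = _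
    simp only [one_mul]

/-- Each member of a one-parameter group is the square of the member at half the time, so it lies in
the five-parameter group; no continuity is needed. Conversely, the five-parameter group is generated
by five explicit one-parameter groups. -/
theorem continuousGroup_eq : continuousGroup κ = pointGroup κ := by
  refine le_antisymm ((Subgroup.closure_le _).mpr ?_) ?_
  · rintro _ ⟨φ, hφ, s, rfl⟩
    have e : φ s = φ (Multiplicative.ofAdd (s.toAdd / 2)) *
        φ (Multiplicative.ofAdd (s.toAdd / 2)) := by
      rw [← map_mul, ← ofAdd_add, add_halves, ofAdd_toAdd]
    rw [e]
    exact contactSymmetries_mul_self (hφ.mem _)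
  · rintro _ ⟨a, b, c, d, k, rfl⟩
    -- The factor exp a compensates for the translation of t, which acts first.
    have e : groupPerm κ a b c d k = groupPerm κ 0 b 0 0 0 * groupPerm κ 0 0 c 0 0 *
        groupPerm κ 0 0 0 (d * Real.exp a) 0 * groupPerm κ 0 0 0 0 k * groupPerm κ a 0 0 0 0 := by
      simp [groupPerm_mul, mul_assoc, ← Real.exp_add]
    rw [e]
    refine mul_mem (mul_mem (mul_mem (mul_mem ?_ ?_) ?_) ?_) ?_ <;>
      refine groupPerm_mem_continuousGroup fun s s' => ?_ <;>
      simp [groupPerm_mul, add_mul, add_comm]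

end


/-! ### Uniqueness of the discrete part, and point transformations. -/

theorem exists_pos_add_single {U : Set Jet} (hU : IsOpen U) {z : Jet} (hz : z ∈ U) (i : Fin 5) :
    ∃ ε > 0, z + Pi.single i ε ∈ U := by
  have hc : Continuous fun ε : ℝ => z + Pi.single i ε :=
    continuous_const.add (continuous_single (A := fun _ : Fin 5 => ℝ) i)
  have h0 : ∀ᶠ ε in nhds (0 : ℝ), z + Pi.single i ε ∈ U :=
    hc.continuousAt.preimage_mem_nhds (by simpa using hU.mem_nhds hz)
  obtain ⟨r, hr, h⟩ := Metric.eventually_nhds_iff.mp h0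
  exact ⟨r / 2, by positivity, h (by rw [Real.dist_eq, sub_zero, abs_of_pos] <;> linarith)⟩

section
variable {κ : ℤˣ}

/-- The elements of the discrete group are distinguished, up to the five-parameter group, by the
change of the new `x` and `u` with the old `x`. -/
theorem discrete_unique {U : Set Jet} (hU : IsOpen U) (hne : U.Nonempty) (hκ : U ⊆ region κ)
    {δ δ' g : Equiv.Perm (region κ)} (hδ : δ ∈ discreteGroup κ) (hδ' : δ' ∈ discreteGroup κ)
    (hg : g ∈ pointGroup κ) (h : ∀ z : region κ, (z : Jet) ∈ U → δ z = g (δ' z)) : δ = δ' := by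
  obtain ⟨z, hz⟩ := hne
  obtain ⟨a, b, c, d, k, rfl⟩ := hg
  -- Under x ↦ x + ε the increments of the new (x, u) have signs (+, 0), (-, 0), (0, +), (0, -) for
  -- 1, Γ₁, Γ₂, Γ₁Γ₂. The five-parameter group scales increments by positive factors only.
  obtain ⟨ε, hε, hw⟩ := exists_pos_add_single hU hz 1
  have hz' := congrArg Subtype.val (h ⟨z, hκ hz⟩ hz)
  have hw' := congrArg Subtype.val (h ⟨_, hκ hw⟩ hw)
  rw [groupPerm_apply] at hz' hw'
  have z1 := congrFun hz' 1
  have z2 := congrFun hz' 2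
  have w1 := congrFun hw' 1
  have w2 := congrFun hw' 2
  have p1 := mul_pos (Real.exp_pos (-k)) hε
  have p2 := mul_pos (Real.exp_pos k) hε
  rcases mem_discreteGroup.mp hδ with rfl | rfl | rfl | rfl <;>
    rcases mem_discreteGroup.mp hδ' with rfl | rfl | rfl | rfl <;>
    first
      | rfl
      | exfalso
        simp [groupMap, Γ₁_apply, Γ₂_apply, map₁, map₂] at z1 z2 w1 w2
        linarith

theorem isPointOn_of_equivalentOn {U : Set Jet} (hκ : U ⊆ region κ) {Γ : Jet → Jet}
    {δ : Equiv.Perm (region κ)} (hδ : δ = 1 ∨ δ = Γ₁ κ) (h : EquivalentOn U Γ δ) :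
    IsPointOn U Γ := by
  obtain ⟨g, hg, hΓ⟩ := h
  rw [continuousGroup_eq] at hg
  obtain ⟨a, b, c, d, k, rfl⟩ := hg
  intro z hz w hw h0 h1 h2
  rw [hΓ ⟨z, hκ hz⟩ hz, hΓ ⟨w, hκ hw⟩ hw, groupPerm_apply, groupPerm_apply]
  rcases hδ with rfl | rfl <;> simp [groupMap, Γ₁_apply, map₁, h0, h1, h2]

theorem not_isPointOn_of_equivalentOn {U : Set Jet} (hU : IsOpen U) (hne : U.Nonempty)
    (hκ : U ⊆ region κ) {Γ : Jet → Jet} {δ : Equiv.Perm (region κ)}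
    (hδ : δ = Γ₂ κ ∨ δ = Γ₁ κ * Γ₂ κ) (h : EquivalentOn U Γ δ) : ¬ IsPointOn U Γ := by
  obtain ⟨g, hg, hΓ⟩ := h
  rw [continuousGroup_eq] at hg
  obtain ⟨a, b, c, d, k, rfl⟩ := hg
  obtain ⟨z, hz⟩ := hne
  -- Varying u_x alone changes the new t, which contains ln |u_x|.
  obtain ⟨ε, hε, hw⟩ := exists_pos_add_single hU hz 4
  intro hp
  have e := (hp z hz _ hw (by simp) (by simp) (by simp)).1
  rw [hΓ ⟨z, hκ hz⟩ hz, hΓ ⟨_, hκ hw⟩ hw, groupPerm_apply, groupPerm_apply] at e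
  have hlog : Real.log (z 4) = Real.log (z 4 + ε) := by
    rcases hδ with rfl | rfl <;> simpa [groupMap, Γ₁_apply, Γ₂_apply, map₁, map₂] using e
  have hz4 : 0 < ((κ : ℤ) : ℝ) * z 4 := hκ hz
  have hw4 : 0 < ((κ : ℤ) : ℝ) * (z 4 + ε) := by simpa [region] using hκ hw
  rcases Int.units_eq_one_or κ with rfl | rfl
  · simp at hz4 hw4
    have := Real.log_injOn_pos hz4 hw4 hlog
    linarith
  · simp at hz4 hw4
    rw [← Real.log_neg_eq_log (z 4), ← Real.log_neg_eq_log (z 4 + ε)] at hlog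
    have := Real.log_injOn_pos (show -z 4 ∈ Ioi (0 : ℝ) by simpa using hz4)
      (show -(z 4 + ε) ∈ Ioi (0 : ℝ) by simp; linarith) hlog
    linarith

theorem exists_equivalentOn {U : Set Jet} (hU : IsOpen U) (hc : IsConnected U)
    (hκ : U ⊆ region κ) {Γ : Jet → Jet} (h : IsContactSymmetryOn U Γ) :
    ∃ δ ∈ discreteGroup κ, EquivalentOn U Γ δ := by
  obtain ⟨g, hg, δ, hδ, e⟩ := exists_mul_discrete hU hc hκ h
  exact ⟨δ, hδ, g, continuousGroup_eq ▸ hg, e⟩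

theorem existsUnique_equivalentOn {U : Set Jet} (hU : IsOpen U) (hc : IsConnected U)
    (hκ : U ⊆ region κ) {Γ : Jet → Jet} (h : IsContactSymmetryOn U Γ) :
    ∃! δ, δ ∈ discreteGroup κ ∧ EquivalentOn U Γ δ := by
  obtain ⟨δ, hδ, g, hg, e⟩ := exists_equivalentOn hU hc hκ h
  refine ⟨δ, ⟨hδ, g, hg, e⟩, ?_⟩
  rintro δ' ⟨hδ', g', hg', e'⟩
  rw [continuousGroup_eq] at hg hg'
  refine discrete_unique hU hc.nonempty hκ hδ' hδ (mul_mem (inv_mem hg') hg) fun z hz => ?_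
  have : g (δ z) = g' (δ' z) := Subtype.ext (by rw [← e z hz, e' z hz])
  rw [Equiv.Perm.mul_apply, this, ← Equiv.Perm.mul_apply, inv_mul_cancel]
  rfl

theorem not_isPointOn_iff {U : Set Jet} (hU : IsOpen U) (hc : IsConnected U)
    (hκ : U ⊆ region κ) {Γ : Jet → Jet} (h : IsContactSymmetryOn U Γ) :
    ¬ IsPointOn U Γ ↔ EquivalentOn U Γ (Γ₂ κ) ∨ EquivalentOn U Γ (Γ₁ κ * Γ₂ κ) := by
  constructor
  · intro hp
    obtain ⟨δ, hδ, e⟩ := exists_equivalentOn hU hc hκ h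
    rcases mem_discreteGroup.mp hδ with rfl | rfl | rfl | rfl
    · exact absurd (isPointOn_of_equivalentOn hκ (Or.inl rfl) e) hp
    · exact absurd (isPointOn_of_equivalentOn hκ (Or.inr rfl) e) hp
    · exact Or.inl e
    · exact Or.inr e
  · rintro (e | e)
    · exact not_isPointOn_of_equivalentOn hU hc.nonempty hκ (Or.inl rfl) e
    · exact not_isPointOn_of_equivalentOn hU hc.nonempty hκ (Or.inr rfl) e

theorem normal_pointGroup : ((pointGroup κ).subgroupOf (symmetryGroup κ)).Normal := by
  constructor
  rintro ⟨g, hg⟩ hgp ⟨σ, hσ⟩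
  rw [Subgroup.mem_subgroupOf] at hgp ⊢
  rw [← SetLike.mem_coe, coe_symmetryGroup] at hσ
  obtain ⟨n, hn, δ, hδ, rfl⟩ := exists_mul_eq hσ
  change n * δ * g * (n * δ)⁻¹ ∈ pointGroup κ
  have e : n * δ * g * (n * δ)⁻¹ = n * (δ * g * δ⁻¹) * n⁻¹ := by group
  rw [e]
  exact mul_mem (mul_mem hn (discrete_conj_mem hδ hgp)) (inv_mem hn)

theorem eq_one_of_mem {δ : Equiv.Perm (region κ)} (hδ : δ ∈ discreteGroup κ)
    (hg : δ ∈ pointGroup κ) : δ = 1 :=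
  discrete_unique isOpen_region isConnected_region.nonempty Subset.rfl hδ (one_mem _) hg
    fun _ _ => rfl

theorem isComplement_pointGroup : ((pointGroup κ).subgroupOf (symmetryGroup κ)).IsComplement'
    ((discreteGroup κ).subgroupOf (symmetryGroup κ)) := by
  refine Subgroup.isComplement'_of_disjoint_and_mul_eq_univ ?_ ?_
  · rw [Subgroup.disjoint_def]
    exact fun {x} hx hx' => Subtype.ext (eq_one_of_mem hx' hx)
  · refine eq_univ_of_forall ?_
    rintro ⟨σ, hσ⟩
    have hσ' := hσ
    rw [← SetLike.mem_coe, coe_symmetryGroup] at hσ'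
    obtain ⟨n, hn, δ, hδ, rfl⟩ := exists_mul_eq hσ'
    exact ⟨⟨n, pointGroup_le hn⟩, hn, ⟨δ, discreteGroup_le hδ⟩, hδ, rfl⟩

theorem discreteHom_injective : Function.Injective (discreteHom κ) := by
  rw [injective_iff_map_eq_one]
  rintro ⟨x, y⟩ hxy
  -- At x = 1, u = u_t = 0 the new x is 1, -1, 0, 0 for 1, Γ₁, Γ₂, Γ₁Γ₂, so only the identity fixes
  -- it.
  have hw : (![0, 1, 0, 0, ((κ : ℤ) : ℝ)] : Jet) ∈ region κ := by
    rcases Int.units_eq_one_or κ with rfl | rfl <;> simp [region]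
  have h := congrArg Subtype.val (Equiv.congr_fun hxy ⟨_, hw⟩)
  have h1 := congrFun h 1
  have hv : ∀ x : ZMod 2, x = 0 ∨ x = 1 := by decide
  rcases hv (Multiplicative.toAdd x) with hx | hx <;>
    rcases hv (Multiplicative.toAdd y) with hy | hy
  · exact Prod.ext hx hy
  all_goals
    exfalso
    simp [discreteHom, hx, hy, ZMod.val_one, Γ₁_apply, Γ₂_apply, map₁, map₂] at h1
    try linarith

theorem exists_mulEquiv :
    ∃ e : discreteGroup κ ≃* Multiplicative (ZMod 2) × Multiplicative (ZMod 2),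
      (∀ d : discreteGroup κ, (d : Equiv.Perm (region κ)) = Γ₁ κ →
        e d = (Multiplicative.ofAdd 1, 1)) ∧
      (∀ d : discreteGroup κ, (d : Equiv.Perm (region κ)) = Γ₂ κ →
        e d = (1, Multiplicative.ofAdd 1)) := by
  let e := (MonoidHom.ofInjective discreteHom_injective).trans
    (MulEquiv.subgroupCongr (range_discreteHom (κ := κ)))
  have he : ∀ x, (e x : Equiv.Perm (region κ)) = discreteHom κ x := fun _ => rfl
  refine ⟨e.symm, fun d hd => ?_, fun d hd => ?_⟩ <;>
    rw [MulEquiv.symm_apply_eq] <;> refine Subtype.ext ?_ <;> rw [he, hd]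
  · simp [discreteHom, ZMod.val_one]
  · simp [discreteHom, ZMod.val_one]

end


/-! ### The Lie algebra of generators, and the theorem. -/

/-- The space of the contact generators on `U`, as functions on `U`. -/
noncomputable def generators (U : Set Jet) : Submodule ℝ (U → Jet) :=
  Submodule.span ℝ (range fun i => U.domRestrict (basisField i))

theorem domRestrict_mem_generators {U : Set Jet} {X : Jet → Jet} :
    U.domRestrict X ∈ generators U ↔ ∃ c, ∀ z ∈ U, X z = field c z := by
  rw [generators, Submodule.mem_span_range_iff_exists_fun]
  refine exists_congr fun c => ?_
  rw [funext_iff]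
  simp only [Finset.sum_apply, Pi.smul_apply, Subtype.forall, field_eq_sum]
  exact forall₂_congr fun z hz => eq_comm

theorem linearIndependent_basisField {U : Set Jet} (hne : U.Nonempty) (hq : ∀ z ∈ U, z 4 ≠ 0) :
    LinearIndependent ℝ fun i => U.domRestrict (basisField i) := by
  obtain ⟨z, hz⟩ := hne
  rw [Fintype.linearIndependent_iff]
  intro c hc i
  have h : field c z = field 0 z := by
    have := congrFun hc ⟨z, hz⟩
    simp only [field_eq_sum]
    simpa using this
  rw [field_injective (hq z hz) h]
  rfl

theorem lieBracket_mem_generators {U : Set Jet} (hU : IsOpen U) {X Y : Jet → Jet}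
    (hX : U.domRestrict X ∈ generators U) (hY : U.domRestrict Y ∈ generators U) :
    U.domRestrict (VectorField.lieBracket ℝ X Y) ∈ generators U := by
  rw [domRestrict_mem_generators] at *
  obtain ⟨a, ha⟩ := hX
  obtain ⟨b, hb⟩ := hY
  refine ⟨bracket a b, fun z hz => ?_⟩
  have hXa : X =ᶠ[nhds z] field a := by
    filter_upwards [hU.mem_nhds hz] with y hy using ha y hy
  have hYb : Y =ᶠ[nhds z] field b := by
    filter_upwards [hU.mem_nhds hz] with y hy using hb y hy
  rw [hXa.lieBracket_vectorField_eq hYb, lieBracket_field]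

end HyperbolicHeat

theorem mainTheorem6 (κ : ℤˣ) :
    -- On every connected open set the generators form a Lie algebra with basis `X₁, …, X₅`.
    (∀ U : Set Jet, IsOpen U → IsConnected U → U ⊆ region κ →
      ∃ L : Submodule ℝ (U → Jet),
        (∀ X : Jet → Jet,
          IsContactGenerator U X ↔ U.domRestrict X ∈ L) ∧
        (∀ X Y : Jet → Jet, U.domRestrict X ∈ L → U.domRestrict Y ∈ L →
          U.domRestrict (VectorField.lieBracket ℝ X Y) ∈ L) ∧
        Module.finrank ℝ L = 5 ∧
        ∃ b : Module.Basis (Fin 5) ℝ L,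
          ∀ i, (b i : U → Jet) = U.domRestrict (basisField i)) ∧
    -- The contact symmetries of the region form a group, in which the continuous symmetries are a
    -- normal subgroup with complement `⟨Γ₁, Γ₂⟩ ≅ ℤ₂ × ℤ₂`.
    ((symmetryGroup κ : Set (Equiv.Perm (region κ))) =
        contactSymmetries κ ∧
      continuousGroup κ ≤ symmetryGroup κ ∧
      discreteGroup κ ≤ symmetryGroup κ ∧
      ((continuousGroup κ).subgroupOf (symmetryGroup κ)).Normal ∧
      ((continuousGroup κ).subgroupOf
          (symmetryGroup κ)).IsComplement'
        ((discreteGroup κ).subgroupOf (symmetryGroup κ)) ∧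
      ∃ e : discreteGroup κ ≃* Multiplicative (ZMod 2) × Multiplicative (ZMod 2),
        (∀ d : discreteGroup κ, (d : Equiv.Perm (region κ)) = Γ₁ κ →
          e d = (Multiplicative.ofAdd 1, 1)) ∧
        (∀ d : discreteGroup κ, (d : Equiv.Perm (region κ)) = Γ₂ κ →
          e d = (1, Multiplicative.ofAdd 1))) ∧
    -- Every contact symmetry, also one that is only defined on a connected open set, is equivalent
    -- to exactly one element of `⟨Γ₁, Γ₂⟩`; the non-point ones are those equivalent to `Γ₂` or
    -- `Γ₁ Γ₂`.
    (∀ U : Set Jet, IsOpen U → IsConnected U → U ⊆ region κ →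
      ∀ Γ : Jet → Jet, IsContactSymmetryOn U Γ →
        (∃! d, d ∈ discreteGroup κ ∧ EquivalentOn U Γ d) ∧
        (¬ IsPointOn U Γ ↔
          EquivalentOn U Γ (Γ₂ κ) ∨
          EquivalentOn U Γ (Γ₁ κ * Γ₂ κ))) := by
  refine ⟨fun U hU hc hκ => ?_, ⟨coe_symmetryGroup, continuousGroup_eq.trans_le pointGroup_le,
    discreteGroup_le, ?_, ?_, exists_mulEquiv⟩, fun U hU hc hκ Γ h =>
    ⟨existsUnique_equivalentOn hU hc hκ h, not_isPointOn_iff hU hc hκ h⟩⟩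
  · have hq : ∀ z ∈ U, z 4 ≠ 0 := fun z hz => ne_zero_of_mem (hκ hz)
    have hli := linearIndependent_basisField hc.nonempty hq
    refine ⟨generators U, fun X => ?_, fun X Y => lieBracket_mem_generators hU, ?_,
      Module.Basis.span hli, fun i => ?_⟩
    · rw [isContactGenerator_iff hU hc hq, domRestrict_mem_generators]
    · exact (finrank_span_eq_card hli).trans (Fintype.card_fin 5)
    · exact congrArg Subtype.val (Module.Basis.span_apply hli i)
  · rw [continuousGroup_eq]
    exact normal_pointGroup
  · rw [continuousGroup_eq]
    exact isComplement_pointGroup
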